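/- Let $d\in\{2,3\}$, $p>\frac{d+2}{2}$, $\Omega=\mathbb T^d=(\mathbb R/\mathbb Z)^d$. For $d\times d$ matrices put $A:B=\mathrm{tr}(AB)$ and $|A|=\sqrt{A:A^T}$; let $\mathbb S(d)$ be the symmetric matrices, $e(u)=(\nabla u+\nabla u^T)/2$, $W(s)=(1-s^2)^2/2$, $\sigma=\int_{-1}^1\sqrt{2W(s)}\,ds$. Let $V^{s,q}$ be the closure of the smooth divergence-free vector fields on $\Omega$ in $W^{s,q}(\Omega)^d$. There is a constant $c_K$ depending only on $p$ and $d$, for which Korn's inequality $\|v\|_{W^{1,p}}^p\le c_K(\|e(v)\|_{L^p}^p+\|v\|_{L^1}^p)$ holds for all $C^1$ vector fields $v$ on $\Omega$, where $\|v\|_{W^{1,p}}^p=\int_\Omega|v|^p+|\nabla v|^p\,dx$, such that the following is true. Data. Let $\nu_0>0$ and let $\tau^\pm:\mathbb S(d)\to\mathbb S(d)$ be locally Lipschitz with, for all $s,\hat s$, $$\nu_0|s|^p\le\tau^\pm(s):s\le\nu_0^{-1}(1+|s|^p),\quad |\tau^\pm(s)|\le\nu_0^{-1}(1+|s|^{p-1}),\quad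 (\tau^\pm(s)-\tau^\pm(\hat s)):(s-\hat s)\ge0,$$ and put $\tau(\varphi,s)=\frac{1+\varphi}{2}\tau^+(s)+\frac{1-\varphi}{2}\tau^-(s)$. Let $\varepsilon_i>0$, $\varepsilon_i\to0$, $0<\gamma<\frac12$, let $\zeta\in C_c^\infty(\mathbb R^d)$ be radially symmetric and non-negative with support in $B_1(0)$ and $\int\zeta=1$, and put $\zeta^{\varepsilon}(x)=\varepsilon^{-\gamma}\zeta(x/\varepsilon^{\gamma/d})$. Let $s>\frac d2+1$ be an integer, let $\{\omega_j\}$ be a basis of $V^{s,2}$ (a system with dense linear span, its elements being taken as their $C^1$ representatives) that is orthonormal in $V^{0,2}$, and let $P_i$ be the orthogonal projection of $V^{0,2}$ onto the span $V_i$ of the first $i$ of the $\omega_j$. Let $u_0\in V^{0,2}$, let $\Omega^+(0)\subset\Omega$ be open with $C^1$ boundary, and put $$E_0=\mathcal H^{d-1}(\partial\Omega^+(0))+\tfrac12\int_\Omega|u_0|^2\,dx .$$ Let $\varphi_0^{\varepsilon_i}\in C^3(\Omega)$ with $|\varphi_0^{\varepsilon_i}|\le1$ be initial data satisfying, as $i\to\infty$,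 $$\frac1\sigma\int_\Omega\Big(\frac{\varepsilon_i|\nabla\varphi_0^{\varepsilon_i}|^2}{2}+\frac{W(\varphi_0^{\varepsilon_i})}{\varepsilon_i}\Big)dx+\frac12\int_\Omega|P_iu_0|^2\,dx\le E_0+o(1).\qquad(*)$$ Solutions. A weak solution on $\Omega\times[0,T]$ is a pair $(u,\varphi)$ with $u(\cdot,t)\in V_i$ depending continuously on $t$, $|\varphi|\le1$, $\varphi(\cdot,t)\in C^3(\Omega)$ bounded in $C^3(\Omega)$ uniformly in $t\in[0,T]$, $\varphi(x,\cdot)$ continuous, and $$\partial_tu=P_i\Big(\mathrm{div}\,\tau(\varphi,e(u))-u\cdot\nabla u-\frac{\varepsilon_i}{\sigma}\mathrm{div}\big((\nabla\varphi\otimes\nabla\varphi)*\zeta^{\varepsilon_i}\big)\Big),\qquad \partial_t\varphi+(u*\zeta^{\varepsilon_i})\cdot\nabla\varphi=\Delta\varphi-\frac{W'(\varphi)}{\varepsilon_i^2},$$ $u(\cdot,0)=P_iu_0$, $\varphi(\cdot,0)=\varphi_0^{\varepsilon_i}$; both equations are understood integrated in time, the first one tested with the elements of $V_i$ (with the divergences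 integrated by parts), the second one at each point $x$. Conclusion. (1) There is a sequence $o(1)\to0$ as $i\to\infty$ such that for every $i$, every $T\ge0$ and every weak solution $(u^{\varepsilon_i},\varphi^{\varepsilon_i})$ on $\Omega\times[0,T]$ the integrand of the second integral below is integrable on $\Omega\times[0,T]$ and $$\int_\Omega\frac1\sigma\Big(\frac{\varepsilon_i|\nabla\varphi^{\varepsilon_i}(\cdot,T)|^2}{2}+\frac{W(\varphi^{\varepsilon_i}(\cdot,T))}{\varepsilon_i}\Big)+\frac{|u^{\varepsilon_i}(\cdot,T)|^2}{2}\,dx+\int_0^T\!\!\int_\Omega\frac{\varepsilon_i}{\sigma}\Big(\Delta\varphi^{\varepsilon_i}-\frac{W'(\varphi^{\varepsilon_i})}{\varepsilon_i^2}\Big)^2+\nu_0|e(u^{\varepsilon_i})|^p\,dx\,dt\le E_0+o(1).$$ (2) For all $0\le T_1<T_2<\infty$ there is a sequence $o(1)\to0$ as $i\to\infty$ such that for every $i$ and every weak solution on $\Omega\times[0,T]$ with $T\ge T_2$, the integrand below is integrable on $[T_1,T_2]$ and $$\int_{T_1}^{T_2}\|u^{\varepsilon_i}(\cdot,t)\|_{W^{1,p}(\Omega)}^p\,dt\le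 c_K\{\nu_0^{-1}E_0+(T_2-T_1)E_0^{p/2}\}+o(1).$$ -/

import Mathlib

open MeasureTheory Filter Topology
open scoped Gradient Laplacian Convolution ENNReal

noncomputable section

namespace TwoPhase

/-! Functions on the torus `𝕋^d = (ℝ/ℤ)^d` are `ℤ^d`-periodic functions on `ℝ^d`; integrals over the
torus are integrals over the unit cube. -/

/-- Euclidean space `ℝ^d`. -/
abbrev E (d : ℕ) : Type := EuclideanSpace ℝ (Fin d)

/-- The standard basis vector `e_a`. -/
def e {d : ℕ} (a : Fin d) : E d := EuclideanSpace.single a (1 : ℝ)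

/-- `f` is `ℤ^d`-periodic, i.e. a function on the torus. -/
def Periodic {d : ℕ} {F : Type*} (f : E d → F) : Prop := ∀ (a : Fin d) (x : E d), f (x + e a) = f x

/-- The unit cube `[0,1)^d`, a fundamental domain of the torus. -/
def cell (d : ℕ) : Set (E d) := {x | ∀ a, x a ∈ Set.Ico (0 : ℝ) 1}

/-! ### Matrices -/

/-- `A : B = tr (A B)`. -/
def ddot {d : ℕ} (A B : Matrix (Fin d) (Fin d) ℝ) : ℝ := (A * B).trace

/-- The Euclidean norm of a matrix; for symmetric `A` it is `√(A : A)`. -/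
def mnorm {d : ℕ} (A : Matrix (Fin d) (Fin d) ℝ) : ℝ := Real.sqrt (ddot A A.transpose)

/-- The symmetric `d × d` matrices. -/
def Sym (d : ℕ) : Type := {A : Matrix (Fin d) (Fin d) ℝ // A.IsSymm}

/-- The gradient of a vector field, with `(a, b)` entry `∂_b v_a`. -/
def grad {d : ℕ} (v : E d → E d) (x : E d) : Matrix (Fin d) (Fin d) ℝ :=
  Matrix.of fun a b => (fderiv ℝ v x (e b)) a

/-- The symmetric part `e(v) = (∇v + ∇vᵀ)/2` of the velocity gradient. -/
def symGrad {d : ℕ} (v : E d → E d) (x : E d) : Sym d :=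
  ⟨(1 / 2 : ℝ) • (grad v x + (grad v x).transpose), by
    unfold Matrix.IsSymm
    rw [Matrix.transpose_smul, Matrix.transpose_add, Matrix.transpose_transpose, add_comm]⟩

/-! ### Function spaces -/

/-- Iterated classical partial derivative along a word of coordinate directions. -/
def partialD {d : ℕ} (α : List (Fin d)) (f : E d → ℝ) : E d → ℝ :=
  α.foldr (fun a g x => fderiv ℝ g x (e a)) f

/-- `g` is the weak derivative, along the word `α`, of the function `f` on the torus. -/
def HasWeakDeriv {d : ℕ} (α : List (Fin d)) (f g : E d → ℝ) : Prop :=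
  ∀ ψ : E d → ℝ, ContDiff ℝ (⊤ : ℕ∞) ψ → Periodic ψ →
    ∫ x in cell d, f x * partialD α ψ x = (-1) ^ α.length * ∫ x in cell d, g x * ψ x

/-- The space `L^q` of the torus. -/
def InLp {d : ℕ} (q : ℝ≥0∞) (f : E d → ℝ) : Prop :=
  Periodic f ∧ MemLp f q (volume.restrict (cell d))

/-- The Sobolev space `W^{s,q}` of scalar functions on the torus. -/
def InW {d : ℕ} (s : ℕ) (q : ℝ≥0∞) (f : E d → ℝ) : Prop :=
  InLp q f ∧ ∀ α : List (Fin d), α.length ≤ s → ∃ g, InLp q g ∧ HasWeakDeriv α f g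

/-- The vector fields `w n` converge to `v` in the norm of `W^{s,q}` (all of them being in that
space): all weak derivatives of order at most `s` of all components converge in `L^q`. -/
def WTendsto {d : ℕ} (s : ℕ) (q : ℝ≥0∞) (w : ℕ → E d → E d) (v : E d → E d) : Prop :=
  (∀ n b, InW s q (fun x => w n x b)) ∧ (∀ b, InW s q (fun x => v x b)) ∧
  ∀ (b : Fin d) (α : List (Fin d)), α.length ≤ s →
    ∃ (h : ℕ → E d → ℝ) (g : E d → ℝ),
      (∀ n, InLp q (h n) ∧ HasWeakDeriv α (fun x => w n x b) (h n)) ∧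
      InLp q g ∧ HasWeakDeriv α (fun x => v x b) g ∧
      Tendsto (fun n => eLpNorm (h n - g) q (volume.restrict (cell d))) atTop (𝓝 0)

/-- The smooth divergence-free vector fields on the torus. -/
def SmoothSolenoidal {d : ℕ} (v : E d → E d) : Prop :=
  ContDiff ℝ (⊤ : ℕ∞) v ∧ Periodic v ∧ ∀ x, (grad v x).trace = 0

/-- `V^{s,q}`: the closure of the smooth divergence-free fields in the norm of `W^{s,q}`. -/
def InV {d : ℕ} (s : ℕ) (q : ℝ≥0∞) (v : E d → E d) : Prop :=
  ∃ w : ℕ → E d → E d, (∀ n, SmoothSolenoidal (w n)) ∧ WTendsto s q w v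

/-- The `L²` inner product of vector fields. -/
def l2 {d : ℕ} (v w : E d → E d) : ℝ := ∫ x in cell d, inner ℝ (v x) (w x)

/-- `ω` is a basis of `V^{s,2}`, orthonormal in `V^{0,2}`. Only completeness of the system
is asked for. Since `s > d/2 + 1`, elements of `V^{s,2}` have a unique `C¹` representative,
and `ω j` is that representative. -/
structure IsGalerkinBasis {d : ℕ} (s : ℕ) (ω : ℕ → E d → E d) : Prop where
  mem : ∀ j, InV s 2 (ω j)
  contDiff : ∀ j, ContDiff ℝ 1 (ω j)
  orthonormal : ∀ j k, l2 (ω j) (ω k) = if j = k then 1 else 0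
  complete : ∀ v, InV s 2 v → ∃ w : ℕ → E d → E d,
    (∀ n, w n ∈ Submodule.span ℝ (Set.range ω)) ∧ WTendsto s 2 w v

/-- The span `V_i` of the first `i` basis fields. -/
def galerkinSpace {d : ℕ} (ω : ℕ → E d → E d) (i : ℕ) : Submodule ℝ (E d → E d) :=
  Submodule.span ℝ (ω '' {j | j < i})

/-- The orthogonal projection `P_i` onto `V_i`. -/
def galerkinProj {d : ℕ} (ω : ℕ → E d → E d) (i : ℕ) (v : E d → E d) : E d → E d :=
  ∑ j ∈ Finset.range i, l2 v (ω j) • ω j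

/-- `‖v‖_{W^{1,p}}^p = ∫ |v|^p + |∇v|^p` for a `C¹` field `v`. -/
def w1pNormPow {d : ℕ} (p : ℝ) (v : E d → E d) : ℝ :=
  ∫ x in cell d, (‖v x‖ ^ p + mnorm (grad v x) ^ p)

/-- `c` is a constant in Korn's inequality in `W^{1,p}` of the torus (it is
enough to test with `C¹` fields, which are dense). -/
def IsKornConstant (d : ℕ) (p c : ℝ) : Prop :=
  ∀ v : E d → E d, ContDiff ℝ 1 v → Periodic v →
    w1pNormPow p v ≤
      c * ((∫ x in cell d, mnorm (symGrad v x).1 ^ p) + (∫ x in cell d, ‖v x‖) ^ p)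

/-! ### Data -/

/-- The assumptions on a stress tensor `τ`: local Lipschitz continuity, coercivity, growth
and monotonicity. -/
structure IsStress {d : ℕ} (ν₀ p : ℝ) (τ : Sym d → Sym d) : Prop where
  locLip : ∀ s₀ : Sym d, ∃ r > 0, ∃ K : ℝ, ∀ s t : Sym d,
    mnorm (s.1 - s₀.1) < r → mnorm (t.1 - s₀.1) < r →
      mnorm ((τ s).1 - (τ t).1) ≤ K * mnorm (s.1 - t.1)
  lower : ∀ s, ν₀ * mnorm s.1 ^ p ≤ ddot (τ s).1 s.1
  upper : ∀ s, ddot (τ s).1 s.1 ≤ ν₀⁻¹ * (1 + mnorm s.1 ^ p)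
  growth : ∀ s, mnorm (τ s).1 ≤ ν₀⁻¹ * (1 + mnorm s.1 ^ (p - 1))
  mono : ∀ s t, 0 ≤ ddot ((τ s).1 - (τ t).1) (s.1 - t.1)

/-- `τ(φ, s) = (1+φ)/2 τ⁺(s) + (1-φ)/2 τ⁻(s)`. -/
def mixStress {d : ℕ} (τp τm : Sym d → Sym d) (φ : ℝ) (s : Sym d) : Matrix (Fin d) (Fin d) ℝ :=
  ((1 + φ) / 2) • (τp s).1 + ((1 - φ) / 2) • (τm s).1

/-- The double well potential `W(s) = (1 - s²)²/2`. -/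
def W (s : ℝ) : ℝ := (1 - s ^ 2) ^ 2 / 2

/-- `σ = ∫_{-1}^{1} √(2 W(s)) ds`. -/
def σ : ℝ := ∫ s in (-1 : ℝ)..1, Real.sqrt (2 * W s)

/-- The radially symmetric mollifying kernel. -/
structure IsKernel {d : ℕ} (ζ : E d → ℝ) : Prop where
  smooth : ContDiff ℝ (⊤ : ℕ∞) ζ
  nonneg : ∀ x, 0 ≤ ζ x
  radial : ∀ x y, ‖x‖ = ‖y‖ → ζ x = ζ y
  supp : tsupport ζ ⊆ Metric.ball 0 1
  integral_eq : ∫ x, ζ x = 1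

/-- The scaled kernel `ζ^ε(x) = ε^{-γ} ζ(x / ε^{γ/d})`. -/
def scaledKernel {d : ℕ} (ζ : E d → ℝ) (γ ε : ℝ) (x : E d) : ℝ :=
  (ε ^ γ)⁻¹ * ζ ((ε ^ (γ / d))⁻¹ • x)

/-- `f * ζ`, for scalar or vector-valued `f` on the torus. -/
def mollify {d : ℕ} {F : Type*} [NormedAddCommGroup F] [NormedSpace ℝ F]
    (ζ : E d → ℝ) (f : E d → F) : E d → F :=
  ζ ⋆[ContinuousLinearMap.lsmul ℝ ℝ, volume] f

/-- `U` is an open subset of the torus with `C¹` boundary: locally near each boundary point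
it is `{f > 0}` for a `C¹` function `f` with non-zero gradient. -/
structure IsC1Domain {d : ℕ} (U : Set (E d)) : Prop where
  isOpen : IsOpen U
  periodic : ∀ (a : Fin d) (x : E d), x + e a ∈ U ↔ x ∈ U
  boundary : ∀ x ∈ frontier U, ∃ (f : E d → ℝ) (N : Set (E d)), ContDiff ℝ 1 f ∧
    fderiv ℝ f x ≠ 0 ∧ N ∈ 𝓝 x ∧ ∀ y ∈ N, (y ∈ U ↔ 0 < f y)

/-- `E₀ = H^{d-1}(∂Ω⁺(0)) + ½ ∫ |u₀|²`; the Hausdorff measure is normalized to agree with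
surface area. -/
def E₀ {d : ℕ} (U : Set (E d)) (u₀ : E d → E d) : ℝ :=
  (Measure.euclideanHausdorffMeasure (d - 1) (frontier U ∩ cell d)).toReal +
    (1 / 2) * ∫ x in cell d, ‖u₀ x‖ ^ 2

/-! ### The approximate system -/

/-- Phase-field surface energy plus kinetic energy. -/
def energy {d : ℕ} (ε : ℝ) (φ : E d → ℝ) (u : E d → E d) : ℝ :=
  ∫ x in cell d, (1 / σ * (ε * ‖∇ φ x‖ ^ 2 / 2 + W (φ x) / ε) + ‖u x‖ ^ 2 / 2)

/-- The dissipation density `(ε/σ) (Δφ - W'(φ)/ε²)² + ν₀ |e(u)|^p`. -/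
def dissipation {d : ℕ} (ν₀ p ε : ℝ) (φ : E d → ℝ) (u : E d → E d) (x : E d) : ℝ :=
  ε / σ * (Laplacian.laplacian φ x - deriv W (φ x) / ε ^ 2) ^ 2 + ν₀ * mnorm (symGrad u x).1 ^ p

/-- The matrix field `(∇φ ⊗ ∇φ) * ζ`. -/
def capillary {d : ℕ} (ζ : E d → ℝ) (φ : E d → ℝ) (x : E d) : Matrix (Fin d) (Fin d) ℝ :=
  Matrix.of fun a b => mollify ζ (fun y => (∇ φ y) a * (∇ φ y) b) x

/-- The right-hand side of the momentum equation tested with `v`: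
`-∫ τ(φ,e(u)) : e(v) - ∫ (u·∇u)·v + (ε/σ) ∫ ((∇φ ⊗ ∇φ) * ζ) : ∇v`. -/
def momentumRHS {d : ℕ} (τp τm : Sym d → Sym d) (ζ : E d → ℝ) (ε : ℝ) (φ : E d → ℝ)
    (u v : E d → E d) : ℝ :=
  -(∫ x in cell d, ddot (mixStress τp τm (φ x) (symGrad u x)) (symGrad v x).1)
    - (∫ x in cell d, inner ℝ (fderiv ℝ u x (u x)) (v x))
    + ε / σ * ∫ x in cell d, ddot (capillary ζ φ x) (grad v x)

/-- `(u, φ)` is a weak solution on `𝕋^d × [0,T]` of the `i`-th approximate system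
`∂u/∂t = P_i (div τ(φ,e(u)) - u·∇u - (ε/σ) div((∇φ ⊗ ∇φ) * ζ))`, `u(t) ∈ V_i`,
`∂φ/∂t + (u * ζ)·∇φ = Δφ - W'(φ)/ε²`, `u(0) = P_i u₀`, `φ(0) = φ₀`,
with `|φ| ≤ 1` and `φ ∈ L^∞(0,T; C³)`. Both equations are integrated in time (which includes the
initial conditions); the first one is tested with the elements of `V_i`. -/
structure IsWeakSolution {d : ℕ} (τp τm : Sym d → Sym d) (ζ : E d → ℝ) (ε : ℝ)
    (ω : ℕ → E d → E d) (i : ℕ) (u₀ : E d → E d) (φ₀ : E d → ℝ) (T : ℝ)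
    (u : ℝ → E d → E d) (φ : ℝ → E d → ℝ) : Prop where
  mem : ∀ t ∈ Set.Icc 0 T, u t ∈ galerkinSpace ω i
  cont_u : ∀ v ∈ galerkinSpace ω i, ContinuousOn (fun t => l2 (u t) v) (Set.Icc 0 T)
  momentum : ∀ t ∈ Set.Icc 0 T, ∀ v ∈ galerkinSpace ω i,
    l2 (u t) v = l2 (galerkinProj ω i u₀) v + ∫ r in (0 : ℝ)..t, momentumRHS τp τm ζ ε (φ r) (u r) v
  periodic : ∀ t ∈ Set.Icc 0 T, Periodic (φ t)
  contDiff : ∀ t ∈ Set.Icc 0 T, ContDiff ℝ 3 (φ t)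
  bound : ∃ M : ℝ, ∀ t ∈ Set.Icc 0 T, ∀ x, ∀ k ≤ 3, ‖iteratedFDeriv ℝ k (φ t) x‖ ≤ M
  abs_le : ∀ t ∈ Set.Icc 0 T, ∀ x, |φ t x| ≤ 1
  cont_phi : ∀ x, ContinuousOn (fun t => φ t x) (Set.Icc 0 T)
  phase : ∀ t ∈ Set.Icc 0 T, ∀ x,
    φ t x = φ₀ x + ∫ r in (0 : ℝ)..t,
      (Laplacian.laplacian (φ r) x - deriv W (φ r x) / ε ^ 2
        - inner ℝ (mollify ζ (u r) x) (∇ (φ r) x))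

end TwoPhase

end

/-!
The proof has two independent parts: Korn's inequality in `L^p` on the torus for `p > 2` (which is
what `p > (d + 2) / 2` gives for `d ≥ 2`), and the energy law of the approximate system. Functions
on the torus are periodic functions on `ℝ^d`, integrated over the unit cube.

*Korn's inequality* (`exists_isKornConstant`). Singular integrals are avoided by a maximum principle
type argument. Let `G = ∇v` and `E = e(v)` evolve by the heat flow, and put `n = δ + |G|²`,
`m = δ + |E|²`, `q = p / 2 > 1`. The second derivatives of a vector field are combinations of the
first derivatives of its symmetrized gradient, so `|∇E|² ≤ |∇G|² ≤ 9 |∇E|²`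
(`sum_sq_le_nine_symmetrize`). For suitable constants `A ≥ 1` and `B` depending on `q` only, this
makes `Φ = n ^ q - A m n ^ (q - 1) - B m ^ q` a supersolution of the heat equation
(`exists_supersolution_constants`), so `∫ Φ` increases in time. All non-constant Fourier modes
decay, and `∫ Φ` tends to a number `≤ 0`. Therefore `∫ Φ ≤ 0` initially, and Young's inequality
gives `∫ n ^ q ≤ C ∫ m ^ q` (`exists_caloric_comparison`). The heat flow is explicit for
trigonometric polynomials; a `C¹` field is approximated by its convolutions with the powers of the
trigonometric polynomial `∏ (1 + cos 2πx_a) / 2`. Poincaré's inequality (`exists_poincare`) adds the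
lower order terms.

*The energy law* (`IsWeakSolution.energy_le`). The phase equation multiplied by
`-εΔφ + W'(φ)/ε`, and the momentum equation tested with `u` itself, give
`d/dt energy ≤ -∫ dissipation` (`energy_rate_le`). The convective term vanishes because `u` is
divergence-free, and transport by `u * ζ` leaves the potential energy unchanged and changes the
Dirichlet energy by exactly the work of the capillary force, since mollification by an even kernel
is symmetric and commutes with derivatives. The remaining points concern regularity. The Galerkin
fields are divergence-free in the classical sense as `C¹` functions which are `L²` limits of smooth
divergence-free fields (`InV.isSolenoidal`); the coefficients of `u` are differentiable in time by
the momentum equation; and the Dirichlet energy is differentiable, although `∇φ` need not be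
differentiable in time, because integration by parts turns its difference quotient into
`-∫ (φ(t) - φ(t₀)) / (t - t₀) · (Δφ(t) + Δφ(t₀))` (`IsRegularFamily.hasDerivAt_dirichlet`).

*The velocity bound* (`IsWeakSolution.integral_w1pNormPow_le`). The energy law at each time bounds
`‖u‖_{L¹}² ≤ ‖u‖_{L²}²` by twice the initial energy, and its dissipation bounds the integral of
`|e(u)|^p`. Korn's inequality combines the two; multiplying Korn's constant by `2 ^ (p / 2)` absorbs
the factor `2`.
-/

namespace TwoPhase

/-! ### Periodic functions and integration over the unit cell -/

section Torus

variable {d : ℕ} {F : Type*}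

/-- The standard basis of `ℝ^d`, as a basis. -/
noncomputable def stdBasis (d : ℕ) : Module.Basis (Fin d) ℝ (E d) :=
  (EuclideanSpace.basisFun (Fin d) ℝ).toBasis

lemma stdBasis_apply (a : Fin d) : stdBasis d a = e a := by
  simp [stdBasis, e]

lemma cell_eq_fundamentalDomain : cell d = ZSpan.fundamentalDomain (stdBasis d) := by
  ext x
  simp [cell, ZSpan.mem_fundamentalDomain, stdBasis]

lemma measurableSet_cell : MeasurableSet (cell d) := by
  rw [cell_eq_fundamentalDomain]
  exact ZSpan.fundamentalDomain_measurableSet _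

/-- The closed unit cube. -/
def closedCell (d : ℕ) : Set (E d) := {x | ∀ a, x a ∈ Set.Icc (0 : ℝ) 1}

lemma cell_subset_closedCell : cell d ⊆ closedCell d := fun _ hx a => ⟨(hx a).1, (hx a).2.le⟩

lemma isCompact_closedCell : IsCompact (closedCell d) := by
  have h : closedCell d =
      (EuclideanSpace.equiv (Fin d) ℝ).toHomeomorph ⁻¹' (Set.pi Set.univ fun _ => Set.Icc 0 1) := by
    ext x
    simp only [closedCell, Set.mem_ofPred_eq, Set.mem_preimage, Set.mem_pi, Set.mem_univ,
      true_imp_iff]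
    rfl
  rw [h, Homeomorph.isCompact_preimage]
  exact isCompact_univ_pi fun _ => isCompact_Icc

lemma volume_cell : volume (cell d) = 1 := by
  have h : cell d = (WithLp.ofLp : E d → Fin d → ℝ) ⁻¹'
      (Set.pi Set.univ fun _ => Set.Ico (0 : ℝ) 1) := by
    ext x
    simp only [cell, Set.mem_ofPred_eq, Set.mem_preimage, Set.mem_pi, Set.mem_univ, true_imp_iff]
  rw [h, (PiLp.volume_preserving_ofLp (Fin d)).measure_preimage]
  · rw [Real.volume_pi_Ico]; simp
  · exact (MeasurableSet.univ_pi fun _ => measurableSet_Ico).nullMeasurableSet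

instance : IsProbabilityMeasure ((volume : Measure (E d)).restrict (cell d)) :=
  ⟨by rw [Measure.restrict_apply_univ, volume_cell]⟩

lemma restrict_cell_restrict {K : Set (E d)} (hK : cell d ⊆ K) :
    (volume.restrict (cell d)).restrict K = volume.restrict (cell d) := by
  rw [Measure.restrict_restrict' measurableSet_cell, Set.inter_eq_right.2 hK]

lemma Periodic.vadd {f : E d → F} (hf : Periodic f)
    (g : Submodule.span ℤ (Set.range (stdBasis d))) (x : E d) : f (g +ᵥ x) = f x := by
  obtain ⟨g, hg⟩ := g
  change f (g + x) = f x
  induction hg using Submodule.span_induction generalizing x with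
  | mem y hy =>
    obtain ⟨a, rfl⟩ := hy
    rw [stdBasis_apply, add_comm, hf]
  | zero => simp
  | add y z _ _ hy hz => rw [add_assoc, hy, hz]
  | smul n y _ hy =>
    induction n using Int.induction_on generalizing x with
    | zero => simp
    | succ n ih => rw [add_smul, one_smul, add_assoc, ih, hy]
    | pred n ih =>
      rw [sub_smul, one_smul]
      rw [← hy (-(n : ℤ) • y - y + x)]
      rw [show y + (-(n : ℤ) • y - y + x) = -(n : ℤ) • y + x by abel, ih]

open scoped Pointwise in
/-- Integrals over the torus are invariant under translations. -/
lemma setIntegral_cell_add [NormedAddCommGroup F] [NormedSpace ℝ F] {f : E d → F}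
    (hf : Periodic f) (h : E d) :
    ∫ x in cell d, f (x + h) = ∫ x in cell d, f x := by
  have h1 : IsAddFundamentalDomain (Submodule.span ℤ (Set.range (stdBasis d))) (cell d) volume := by
    rw [cell_eq_fundamentalDomain]
    exact ZSpan.isAddFundamentalDomain _ _
  have h2 := h1.vadd_of_comm (G' := E d) h
  have : VAddInvariantMeasure (Submodule.span ℤ (Set.range (stdBasis d))) (E d) volume :=
    inferInstanceAs <|
      VAddInvariantMeasure (Submodule.span ℤ (Set.range (stdBasis d))).toAddSubgroup (E d) volume
  have h3 : (fun x : E d => x + h) ⁻¹' (h +ᵥ cell d) = cell d := by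
    ext x
    rw [Set.mem_preimage, Set.mem_vadd_set]
    constructor
    · rintro ⟨y, hy, hyx⟩
      rw [vadd_eq_add, add_comm] at hyx
      rwa [← add_right_cancel hyx]
    · intro hx
      exact ⟨x, hx, by rw [vadd_eq_add, add_comm]⟩
  calc ∫ x in cell d, f (x + h) = ∫ x in (fun x : E d => x + h) ⁻¹' (h +ᵥ cell d), f (x + h) := by
        rw [h3]
    _ = ∫ x in h +ᵥ cell d, f x :=
        (measurePreserving_add_right volume h).setIntegral_preimage_emb
          (measurableEmbedding_addRight h) f _
    _ = _ := h2.setIntegral_eq h1 hf.vadd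

lemma Periodic.exists_mem_cell {f : E d → F} (hf : Periodic f) (x : E d) :
    ∃ y ∈ cell d, f y = f x := by
  refine ⟨ZSpan.fract (stdBasis d) x, ?_, ?_⟩
  · rw [cell_eq_fundamentalDomain]; exact ZSpan.fract_mem_fundamentalDomain _ _
  · have := hf.vadd (ZSpan.floor (stdBasis d) x) (ZSpan.fract (stdBasis d) x)
    rw [← this]
    congr 1
    rw [ZSpan.fract_apply]
    change _ + (x - _) = x
    abel

variable [NormedAddCommGroup F]

lemma Periodic.exists_bound {f : E d → F} (hf : Periodic f) (hc : Continuous f) :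
    ∃ C, 0 ≤ C ∧ ∀ x, ‖f x‖ ≤ C := by
  obtain ⟨C, hC⟩ := isCompact_closedCell.exists_bound_of_continuousOn hc.continuousOn
  refine ⟨max C 0, le_max_right _ _, fun x => ?_⟩
  obtain ⟨y, hy, hyx⟩ := hf.exists_mem_cell x
  rw [← hyx]
  exact (hC y (cell_subset_closedCell hy)).trans (le_max_left _ _)

lemma integrable_cell {f : E d → F} (hc : Continuous f) :
    Integrable f (volume.restrict (cell d)) :=
  (hc.continuousOn.integrableOn_compact isCompact_closedCell).mono_set cell_subset_closedCell

lemma continuous_cell_integral {X : Type*} [TopologicalSpace X] [FirstCountableTopology X]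
    [LocallyCompactSpace X] [NormedSpace ℝ F] {f : X → E d → F}
    (hf : Continuous (Function.uncurry f)) : Continuous fun t => ∫ x in cell d, f t x := by
  have := continuous_parametric_integral_of_continuous (μ := volume.restrict (cell d)) hf
    (isCompact_closedCell (d := d))
  simpa only [restrict_cell_restrict cell_subset_closedCell] using this

/-- Differentiation under the integral over the cell, for a jointly continuous derivative. -/
lemma hasDerivAt_cell_integral {f f' : ℝ → E d → ℝ} {t₀ : ℝ} {U : Set ℝ} (hU : U ∈ 𝓝 t₀)
    (hf : ∀ t, Continuous (f t)) (hf' : Continuous (Function.uncurry f'))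
    (hd : ∀ t ∈ U, ∀ x, HasDerivAt (fun t => f t x) (f' t x) t) :
    HasDerivAt (fun t => ∫ x in cell d, f t x) (∫ x in cell d, f' t₀ x) t₀ := by
  obtain ⟨r, hr, hrU⟩ := Metric.mem_nhds_iff.1 hU
  have hK : IsCompact (Metric.closedBall t₀ r ×ˢ closedCell d) :=
    (isCompact_closedBall _ _).prod isCompact_closedCell
  obtain ⟨C, hC⟩ := hK.exists_bound_of_continuousOn hf'.continuousOn
  refine (hasDerivAt_integral_of_dominated_loc_of_deriv_le (bound := fun _ => C)
    (Metric.ball_mem_nhds t₀ hr)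
    (Eventually.of_forall fun t => (hf t).aestronglyMeasurable) (integrable_cell (hf t₀))
    (hf'.comp (by fun_prop : Continuous fun x : E d => (t₀, x))).aestronglyMeasurable ?_
    (integrable_const C) ?_).2
  · filter_upwards [ae_restrict_mem measurableSet_cell] with x hx t ht
    exact hC (t, x) ⟨Metric.ball_subset_closedBall ht, cell_subset_closedCell hx⟩
  · exact Eventually.of_forall fun x t ht => hd t (hrU ht) x

/-- The integral of a directional derivative over the torus vanishes. -/
lemma integral_cell_deriv_eq_zero {f f' : E d → ℝ} {v : E d} (hp : Periodic f)
    (hf : Continuous f) (hf' : Continuous f')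
    (hd : ∀ x, HasDerivAt (fun s : ℝ => f (x + s • v)) (f' x) 0) :
    ∫ x in cell d, f' x = 0 := by
  have h1 : HasDerivAt (fun s : ℝ => ∫ x in cell d, f (x + s • v))
      (∫ x in cell d, f' (x + (0 : ℝ) • v)) 0 := by
    refine hasDerivAt_cell_integral (f := fun s x => f (x + s • v))
      (f' := fun s x => f' (x + s • v)) univ_mem (fun t => by fun_prop)
      (hf'.comp (by fun_prop : Continuous fun z : ℝ × E d => z.2 + z.1 • v)) fun t _ x => ?_
    have h := hd (x + t • v)
    have h2 : HasDerivAt (fun s : ℝ => s - t) 1 t := (hasDerivAt_id t).sub_const t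
    have h3 := HasDerivAt.comp t (h₂ := fun s : ℝ => f (x + t • v + s • v)) (by simpa using h) h2
    rw [mul_one] at h3
    refine h3.congr_of_eventuallyEq (Eventually.of_forall fun s => ?_)
    simp only [Function.comp]
    congr 1
    rw [add_assoc, ← add_smul]
    congr 2; ring
  have h2 : (fun s : ℝ => ∫ x in cell d, f (x + s • v)) = fun _ => ∫ x in cell d, f x := by
    funext s
    exact setIntegral_cell_add hp _
  rw [h2] at h1
  have := h1.unique (hasDerivAt_const _ _)
  simpa using this

lemma hasDerivAt_line {f : E d → ℝ} (hf : Differentiable ℝ f) (v x : E d) :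
    HasDerivAt (fun s : ℝ => f (x + s • v)) (fderiv ℝ f x v) 0 := by
  have h1 : HasDerivAt (fun s : ℝ => x + s • v) v 0 := by
    simpa using ((hasDerivAt_id (0 : ℝ)).smul_const v).const_add x
  have h2 : HasFDerivAt f (fderiv ℝ f x) (x + (0 : ℝ) • v) := by simpa using (hf x).hasFDerivAt
  exact h2.comp_hasDerivAt (0 : ℝ) h1

lemma integral_cell_fderiv {f : E d → ℝ} (hp : Periodic f) (hf : ContDiff ℝ 1 f) (v : E d) :
    ∫ x in cell d, fderiv ℝ f x v = 0 :=
  integral_cell_deriv_eq_zero hp hf.continuous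
    ((hf.continuous_fderiv (by norm_num)).clm_apply continuous_const)
    (hasDerivAt_line (hf.differentiable (by norm_num)) v)

/-- Integration by parts on the torus. -/
lemma integral_cell_mul_fderiv {f g : E d → ℝ} (hpf : Periodic f) (hpg : Periodic g)
    (hf : ContDiff ℝ 1 f) (hg : ContDiff ℝ 1 g) (v : E d) :
    ∫ x in cell d, f x * fderiv ℝ g x v = -∫ x in cell d, fderiv ℝ f x v * g x := by
  have h0 := integral_cell_fderiv (f := fun x => f x * g x)
    (fun a x => by simp only [hpf a x, hpg a x]) (hf.mul hg) v
  have h1 : ∀ x, fderiv ℝ (fun x => f x * g x) x v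
      = f x * fderiv ℝ g x v + fderiv ℝ f x v * g x := by
    intro x
    rw [fderiv_fun_mul (hf.differentiable (by norm_num) x) (hg.differentiable (by norm_num) x)]
    simp [mul_comm]
  have hcf := (hf.continuous_fderiv (by norm_num)).clm_apply (continuous_const (y := v))
  have hcg := (hg.continuous_fderiv (by norm_num)).clm_apply (continuous_const (y := v))
  simp only [h1] at h0
  have h2 := integral_add (integrable_cell (hf.continuous.mul hcg))
    (integrable_cell (hcf.mul hg.continuous))
  simp only [Pi.mul_apply] at h2
  linarith

lemma Periodic.fderiv [NormedSpace ℝ F] {f : E d → F} (hf : Periodic f) :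
    Periodic (fun x => fderiv ℝ f x) := by
  intro a x
  have h : (fun y => f (y + e a)) = f := funext fun y => hf a y
  change _root_.fderiv ℝ f (x + e a) = _root_.fderiv ℝ f x
  rw [← fderiv_comp_add_right, h]

end Torus

/-! ### A monotonicity formula for the heat flow -/

section HeatFlow

/-- The constants `A` and `B` for which `n ^ q - A m n ^ (q - 1) - B m ^ q` is a supersolution of
the heat equation when `n` and `m` are squared lengths of caloric families whose gradients are
comparable. In the inequality, `n' k`, `m' k` are the partial derivatives of `n` and `m`, and `S k`,
`R k` the squared lengths of the `k`-th partial derivatives of the two families. The sum is the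
Laplacian of the expression minus its time derivative. -/
lemma exists_supersolution_constants {q C₀ : ℝ} (hq : 1 < q) (hC₀ : 0 < C₀) :
    ∃ A B : ℝ, 1 ≤ A ∧ 0 ≤ B ∧ ∀ {κ : Type} [Fintype κ] (n m : ℝ) (S R n' m' : κ → ℝ),
      0 < m → m ≤ n → (∀ k, n' k ^ 2 ≤ 4 * n * S k) → (∀ k, m' k ^ 2 ≤ 4 * m * R k) →
      (∀ k, 0 ≤ R k) → (∀ k, R k ≤ S k) → ∑ k, S k ≤ C₀ * ∑ k, R k →
      ∑ k, ((q * n ^ (q - 1) - A * (q - 1) * m * n ^ (q - 1) / n) * (2 * S k)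
        + (-A * n ^ (q - 1) - B * q * m ^ (q - 1)) * (2 * R k)
        + (q * (q - 1) * n ^ (q - 1) / n - A * (q - 1) * (q - 2) * m * n ^ (q - 1) / n ^ 2)
            * n' k ^ 2
        + 2 * (-A * (q - 1) * n ^ (q - 1) / n) * n' k * m' k
        + (-B * q * (q - 1) * m ^ (q - 1) / m) * m' k ^ 2) ≤ 0 := by
  -- `c1` and `c2` bound the coefficients of `S` in the cross terms and in the terms without `A`
  set c1 : ℝ := (q - 1) * (4 * |q - 2| + 8) with hc1
  set c2 : ℝ := 2 * q + 4 * q * (q - 1) with hc2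
  have hq1 : 0 < q - 1 := by linarith
  have hc1pos : 0 < c1 := by positivity
  set A : ℝ := max 1 (C₀ * c2) with hA
  have hA1 : 1 ≤ A := le_max_left _ _
  have hA2 : C₀ * c2 ≤ A := le_max_right _ _
  set η : ℝ := (C₀ * c1)⁻¹ with hη
  have hηpos : 0 < η := by positivity
  set κ₀ : ℝ := (η ^ 2) ^ (q - 1) with hκ₀
  have hκpos : 0 < κ₀ := by positivity
  refine ⟨A, A * c1 * C₀ / (2 * q * κ₀), hA1, by positivity, ?_⟩
  set B : ℝ := A * c1 * C₀ / (2 * q * κ₀) with hB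
  have hBpos : 0 ≤ B := by positivity
  intro κ _ n m S R n' m' hm hmn hn' hm' hR hRS hSR
  have hn : 0 < n := hm.trans_le hmn
  set P : ℝ := n ^ (q - 1) with hP
  have hPpos : 0 < P := by positivity
  set r : ℝ := m / n with hr
  have hrpos : 0 < r := by positivity
  have hr1 : r ≤ 1 := (div_le_one hn).2 hmn
  set ρ : ℝ := √r with hρ
  have hρ2 : ρ ^ 2 = r := Real.sq_sqrt hrpos.le
  have hρpos : 0 < ρ := Real.sqrt_pos.2 hrpos
  have hρ1 : ρ ≤ 1 := Real.sqrt_le_one.2 hr1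
  have hrρ : r ≤ ρ := by nlinarith
  have hmr : m = r * n := by rw [hr]; field_simp
  have hM : m ^ (q - 1) = r ^ (q - 1) * P := by
    rw [hmr, Real.mul_rpow hrpos.le hn.le]
  set g : ℝ := r ^ (q - 1) with hg
  have hgpos : 0 < g := by positivity
  -- the cross term is absorbed by `A` when `m / n` is small, and by `B` otherwise
  have key : c2 + A * c1 * ρ ≤ 2 * (A + B * q * g) / C₀ := by
    have h1 : c2 ≤ A / C₀ := by rw [le_div_iff₀ hC₀]; linarith
    have h2 : A * c1 * ρ ≤ A / C₀ + 2 * B * q * g / C₀ := by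
      rcases le_total ρ η with h | h
      · have : A * c1 * ρ ≤ A * c1 * η := by gcongr
        have h3 : A * c1 * η = A / C₀ := by rw [hη]; field_simp
        have : 0 ≤ 2 * B * q * g / C₀ := by positivity
        linarith
      · have h3 : κ₀ ≤ g := by
          refine Real.rpow_le_rpow (by positivity) ?_ hq1.le
          rw [← hρ2]; gcongr
        have h4 : 2 * B * q * κ₀ / C₀ = A * c1 := by rw [hB]; field_simp
        have h5 : 2 * B * q * κ₀ / C₀ ≤ 2 * B * q * g / C₀ := by gcongr
        have h6 : A * c1 * ρ ≤ A * c1 * 1 := by gcongr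
        have : 0 ≤ A / C₀ := by positivity
        linarith
    have h3 : 2 * (A + B * q * g) / C₀ = A / C₀ + (A / C₀ + 2 * B * q * g / C₀) := by
      field_simp; ring
    linarith
  have hterm : ∀ k, (q * P - A * (q - 1) * m * P / n) * (2 * S k)
        + (-A * P - B * q * m ^ (q - 1)) * (2 * R k)
        + (q * (q - 1) * P / n - A * (q - 1) * (q - 2) * m * P / n ^ 2) * n' k ^ 2
        + 2 * (-A * (q - 1) * P / n) * n' k * m' k
        + (-B * q * (q - 1) * m ^ (q - 1) / m) * m' k ^ 2
      ≤ P * ((c2 + A * c1 * ρ) * S k - 2 * (A + B * q * g) * R k) := by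
    intro k
    have hS : 0 ≤ S k := (hR k).trans (hRS k)
    set x := n' k ^ 2 / n with hx
    have hx0 : 0 ≤ x := by positivity
    have hx1 : x ≤ 4 * S k := by
      rw [hx, div_le_iff₀ hn]; linarith [hn' k]
    have hcross : |n' k * m' k| ≤ 4 * n * ρ * S k := by
      refine abs_le_of_sq_le_sq ?_ (by positivity)
      calc (n' k * m' k) ^ 2 = n' k ^ 2 * m' k ^ 2 := by ring
        _ ≤ (4 * n * S k) * (4 * m * R k) :=
            mul_le_mul (hn' k) (hm' k) (sq_nonneg _) (by positivity)
        _ ≤ (4 * n * S k) * (4 * m * S k) := by have := hRS k; gcongr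
        _ = (4 * n * ρ * S k) ^ 2 := by rw [hmr, ← hρ2]; ring
    have hcross' : -(4 * ρ * S k) ≤ n' k * m' k / n := by
      rw [le_div_iff₀ hn]; linarith [(abs_le.1 hcross).1]
    have h3 : -(|q - 2| * (4 * ρ * S k)) ≤ (q - 2) * r * x := by
      have h31 : |(q - 2) * r * x| ≤ |q - 2| * (4 * ρ * S k) := by
        rw [abs_mul, abs_mul, abs_of_pos hrpos, abs_of_nonneg hx0, mul_assoc]
        refine mul_le_mul_of_nonneg_left ?_ (abs_nonneg _)
        calc r * x ≤ ρ * (4 * S k) := by gcongr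
          _ = _ := by ring
      exact (abs_le.1 h31).1
    have h4 : (-B * q * (q - 1) * m ^ (q - 1) / m) * m' k ^ 2 ≤ 0 := by
      have : 0 ≤ B * q * (q - 1) * m ^ (q - 1) / m * m' k ^ 2 := by positivity
      rw [neg_mul, neg_mul, neg_mul, neg_div, neg_mul]
      exact neg_nonpos.2 this
    have e1 : (q * P - A * (q - 1) * m * P / n) * (2 * S k)
        + (-A * P - B * q * m ^ (q - 1)) * (2 * R k)
        + (q * (q - 1) * P / n - A * (q - 1) * (q - 2) * m * P / n ^ 2) * n' k ^ 2
        + 2 * (-A * (q - 1) * P / n) * n' k * m' k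
        = P * (2 * q * S k - 2 * A * (q - 1) * r * S k - 2 * (A + B * q * g) * R k
          + q * (q - 1) * x - A * (q - 1) * ((q - 2) * r * x)
          - 2 * A * (q - 1) * (n' k * m' k / n)) := by
      rw [hM, hx, hr]; field_simp; ring
    have h5 : 2 * q * S k - 2 * A * (q - 1) * r * S k - 2 * (A + B * q * g) * R k
          + q * (q - 1) * x - A * (q - 1) * ((q - 2) * r * x)
          - 2 * A * (q - 1) * (n' k * m' k / n)
        ≤ (c2 + A * c1 * ρ) * S k - 2 * (A + B * q * g) * R k := by
      have a1 : 0 ≤ 2 * A * (q - 1) * r * S k := by positivity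
      have a2 : q * (q - 1) * x ≤ q * (q - 1) * (4 * S k) := by gcongr
      have a3 := mul_le_mul_of_nonneg_left h3 (by positivity : 0 ≤ A * (q - 1))
      have a4 := mul_le_mul_of_nonneg_left hcross' (by positivity : 0 ≤ 2 * A * (q - 1))
      have a5 : (c2 + A * c1 * ρ) * S k = 2 * q * S k + q * (q - 1) * (4 * S k)
          + A * (q - 1) * (|q - 2| * (4 * ρ * S k)) + 2 * A * (q - 1) * (4 * ρ * S k) := by
        rw [hc1, hc2]; ring
      rw [a5]
      linarith
    have h6 := mul_le_mul_of_nonneg_left h5 hPpos.le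
    rw [e1]
    exact (add_le_of_nonpos_right h4).trans h6
  refine (Finset.sum_le_sum fun k _ => hterm k).trans ?_
  rw [← Finset.mul_sum, Finset.sum_sub_distrib, ← Finset.mul_sum, ← Finset.mul_sum]
  refine mul_nonpos_of_nonneg_of_nonpos hPpos.le ?_
  have hS0 : 0 ≤ ∑ k, S k := Finset.sum_nonneg fun k _ => (hR k).trans (hRS k)
  have h1 : (c2 + A * c1 * ρ) * ∑ k, S k ≤ 2 * (A + B * q * g) / C₀ * (C₀ * ∑ k, R k) := by
    have : 0 ≤ ∑ k, R k := Finset.sum_nonneg fun k _ => hR k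
    exact mul_le_mul key hSR hS0 (by positivity)
  have h2 : 2 * (A + B * q * g) / C₀ * (C₀ * ∑ k, R k) = 2 * (A + B * q * g) * ∑ k, R k := by
    field_simp
  linarith

variable {d : ℕ}

/-- `f` is a solution of the heat equation on the torus with first and second pure partial
derivatives `D k`, `DD k`, which tends to `0` for large times. -/
structure IsDecayingCaloric (f : ℝ → E d → ℝ) (D DD : Fin d → ℝ → E d → ℝ) : Prop where
  periodic : ∀ t, Periodic (f t)
  periodic_D : ∀ k t, Periodic (D k t)
  cont : Continuous (Function.uncurry f)
  cont_D : ∀ k, Continuous (Function.uncurry (D k))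
  cont_DD : ∀ k, Continuous (Function.uncurry (DD k))
  hasDerivAt : ∀ k t x, HasDerivAt (fun s : ℝ => f t (x + s • e k)) (D k t x) 0
  hasDerivAt_D : ∀ k t x, HasDerivAt (fun s : ℝ => D k t (x + s • e k)) (DD k t x) 0
  heat : ∀ t x, HasDerivAt (fun t => f t x) (∑ k, DD k t x) t
  bound : ∃ C, ∀ t, 0 ≤ t → ∀ x, |f t x| ≤ C
  decay : ∀ x, Tendsto (fun t => f t x) atTop (𝓝 0)

lemma hasDerivAt_add_sum_sq {ι : Type*} [Fintype ι] {δ t : ℝ} {f : ι → ℝ → ℝ} {f' : ι → ℝ}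
    (h : ∀ i, HasDerivAt (f i) (f' i) t) :
    HasDerivAt (fun s => δ + ∑ i, f i s ^ 2) (2 * ∑ i, f i t * f' i) t := by
  have h1 : HasDerivAt (fun s => ∑ i, f i s ^ 2) (∑ i, 2 * (f i t * f' i)) t := by
    refine HasDerivAt.fun_sum fun i _ => ?_
    refine ((h i).fun_pow 2).congr_deriv ?_
    simp; ring
  rw [Finset.mul_sum]
  exact h1.const_add δ

lemma hasDerivAt_two_sum_mul {ι : Type*} [Fintype ι] {t : ℝ} {f g : ι → ℝ → ℝ} {f' g' : ι → ℝ}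
    (h : ∀ i, HasDerivAt (f i) (f' i) t) (hg : ∀ i, HasDerivAt (g i) (g' i) t) :
    HasDerivAt (fun s => 2 * ∑ i, f i s * g i s) (2 * ∑ i, (f' i * g i t + f i t * g' i)) t :=
  (HasDerivAt.fun_sum fun i _ => (h i).fun_mul (hg i)).const_mul 2

/-- The first derivative of `n ^ q - A m n ^ (q - 1) - B m ^ q`. -/
lemma hasDerivAt_supersolution {q A B t n' m' : ℝ} {n m : ℝ → ℝ}
    (hn : HasDerivAt n n' t) (hm : HasDerivAt m m' t) (hn0 : 0 < n t) (hm0 : 0 < m t) :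
    HasDerivAt (fun s => n s ^ q - A * m s * n s ^ (q - 1) - B * m s ^ q)
      ((q * n t ^ (q - 1) - A * (q - 1) * m t * n t ^ (q - 1) / n t) * n'
        + (-A * n t ^ (q - 1) - B * q * m t ^ (q - 1)) * m') t := by
  have h1 := hn.rpow_const (p := q) (Or.inl hn0.ne')
  have h2 := hn.rpow_const (p := q - 1) (Or.inl hn0.ne')
  have h3 := hm.rpow_const (p := q) (Or.inl hm0.ne')
  refine ((h1.sub ((hm.const_mul A).mul h2)).sub (h3.const_mul B)).congr_deriv ?_
  rw [Real.rpow_sub_one hn0.ne' (q - 1)]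
  field_simp
  ring

/-- The second derivative of `n ^ q - A m n ^ (q - 1) - B m ^ q`. -/
lemma hasDerivAt_deriv_supersolution {q A B t n'' m'' : ℝ} {n m n' m' : ℝ → ℝ}
    (hn : HasDerivAt n (n' t) t) (hm : HasDerivAt m (m' t) t)
    (hn' : HasDerivAt n' n'' t) (hm' : HasDerivAt m' m'' t) (hn0 : 0 < n t) (hm0 : 0 < m t) :
    HasDerivAt (fun s => (q * n s ^ (q - 1) - A * (q - 1) * m s * n s ^ (q - 1) / n s) * n' s
        + (-A * n s ^ (q - 1) - B * q * m s ^ (q - 1)) * m' s)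
      ((q * n t ^ (q - 1) - A * (q - 1) * m t * n t ^ (q - 1) / n t) * n''
        + (-A * n t ^ (q - 1) - B * q * m t ^ (q - 1)) * m''
        + (q * (q - 1) * n t ^ (q - 1) / n t
            - A * (q - 1) * (q - 2) * m t * n t ^ (q - 1) / n t ^ 2) * n' t ^ 2
        + 2 * (-A * (q - 1) * n t ^ (q - 1) / n t) * n' t * m' t
        + (-B * q * (q - 1) * m t ^ (q - 1) / m t) * m' t ^ 2) t := by
  have h2 := hn.rpow_const (p := q - 1) (Or.inl hn0.ne')
  have h3 := hm.rpow_const (p := q - 1) (Or.inl hm0.ne')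
  have h4 := ((hm.const_mul (A * (q - 1))).mul h2).div hn hn0.ne'
  refine ((((h2.const_mul q).sub h4).mul hn').add
    (((h2.const_mul (-A)).sub (h3.const_mul (B * q))).mul hm')).congr_deriv ?_
  simp only [Pi.mul_apply, Pi.sub_apply, Pi.div_apply]
  rw [Real.rpow_sub_one hn0.ne' (q - 1), Real.rpow_sub_one hm0.ne' (q - 1)]
  field_simp
  ring

end HeatFlow

section HeatFlow

variable {d : ℕ}

lemma weighted_young {q A n m : ℝ} (hq : 1 < q) (hA : 1 ≤ A) (hm : 0 < m) (hn : 0 < n) :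
    A * m * n ^ (q - 1) ≤ n ^ q / 2 + A * (2 * A) ^ (q - 1) * m ^ q := by
  have e1 : n ^ q = n * n ^ (q - 1) := by
    rw [Real.rpow_sub_one hn.ne']; field_simp
  have e2 : m ^ q = m * m ^ (q - 1) := by
    rw [Real.rpow_sub_one hm.ne']; field_simp
  rcases le_total (2 * A * m) n with hc | hc
  · have h1 : 0 ≤ A * (2 * A) ^ (q - 1) * m ^ q := by positivity
    have h2 : 2 * A * m * n ^ (q - 1) ≤ n * n ^ (q - 1) := by gcongr
    linarith
  · have h1 : n ^ (q - 1) ≤ (2 * A) ^ (q - 1) * m ^ (q - 1) := by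
      rw [← Real.mul_rpow (by positivity) hm.le]
      exact Real.rpow_le_rpow hn.le hc (by linarith)
    have h2 : A * m * n ^ (q - 1) ≤ A * m * ((2 * A) ^ (q - 1) * m ^ (q - 1)) := by gcongr
    have h3 : 0 ≤ n ^ q := by positivity
    rw [e2]; linarith

set_option maxHeartbeats 1000000 in
/-- If the gradient of a decaying caloric family `f` is pointwise controlled by the gradient of a
decaying caloric family `h` with `|h| ≤ |f|` and `|∂_k h| ≤ |∂_k f|`, then the `L^{2q}` norm of the
initial data of `f` is controlled by that of `h`. -/
theorem exists_caloric_comparison {q C₀ : ℝ} (hq : 1 < q) (hC₀ : 0 < C₀) :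
    ∃ C : ℝ, 0 ≤ C ∧ ∀ {ι κ : Type} [Fintype ι] [Fintype κ]
      {f : ι → ℝ → E d → ℝ} {D DD : ι → Fin d → ℝ → E d → ℝ}
      {h : κ → ℝ → E d → ℝ} {Dh DDh : κ → Fin d → ℝ → E d → ℝ},
      (∀ i, IsDecayingCaloric (f i) (D i) (DD i)) → (∀ i, IsDecayingCaloric (h i) (Dh i) (DDh i)) →
      (∀ t x, ∑ i, h i t x ^ 2 ≤ ∑ i, f i t x ^ 2) →
      (∀ k t x, ∑ i, Dh i k t x ^ 2 ≤ ∑ i, D i k t x ^ 2) →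
      (∀ t x, ∑ k, ∑ i, D i k t x ^ 2 ≤ C₀ * ∑ k, ∑ i, Dh i k t x ^ 2) →
      ∫ x in cell d, (∑ i, f i 0 x ^ 2) ^ q ≤ C * ∫ x in cell d, (∑ i, h i 0 x ^ 2) ^ q := by
  obtain ⟨A, B, hA, hB, hAB⟩ := exists_supersolution_constants hq hC₀
  have hq1 : 0 < q - 1 := by linarith
  have hq0 : 0 < q := by linarith
  refine ⟨2 * (A * (2 * A) ^ (q - 1) + B), by positivity, ?_⟩
  intro ι κ _ _ f D DD h Dh DDh hf hh hhf hDD hSR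
  -- `n` and `m` are the squared lengths, regularized by `δ` in order to be positive
  have main : ∀ δ : ℝ, 0 < δ → ∫ x in cell d, (∑ i, f i 0 x ^ 2) ^ q ≤
      2 * (A * (2 * A) ^ (q - 1) + B) * ∫ x in cell d, (δ + ∑ i, h i 0 x ^ 2) ^ q := by
    intro δ hδ
    set n : ℝ → E d → ℝ := fun t x => δ + ∑ i, f i t x ^ 2 with hn
    set m : ℝ → E d → ℝ := fun t x => δ + ∑ i, h i t x ^ 2 with hm
    have hm0 : ∀ t x, 0 < m t x := fun t x =>
      add_pos_of_pos_of_nonneg hδ (Finset.sum_nonneg fun _ _ => sq_nonneg _)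
    have hmn : ∀ t x, m t x ≤ n t x := fun t x => by
      simp only [hn, hm]; have := hhf t x; linarith
    have hn0 : ∀ t x, 0 < n t x := fun t x => (hm0 t x).trans_le (hmn t x)
    have hcf := fun i => (hf i).cont
    have hcD := fun i => (hf i).cont_D
    have hcDD := fun i => (hf i).cont_DD
    have hch := fun i => (hh i).cont
    have hcDh := fun i => (hh i).cont_D
    have hcDDh := fun i => (hh i).cont_DD
    have hcn : Continuous (Function.uncurry n) :=
      continuous_const.add (continuous_finsetSum _ fun i _ => (hcf i).pow 2)
    have hcm : Continuous (Function.uncurry m) :=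
      continuous_const.add (continuous_finsetSum _ fun i _ => (hch i).pow 2)
    set nk : Fin d → ℝ → E d → ℝ := fun k t x => 2 * ∑ i, f i t x * D i k t x with hnk
    set mk : Fin d → ℝ → E d → ℝ := fun k t x => 2 * ∑ i, h i t x * Dh i k t x with hmk
    have hcnk : ∀ k, Continuous (Function.uncurry (nk k)) := fun k =>
      continuous_const.mul (continuous_finsetSum _ fun i _ => (hcf i).mul (hcD i k))
    have hcmk : ∀ k, Continuous (Function.uncurry (mk k)) := fun k =>
      continuous_const.mul (continuous_finsetSum _ fun i _ => (hch i).mul (hcDh i k))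
    set nkk : Fin d → ℝ → E d → ℝ := fun k t x =>
      2 * ∑ i, (D i k t x * D i k t x + f i t x * DD i k t x) with hnkk
    set mkk : Fin d → ℝ → E d → ℝ := fun k t x =>
      2 * ∑ i, (Dh i k t x * Dh i k t x + h i t x * DDh i k t x) with hmkk
    have hcnkk : ∀ k, Continuous (Function.uncurry (nkk k)) := fun k =>
      continuous_const.mul (continuous_finsetSum _ fun i _ =>
        ((hcD i k).mul (hcD i k)).add ((hcf i).mul (hcDD i k)))
    have hcmkk : ∀ k, Continuous (Function.uncurry (mkk k)) := fun k =>
      continuous_const.mul (continuous_finsetSum _ fun i _ =>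
        ((hcDh i k).mul (hcDh i k)).add ((hch i).mul (hcDDh i k)))
    set nt : ℝ → E d → ℝ := fun t x => 2 * ∑ i, f i t x * ∑ k, DD i k t x with hnt
    set mt : ℝ → E d → ℝ := fun t x => 2 * ∑ i, h i t x * ∑ k, DDh i k t x with hmt
    have hcnt : Continuous (Function.uncurry nt) :=
      continuous_const.mul (continuous_finsetSum _ fun i _ =>
        (hcf i).mul (continuous_finsetSum _ fun k _ => hcDD i k))
    have hcmt : Continuous (Function.uncurry mt) :=
      continuous_const.mul (continuous_finsetSum _ fun i _ =>
        (hch i).mul (continuous_finsetSum _ fun k _ => hcDDh i k))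
    have hdn : ∀ k t x, HasDerivAt (fun s : ℝ => n t (x + s • e k)) (nk k t x) 0 := by
      intro k t x
      have := hasDerivAt_add_sum_sq (δ := δ) fun i => (hf i).hasDerivAt k t x
      simpa only [zero_smul, add_zero] using this
    have hdm : ∀ k t x, HasDerivAt (fun s : ℝ => m t (x + s • e k)) (mk k t x) 0 := by
      intro k t x
      have := hasDerivAt_add_sum_sq (δ := δ) fun i => (hh i).hasDerivAt k t x
      simpa only [zero_smul, add_zero] using this
    have hdnk : ∀ k t x, HasDerivAt (fun s : ℝ => nk k t (x + s • e k)) (nkk k t x) 0 := by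
      intro k t x
      have := hasDerivAt_two_sum_mul (fun i => (hf i).hasDerivAt k t x)
        (fun i => (hf i).hasDerivAt_D k t x)
      simpa using this
    have hdmk : ∀ k t x, HasDerivAt (fun s : ℝ => mk k t (x + s • e k)) (mkk k t x) 0 := by
      intro k t x
      have := hasDerivAt_two_sum_mul (fun i => (hh i).hasDerivAt k t x)
        (fun i => (hh i).hasDerivAt_D k t x)
      simpa using this
    have hdnt : ∀ t x, HasDerivAt (fun t => n t x) (nt t x) t := fun t x =>
      hasDerivAt_add_sum_sq (δ := δ) fun i => (hf i).heat t x
    have hdmt : ∀ t x, HasDerivAt (fun t => m t x) (mt t x) t := fun t x =>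
      hasDerivAt_add_sum_sq (δ := δ) fun i => (hh i).heat t x
    have hcP : ∀ r : ℝ, Continuous fun z : ℝ × E d => n z.1 z.2 ^ r := fun r =>
      hcn.rpow_const fun z => Or.inl (hn0 z.1 z.2).ne'
    have hcM : ∀ r : ℝ, Continuous fun z : ℝ × E d => m z.1 z.2 ^ r := fun r =>
      hcm.rpow_const fun z => Or.inl (hm0 z.1 z.2).ne'
    have hcn' : Continuous fun z : ℝ × E d => n z.1 z.2 := hcn
    have hcm' : Continuous fun z : ℝ × E d => m z.1 z.2 := hcm
    set Φ : ℝ → E d → ℝ := fun t x =>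
      n t x ^ q - A * m t x * n t x ^ (q - 1) - B * m t x ^ q with hΦ
    have hcΦ : Continuous (Function.uncurry Φ) :=
      ((hcP q).sub ((continuous_const.mul hcm').mul (hcP (q - 1)))).sub
        (continuous_const.mul (hcM q))
    set ψn : ℝ → E d → ℝ := fun t x =>
      q * n t x ^ (q - 1) - A * (q - 1) * m t x * n t x ^ (q - 1) / n t x with hψn
    set ψm : ℝ → E d → ℝ := fun t x =>
      -A * n t x ^ (q - 1) - B * q * m t x ^ (q - 1) with hψm
    have hcψn : Continuous fun z : ℝ × E d => ψn z.1 z.2 :=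
      (continuous_const.mul (hcP _)).sub
        (((continuous_const.mul hcm').mul (hcP _)).div hcn' fun z => (hn0 _ _).ne')
    have hcψm : Continuous fun z : ℝ × E d => ψm z.1 z.2 :=
      (continuous_const.mul (hcP _)).sub (continuous_const.mul (hcM _))
    set Φt : ℝ → E d → ℝ := fun t x => ψn t x * nt t x + ψm t x * mt t x with hΦt
    have hcΦt : Continuous (Function.uncurry Φt) := (hcψn.mul hcnt).add (hcψm.mul hcmt)
    have hdΦt : ∀ t x, HasDerivAt (fun t => Φ t x) (Φt t x) t := fun t x =>
      hasDerivAt_supersolution (hdnt t x) (hdmt t x) (hn0 t x) (hm0 t x)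
    set Φk : Fin d → ℝ → E d → ℝ := fun k t x => ψn t x * nk k t x + ψm t x * mk k t x with hΦk
    have hcΦk : ∀ k, Continuous (Function.uncurry (Φk k)) := fun k =>
      (hcψn.mul (hcnk k)).add (hcψm.mul (hcmk k))
    set Φkk : Fin d → ℝ → E d → ℝ := fun k t x => ψn t x * nkk k t x + ψm t x * mkk k t x
        + (q * (q - 1) * n t x ^ (q - 1) / n t x
            - A * (q - 1) * (q - 2) * m t x * n t x ^ (q - 1) / n t x ^ 2) * nk k t x ^ 2
        + 2 * (-A * (q - 1) * n t x ^ (q - 1) / n t x) * nk k t x * mk k t x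
        + (-B * q * (q - 1) * m t x ^ (q - 1) / m t x) * mk k t x ^ 2 with hΦkk
    have hcΦkk : ∀ k, Continuous (Function.uncurry (Φkk k)) := by
      intro k
      have c1 : Continuous fun z : ℝ × E d => nk k z.1 z.2 := hcnk k
      have c2 : Continuous fun z : ℝ × E d => mk k z.1 z.2 := hcmk k
      refine ((((hcψn.mul (hcnkk k)).add (hcψm.mul (hcmkk k))).add ?_).add ?_).add ?_
      · exact (((continuous_const.mul (hcP _)).div hcn' fun z => (hn0 _ _).ne').sub
          (((continuous_const.mul hcm').mul (hcP _)).div (hcn'.pow 2)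
            fun z => (pow_pos (hn0 _ _) 2).ne')).mul (c1.pow 2)
      · exact ((continuous_const.mul ((continuous_const.mul (hcP _)).div hcn'
          fun z => (hn0 _ _).ne')).mul c1).mul c2
      · exact ((continuous_const.mul (hcM _)).div hcm' fun z => (hm0 _ _).ne').mul (c2.pow 2)
    have hdΦk : ∀ k t x, HasDerivAt (fun s : ℝ => Φk k t (x + s • e k)) (Φkk k t x) 0 := by
      intro k t x
      have := hasDerivAt_deriv_supersolution (q := q) (A := A) (B := B) (t := 0)
        (n := fun s : ℝ => n t (x + s • e k)) (m := fun s : ℝ => m t (x + s • e k))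
        (n' := fun s : ℝ => nk k t (x + s • e k)) (m' := fun s : ℝ => mk k t (x + s • e k))
        (n'' := nkk k t x) (m'' := mkk k t x)
        (by simpa only [zero_smul, add_zero] using hdn k t x)
        (by simpa only [zero_smul, add_zero] using hdm k t x)
        (hdnk k t x) (hdmk k t x) (hn0 _ _) (hm0 _ _)
      simpa only [zero_smul, add_zero] using this
    have hper : ∀ t, Periodic (n t) ∧ Periodic (m t) ∧ (∀ k, Periodic (nk k t)) ∧
        ∀ k, Periodic (mk k t) := by
      intro t
      refine ⟨fun a x => ?_, fun a x => ?_, fun k a x => ?_, fun k a x => ?_⟩ <;>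
      simp only [hn, hm, hnk, hmk, fun i => (hf i).periodic t a x, fun i => (hh i).periodic t a x,
        fun i k => (hf i).periodic_D k t a x, fun i k => (hh i).periodic_D k t a x]
    have hperΦk : ∀ k t, Periodic (Φk k t) := fun k t a x => by
      simp only [hΦk, hψn, hψm, (hper t).1 a x, (hper t).2.1 a x, (hper t).2.2.1 k a x,
        (hper t).2.2.2 k a x]
    have hslice : ∀ {g : ℝ → E d → ℝ}, Continuous (Function.uncurry g) → ∀ t, Continuous (g t) :=
      fun hg t => hg.comp (by fun_prop : Continuous fun x : E d => (t, x))
    -- the Laplacian of `Φ` integrates to zero, and `Φ` is a supersolution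
    have hint0 : ∀ k t, ∫ x in cell d, Φkk k t x = 0 := fun k t =>
      integral_cell_deriv_eq_zero (hperΦk k t) (hslice (hcΦk k) t)
        (hslice (hcΦkk k) t) (hdΦk k t)
    have hineq : ∀ t x, ∑ k, Φkk k t x ≤ Φt t x := by
      intro t x
      have h1 := hAB (n t x) (m t x) (fun k => ∑ i, D i k t x ^ 2) (fun k => ∑ i, Dh i k t x ^ 2)
        (fun k => nk k t x) (fun k => mk k t x) (hm0 t x) (hmn t x)
        (fun k => by
          have := Finset.sum_mul_sq_le_sq_mul_sq Finset.univ (fun i => f i t x)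
            (fun i => D i k t x)
          have h2 : ∑ i, f i t x ^ 2 ≤ n t x := by simp only [hn]; linarith
          have h3 : (0 : ℝ) ≤ ∑ i, D i k t x ^ 2 := Finset.sum_nonneg fun _ _ => sq_nonneg _
          have h4 := mul_le_mul_of_nonneg_right h2 h3
          simp only [hnk, mul_pow]
          linarith)
        (fun k => by
          have := Finset.sum_mul_sq_le_sq_mul_sq Finset.univ (fun i => h i t x)
            (fun i => Dh i k t x)
          have h2 : ∑ i, h i t x ^ 2 ≤ m t x := by simp only [hm]; linarith
          have h3 : (0 : ℝ) ≤ ∑ i, Dh i k t x ^ 2 := Finset.sum_nonneg fun _ _ => sq_nonneg _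
          have h4 := mul_le_mul_of_nonneg_right h2 h3
          simp only [hmk, mul_pow]
          linarith)
        (fun k => Finset.sum_nonneg fun _ _ => sq_nonneg _) (fun k => hDD k t x) (hSR t x)
      have e1 : ∑ k, nkk k t x = nt t x + ∑ k, 2 * ∑ i, D i k t x ^ 2 := by
        simp only [hnkk, hnt, Finset.sum_add_distrib, mul_add]
        rw [add_comm]
        congr 1
        · rw [← Finset.mul_sum, Finset.sum_comm]
          simp only [Finset.mul_sum]
        · simp only [pow_two]
      have e2 : ∑ k, mkk k t x = mt t x + ∑ k, 2 * ∑ i, Dh i k t x ^ 2 := by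
        simp only [hmkk, hmt, Finset.sum_add_distrib, mul_add]
        rw [add_comm]
        congr 1
        · rw [← Finset.mul_sum, Finset.sum_comm]
          simp only [Finset.mul_sum]
        · simp only [pow_two]
      have e3 : ∑ k, (ψn t x * nkk k t x + ψm t x * mkk k t x) = Φt t x +
          ∑ k, (ψn t x * (2 * ∑ i, D i k t x ^ 2) + ψm t x * (2 * ∑ i, Dh i k t x ^ 2)) := by
        have e4 : ∑ k, ψn t x * nkk k t x = ψn t x * ∑ k, nkk k t x := (Finset.mul_sum _ _ _).symm
        have e5 : ∑ k, ψm t x * mkk k t x = ψm t x * ∑ k, mkk k t x := (Finset.mul_sum _ _ _).symm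
        rw [Finset.sum_add_distrib, e4, e5, e1, e2, Finset.sum_add_distrib, mul_add, mul_add,
          Finset.mul_sum, Finset.mul_sum]
        simp only [hΦt]; ring
      simp only [Finset.sum_add_distrib] at h1 e3
      simp only [hΦkk, Finset.sum_add_distrib]
      simp only [hψn, hψm] at e3 ⊢
      linarith
    -- hence `∫ Φ` is monotone in time, with a limit that is nonpositive because `1 ≤ A`
    set I : ℝ → ℝ := fun t => ∫ x in cell d, Φ t x with hI
    have hdI : ∀ t, HasDerivAt I (∫ x in cell d, Φt t x) t := fun t =>
      hasDerivAt_cell_integral univ_mem (hslice hcΦ) hcΦt fun t _ x => hdΦt t x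
    have hI' : ∀ t, 0 ≤ ∫ x in cell d, Φt t x := by
      intro t
      calc (0 : ℝ) = ∑ k, ∫ x in cell d, Φkk k t x := by simp [hint0]
        _ = ∫ x in cell d, ∑ k, Φkk k t x :=
            (integral_finsetSum _ fun k _ => integrable_cell (hslice (hcΦkk k) t)).symm
        _ ≤ ∫ x in cell d, Φt t x :=
            integral_mono (integrable_cell (continuous_finsetSum _ fun k _ => hslice (hcΦkk k) t))
              (integrable_cell (hslice hcΦt t)) (hineq t)
    have hmono : Monotone I := monotone_of_deriv_nonneg (fun t => (hdI t).differentiableAt)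
      fun t => by rw [(hdI t).deriv]; exact hI' t
    have hlim : Tendsto I atTop (𝓝 (∫ _ in cell d, (δ ^ q - A * δ * δ ^ (q - 1) - B * δ ^ q))) := by
      choose Cf hCf using fun i => (hf i).bound
      set N : ℝ := δ + ∑ i, Cf i ^ 2 with hN
      have hnN : ∀ t, 0 ≤ t → ∀ x, n t x ≤ N := by
        intro t ht x
        simp only [hn, hN]
        gcongr 2 with i
        refine sq_le_sq' ?_ ?_
        · exact (abs_le.1 (hCf i t ht x)).1
        · exact (abs_le.1 (hCf i t ht x)).2
      refine tendsto_integral_filter_of_dominated_convergence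
        (fun _ => N ^ q + A * N ^ q + B * N ^ q)
        (Eventually.of_forall fun t => (hslice hcΦ t).aestronglyMeasurable) ?_
        (integrable_const _) ?_
      · filter_upwards [eventually_ge_atTop 0] with t ht
        refine Eventually.of_forall fun x => ?_
        have hn1 := hn0 t x
        have hm1 := hm0 t x
        have b1 : n t x ^ q ≤ N ^ q := Real.rpow_le_rpow hn1.le (hnN t ht x) hq0.le
        have b2 : m t x ^ q ≤ N ^ q := Real.rpow_le_rpow hm1.le ((hmn t x).trans (hnN t ht x)) hq0.le
        have b3 : m t x * n t x ^ (q - 1) ≤ N ^ q := by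
          calc m t x * n t x ^ (q - 1) ≤ n t x * n t x ^ (q - 1) := by
                have := hmn t x; gcongr
            _ = n t x ^ q := by rw [Real.rpow_sub_one hn1.ne']; field_simp
            _ ≤ _ := b1
        have b4 : 0 ≤ n t x ^ q := by positivity
        have b5 : 0 ≤ m t x * n t x ^ (q - 1) := by positivity
        have b6 : 0 ≤ m t x ^ q := by positivity
        have b7 : A * (m t x * n t x ^ (q - 1)) ≤ A * N ^ q := by gcongr
        have b8 : 0 ≤ A * (m t x * n t x ^ (q - 1)) := by positivity
        have b9 : B * m t x ^ q ≤ B * N ^ q := by gcongr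
        have b10 : 0 ≤ B * m t x ^ q := by positivity
        rw [Real.norm_eq_abs, abs_le]
        simp only [hΦ, mul_assoc]
        constructor <;> linarith
      · refine Eventually.of_forall fun x => ?_
        have l1 : Tendsto (fun t => n t x) atTop (𝓝 δ) := by
          have := (tendsto_finsetSum (Finset.univ : Finset ι) fun i _ =>
            ((hf i).decay x).pow 2).const_add δ
          simpa using this
        have l2 : Tendsto (fun t => m t x) atTop (𝓝 δ) := by
          have := (tendsto_finsetSum (Finset.univ : Finset κ) fun i _ =>
            ((hh i).decay x).pow 2).const_add δ
          simpa using this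
        exact ((l1.rpow_const (Or.inl hδ.ne')).sub ((l2.const_mul A).mul
          (l1.rpow_const (Or.inl hδ.ne')))).sub ((l2.rpow_const (Or.inl hδ.ne')).const_mul B)
    have hI0 : I 0 ≤ 0 := by
      have h1 : I 0 ≤ ∫ _ in cell d, (δ ^ q - A * δ * δ ^ (q - 1) - B * δ ^ q) :=
        ge_of_tendsto hlim (by filter_upwards [eventually_ge_atTop 0] with t ht using hmono ht)
      rw [integral_const, probReal_univ, one_smul] at h1
      have h2 : A * δ * δ ^ (q - 1) = A * δ ^ q := by
        rw [Real.rpow_sub_one hδ.ne']; field_simp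
      rw [h2] at h1
      have h3 : 0 < δ ^ q := by positivity
      nlinarith
    -- Young's inequality absorbs the mixed term
    have hyoung : ∀ x, n 0 x ^ q ≤ 2 * Φ 0 x
        + 2 * (A * (2 * A) ^ (q - 1) + B) * m 0 x ^ q := by
      intro x
      have key := weighted_young hq hA (hm0 0 x) (hn0 0 x)
      simp only [hΦ]
      linarith
    have hcP0 : Continuous fun x => n 0 x ^ q :=
      (hcP q).comp (by fun_prop : Continuous fun x : E d => ((0 : ℝ), x))
    have hcM0 : Continuous fun x => m 0 x ^ q :=
      (hcM q).comp (by fun_prop : Continuous fun x : E d => ((0 : ℝ), x))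
    have hcf0 : Continuous fun x => ∑ i, f i 0 x ^ 2 :=
      continuous_finsetSum _ fun i _ => (hslice (hcf i) 0).pow 2
    calc ∫ x in cell d, (∑ i, f i 0 x ^ 2) ^ q ≤ ∫ x in cell d, n 0 x ^ q := by
          refine integral_mono (integrable_cell (hcf0.rpow_const fun _ => Or.inr hq0.le))
            (integrable_cell hcP0) fun x => ?_
          refine Real.rpow_le_rpow (Finset.sum_nonneg fun _ _ => sq_nonneg _) ?_ hq0.le
          simp only [hn]; linarith
      _ ≤ ∫ x in cell d, (2 * Φ 0 x + 2 * (A * (2 * A) ^ (q - 1) + B) * m 0 x ^ q) :=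
          integral_mono (integrable_cell hcP0) (integrable_cell
            (((hslice hcΦ 0).const_mul 2).add (hcM0.const_mul _))) hyoung
      _ = 2 * I 0 + 2 * (A * (2 * A) ^ (q - 1) + B) * ∫ x in cell d, m 0 x ^ q := by
          rw [integral_add (integrable_cell ((hslice hcΦ 0).const_mul 2))
            (integrable_cell (hcM0.const_mul _)), integral_const_mul, integral_const_mul]
      _ ≤ _ := by linarith
  -- let `δ → 0`
  have hch0 : Continuous fun x => ∑ i, h i 0 x ^ 2 := continuous_finsetSum _ fun i _ =>
    ((hh i).cont.comp (by fun_prop : Continuous fun x : E d => ((0 : ℝ), x))).pow 2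
  have hlim : Continuous fun δ : ℝ => ∫ x in cell d, (δ + ∑ i, h i 0 x ^ 2) ^ q := by
    refine continuous_cell_integral (Continuous.rpow_const ?_ fun _ => Or.inr hq0.le)
    exact continuous_fst.add (hch0.comp continuous_snd)
  have h1 : Tendsto (fun δ : ℝ => 2 * (A * (2 * A) ^ (q - 1) + B) *
      ∫ x in cell d, (δ + ∑ i, h i 0 x ^ 2) ^ q) (𝓝[>] 0)
      (𝓝 (2 * (A * (2 * A) ^ (q - 1) + B) * ∫ x in cell d, (0 + ∑ i, h i 0 x ^ 2) ^ q)) :=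
    ((hlim.tendsto 0).const_mul _).mono_left nhdsWithin_le_nhds
  simp only [zero_add] at h1
  exact ge_of_tendsto h1 (by filter_upwards [self_mem_nhdsWithin] with δ hδ using main δ hδ)

end HeatFlow

/-! ### Trigonometric polynomials -/

section Trig

variable {d : ℕ}

/-- The phase `2π k · x` of the Fourier mode with frequency `k`. -/
noncomputable def phase (k : Fin d → ℤ) (x : E d) : ℝ := 2 * Real.pi * ∑ a, (k a : ℝ) * x a

lemma continuous_phase (k : Fin d → ℤ) : Continuous (phase k) := by
  unfold phase; fun_prop

lemma phase_add (k : Fin d → ℤ) (x y : E d) : phase k (x + y) = phase k x + phase k y := by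
  simp [phase, mul_add, Finset.sum_add_distrib]

lemma phase_sub (k : Fin d → ℤ) (x y : E d) : phase k (x - y) = phase k x - phase k y := by
  simp [phase, mul_sub, Finset.sum_sub_distrib]

lemma phase_smul_e (k : Fin d → ℤ) (s : ℝ) (a : Fin d) :
    phase k (s • e a) = s * (2 * Real.pi * k a) := by
  simp [phase, e]; ring

lemma phase_e (k : Fin d → ℤ) (a : Fin d) : phase k (e a) = k a * (2 * Real.pi) := by
  have := phase_smul_e k 1 a
  rw [one_smul] at this
  rw [this]; ring

/-- The trigonometric polynomial with frequencies `k j`, evolved by the heat flow. -/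
noncomputable def trigHeat {N : ℕ} (k : Fin N → Fin d → ℤ) (α β : Fin N → ℝ) (t : ℝ) (x : E d) :
    ℝ :=
  ∑ j, Real.exp (-(∑ b, (2 * Real.pi * k j b) ^ 2) * t) *
    (α j * Real.cos (phase (k j) x) + β j * Real.sin (phase (k j) x))

variable {N : ℕ} {k : Fin N → Fin d → ℤ} {α β : Fin N → ℝ}

lemma continuous_trigHeat : Continuous (Function.uncurry (trigHeat k α β)) := by
  have h : ∀ j, Continuous fun z : ℝ × E d => phase (k j) z.2 := fun j =>
    (continuous_phase _).comp continuous_snd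
  unfold trigHeat Function.uncurry
  fun_prop

lemma periodic_trigHeat (t : ℝ) : Periodic (trigHeat k α β t) := by
  intro a x
  simp only [trigHeat, phase_add, phase_e, Real.cos_add_int_mul_two_pi,
    Real.sin_add_int_mul_two_pi]

lemma hasDerivAt_trigHeat (b : Fin d) (t : ℝ) (x : E d) :
    HasDerivAt (fun s : ℝ => trigHeat k α β t (x + s • e b))
      (trigHeat k (fun j => 2 * Real.pi * k j b * β j) (fun j => -(2 * Real.pi * k j b * α j)) t x)
      0 := by
  unfold trigHeat
  refine HasDerivAt.fun_sum fun j _ => ?_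
  have h1 : HasDerivAt (fun s : ℝ => phase (k j) (x + s • e b)) (2 * Real.pi * k j b) 0 := by
    simp only [phase_add, phase_smul_e]
    simpa using ((hasDerivAt_id (0 : ℝ)).mul_const (2 * Real.pi * (k j b : ℝ))).const_add
      (phase (k j) x)
  refine (((h1.cos.const_mul (α j)).add (h1.sin.const_mul (β j))).const_mul
    (Real.exp (-(∑ b, (2 * Real.pi * k j b) ^ 2) * t))).congr_deriv ?_
  simp only [zero_smul, add_zero]
  ring

lemma hasDerivAt_trigHeat_time (t : ℝ) (x : E d) :
    HasDerivAt (fun t => trigHeat k α β t x)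
      (∑ b, trigHeat k (fun j => 2 * Real.pi * k j b * -(2 * Real.pi * k j b * α j))
        (fun j => -(2 * Real.pi * k j b * (2 * Real.pi * k j b * β j))) t x) t := by
  unfold trigHeat
  rw [Finset.sum_comm]
  refine HasDerivAt.fun_sum fun j _ => ?_
  have h1 : HasDerivAt (fun t : ℝ => -(∑ b, (2 * Real.pi * (k j b : ℝ)) ^ 2) * t)
      (-(∑ b, (2 * Real.pi * (k j b : ℝ)) ^ 2)) t := by
    simpa using (hasDerivAt_id t).const_mul (-(∑ b, (2 * Real.pi * (k j b : ℝ)) ^ 2))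
  refine (h1.exp.mul_const _).congr_deriv ?_
  rw [← Finset.mul_sum, mul_assoc]
  congr 1
  rw [← Finset.sum_neg_distrib, Finset.sum_mul]
  refine Finset.sum_congr rfl fun b _ => ?_
  ring

/-- Decay requires that the constant mode is absent, as it is for derivatives. -/
lemma isDecayingCaloric_trigHeat (h0 : ∀ j, k j = 0 → α j = 0 ∧ β j = 0) :
    IsDecayingCaloric (trigHeat k α β)
      (fun b => trigHeat k (fun j => 2 * Real.pi * k j b * β j)
        (fun j => -(2 * Real.pi * k j b * α j)))
      (fun b => trigHeat k (fun j => 2 * Real.pi * k j b * -(2 * Real.pi * k j b * α j))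
        (fun j => -(2 * Real.pi * k j b * (2 * Real.pi * k j b * β j)))) where
  periodic := periodic_trigHeat
  periodic_D _ := periodic_trigHeat
  cont := continuous_trigHeat
  cont_D _ := continuous_trigHeat
  cont_DD _ := continuous_trigHeat
  hasDerivAt := hasDerivAt_trigHeat
  hasDerivAt_D b t x := hasDerivAt_trigHeat b t x
  heat := hasDerivAt_trigHeat_time
  bound := by
    refine ⟨∑ j, (|α j| + |β j|), fun t ht x => ?_⟩
    refine (Finset.abs_sum_le_sum_abs _ _).trans (Finset.sum_le_sum fun j _ => ?_)
    rw [abs_mul, abs_of_pos (Real.exp_pos _)]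
    have h1 : Real.exp (-(∑ b, (2 * Real.pi * (k j b : ℝ)) ^ 2) * t) ≤ 1 := by
      rw [Real.exp_le_one_iff]
      have : 0 ≤ ∑ b, (2 * Real.pi * (k j b : ℝ)) ^ 2 := Finset.sum_nonneg fun _ _ => sq_nonneg _
      nlinarith
    have h2 : |α j * Real.cos (phase (k j) x) + β j * Real.sin (phase (k j) x)| ≤ |α j| + |β j| := by
      refine (abs_add_le _ _).trans (add_le_add ?_ ?_) <;> rw [abs_mul]
      · exact mul_le_of_le_one_right (abs_nonneg _) (Real.abs_cos_le_one _)
      · exact mul_le_of_le_one_right (abs_nonneg _) (Real.abs_sin_le_one _)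
    calc _ ≤ 1 * (|α j| + |β j|) := mul_le_mul h1 h2 (abs_nonneg _) zero_le_one
      _ = _ := one_mul _
  decay x := by
    rw [show (0 : ℝ) = ∑ j : Fin N, (0 : ℝ) by simp]
    refine tendsto_finsetSum _ fun j _ => ?_
    by_cases hk : k j = 0
    · simp [h0 j hk]
    · obtain ⟨b, hb⟩ := Function.ne_iff.1 hk
      have hpos : 0 < ∑ b, (2 * Real.pi * (k j b : ℝ)) ^ 2 := by
        refine Finset.sum_pos' (fun _ _ => sq_nonneg _) ⟨b, Finset.mem_univ _, ?_⟩
        have : (k j b : ℝ) ≠ 0 := by exact_mod_cast hb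
        have := Real.pi_pos
        positivity
      have h1 : Tendsto (fun t : ℝ => -(∑ b, (2 * Real.pi * (k j b : ℝ)) ^ 2) * t) atTop atBot :=
        tendsto_id.const_mul_atTop_of_neg (by linarith)
      simpa using (Real.tendsto_exp_atBot.comp h1).mul_const
        (α j * Real.cos (phase (k j) x) + β j * Real.sin (phase (k j) x))

/-- Symmetrization does not increase the Euclidean norm. -/
lemma sum_sq_symmetrize_le (X : Fin d → Fin d → ℝ) :
    ∑ i : Fin d × Fin d, ((X i.1 i.2 + X i.2 i.1) / 2) ^ 2 ≤ ∑ i : Fin d × Fin d, X i.1 i.2 ^ 2 := by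
  have h1 : ∑ i : Fin d × Fin d, X i.2 i.1 ^ 2 = ∑ i : Fin d × Fin d, X i.1 i.2 ^ 2 :=
    (Equiv.prodComm (Fin d) (Fin d)).sum_comp fun i => X i.1 i.2 ^ 2
  calc ∑ i : Fin d × Fin d, ((X i.1 i.2 + X i.2 i.1) / 2) ^ 2
      ≤ ∑ i : Fin d × Fin d, (X i.1 i.2 ^ 2 / 2 + X i.2 i.1 ^ 2 / 2) :=
        Finset.sum_le_sum fun i _ => by nlinarith [sq_nonneg (X i.1 i.2 - X i.2 i.1)]
    _ = _ := by rw [Finset.sum_add_distrib, ← Finset.sum_div, ← Finset.sum_div, h1]; ring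

/-- The second gradient `Y c a b = ∂_c ∂_b v_a` of a vector field is bounded by the derivatives
`Z c a b = ∂_c e_ab` of its symmetrized gradient, since
`∂_c ∂_b v_a = ∂_c e_ab + ∂_b e_ac - ∂_a e_cb`. -/
lemma sum_sq_le_nine_symmetrize (Y : Fin d → Fin d → Fin d → ℝ) (hY : ∀ c a b, Y c a b = Y b a c) :
    ∑ c, ∑ i : Fin d × Fin d, Y c i.1 i.2 ^ 2
      ≤ 9 * ∑ c, ∑ i : Fin d × Fin d, ((Y c i.1 i.2 + Y c i.2 i.1) / 2) ^ 2 := by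
  set Z : Fin d → Fin d → Fin d → ℝ := fun c a b => (Y c a b + Y c b a) / 2 with hZ
  have h : ∀ c a b, Y c a b ^ 2 ≤ 3 * (Z c a b ^ 2 + Z b a c ^ 2 + Z a c b ^ 2) := by
    intro c a b
    have : Y c a b = Z c a b + Z b a c - Z a c b := by
      simp only [hZ]
      rw [hY b a c, hY b c a, hY a b c]
      ring
    rw [this]
    nlinarith [sq_nonneg (Z c a b - Z b a c), sq_nonneg (Z c a b + Z a c b),
      sq_nonneg (Z b a c + Z a c b)]
  simp only [Fintype.sum_prod_type]
  have e1 : ∑ c, ∑ a, ∑ b, Z b a c ^ 2 = ∑ c, ∑ a, ∑ b, Z c a b ^ 2 := by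
    calc ∑ c, ∑ a, ∑ b, Z b a c ^ 2 = ∑ c, ∑ b, ∑ a, Z b a c ^ 2 :=
          Finset.sum_congr rfl fun c _ => Finset.sum_comm
      _ = ∑ b, ∑ c, ∑ a, Z b a c ^ 2 := Finset.sum_comm
      _ = _ := Finset.sum_congr rfl fun c _ => Finset.sum_comm
  have e2 : ∑ c, ∑ a, ∑ b, Z a c b ^ 2 = ∑ c, ∑ a, ∑ b, Z c a b ^ 2 := Finset.sum_comm
  calc ∑ c, ∑ a, ∑ b, Y c a b ^ 2
      ≤ ∑ c, ∑ a, ∑ b, 3 * (Z c a b ^ 2 + Z b a c ^ 2 + Z a c b ^ 2) :=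
        Finset.sum_le_sum fun c _ => Finset.sum_le_sum fun a _ => Finset.sum_le_sum fun b _ => h c a b
    _ = _ := by
        simp only [← Finset.mul_sum, Finset.sum_add_distrib, e1, e2]
        ring

lemma trigHeat_half_add (α' β' : Fin N → ℝ) (t : ℝ) (x : E d) :
    trigHeat k (fun j => (α j + α' j) / 2) (fun j => (β j + β' j) / 2) t x
      = (trigHeat k α β t x + trigHeat k α' β' t x) / 2 := by
  unfold trigHeat
  rw [← Finset.sum_add_distrib, Finset.sum_div]
  refine Finset.sum_congr rfl fun j _ => ?_
  ring

/-- Korn's second inequality, without lower order terms, for trigonometric polynomials. -/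
theorem exists_korn_trig (d : ℕ) {q : ℝ} (hq : 1 < q) :
    ∃ C : ℝ, 0 ≤ C ∧ ∀ (N : ℕ) (k : Fin N → Fin d → ℤ) (α β : Fin d → Fin N → ℝ)
      (G : Fin d → Fin d → E d → ℝ),
      (∀ a b, G a b = trigHeat k (fun j => 2 * Real.pi * k j b * β a j)
        (fun j => -(2 * Real.pi * k j b * α a j)) 0) →
      ∫ x in cell d, (∑ i : Fin d × Fin d, G i.1 i.2 x ^ 2) ^ q ≤
        C * ∫ x in cell d, (∑ i : Fin d × Fin d, ((G i.1 i.2 x + G i.2 i.1 x) / 2) ^ 2) ^ q := by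
  obtain ⟨C, hC, h⟩ := exists_caloric_comparison (d := d) hq (by norm_num : (0 : ℝ) < 9)
  refine ⟨C, hC, fun N k α β G hG => ?_⟩
  set κ : Fin N → Fin d → ℝ := fun j b => 2 * Real.pi * k j b with hκ
  have hκ0 : ∀ j, k j = 0 → ∀ b, κ j b = 0 := fun j hj b => by simp [hκ, hj]
  have hf : ∀ i : Fin d × Fin d, _ := fun i => isDecayingCaloric_trigHeat (k := k)
    (α := fun j => κ j i.2 * β i.1 j) (β := fun j => -(κ j i.2 * α i.1 j))
    (fun j hj => by simp [hκ0 j hj])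
  have hh : ∀ i : Fin d × Fin d, _ := fun i => isDecayingCaloric_trigHeat (k := k)
    (α := fun j => (κ j i.2 * β i.1 j + κ j i.1 * β i.2 j) / 2)
    (β := fun j => (-(κ j i.2 * α i.1 j) + -(κ j i.1 * α i.2 j)) / 2)
    (fun j hj => by simp [hκ0 j hj])
  have hD : ∀ (i : Fin d × Fin d) (c : Fin d) (t : ℝ) (x : E d),
      trigHeat k (fun j => 2 * Real.pi * k j c * ((-(κ j i.2 * α i.1 j) + -(κ j i.1 * α i.2 j)) / 2))
        (fun j => -(2 * Real.pi * k j c * ((κ j i.2 * β i.1 j + κ j i.1 * β i.2 j) / 2))) t x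
      = (trigHeat k (fun j => 2 * Real.pi * k j c * -(κ j i.2 * α i.1 j))
        (fun j => -(2 * Real.pi * k j c * (κ j i.2 * β i.1 j))) t x
        + trigHeat k (fun j => 2 * Real.pi * k j c * -(κ j i.1 * α i.2 j))
        (fun j => -(2 * Real.pi * k j c * (κ j i.1 * β i.2 j))) t x) / 2 := by
    intro i c t x
    rw [← trigHeat_half_add]
    congr 1 <;> · funext j; ring
  have := h hf hh ?_ ?_ ?_
  · simp only [trigHeat_half_add] at this
    simpa only [hG] using this
  · intro t x
    simp only [trigHeat_half_add]
    exact sum_sq_symmetrize_le fun a b => trigHeat k (fun j => κ j b * β a j)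
      (fun j => -(κ j b * α a j)) t x
  · intro c t x
    simp only [hD]
    exact sum_sq_symmetrize_le fun a b => trigHeat k (fun j => 2 * Real.pi * k j c * -(κ j b * α a j))
      (fun j => -(2 * Real.pi * k j c * (κ j b * β a j))) t x
  · intro t x
    simp only [hD]
    refine sum_sq_le_nine_symmetrize (fun c a b => trigHeat k
      (fun j => 2 * Real.pi * k j c * -(κ j b * α a j))
      (fun j => -(2 * Real.pi * k j c * (κ j b * β a j))) t x) fun c a b => ?_
    simp only [hκ]
    congr 1 <;> · funext j; ring

end Trig

/-! ### Approximation by trigonometric polynomials -/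

section Approximation

variable {d : ℕ}

/-- The functions `x ↦ cos (2π k · x + c)` span the real trigonometric polynomials. -/
noncomputable def trigSpan (d : ℕ) : Submodule ℝ (E d → ℝ) :=
  Submodule.span ℝ (Set.range fun kc : (Fin d → ℤ) × ℝ => fun x => Real.cos (phase kc.1 x + kc.2))

lemma cos_mem_trigSpan (k : Fin d → ℤ) (c : ℝ) :
    (fun x => Real.cos (phase k x + c)) ∈ trigSpan d :=
  Submodule.subset_span ⟨(k, c), rfl⟩

lemma phase_zero_left (x : E d) : phase 0 x = 0 := by simp [phase]

lemma one_mem_trigSpan : (1 : E d → ℝ) ∈ trigSpan d := by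
  have := cos_mem_trigSpan (d := d) 0 0
  simp only [phase_zero_left, add_zero, Real.cos_zero] at this
  exact this

lemma mul_mem_trigSpan {f g : E d → ℝ} (hf : f ∈ trigSpan d) (hg : g ∈ trigSpan d) :
    f * g ∈ trigSpan d := by
  have h : f * g ∈ trigSpan d * trigSpan d := Submodule.mul_mem_mul hf hg
  rw [trigSpan, Submodule.span_mul_span] at h
  refine Submodule.span_le.2 ?_ h
  rintro _ ⟨_, ⟨⟨k, c⟩, rfl⟩, _, ⟨⟨l, c'⟩, rfl⟩, rfl⟩
  have : ((fun x => Real.cos (phase k x + c)) * fun x => Real.cos (phase l x + c') : E d → ℝ)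
      = (1 / 2 : ℝ) • (fun x => Real.cos (phase (k + l) x + (c + c')))
        + (1 / 2 : ℝ) • fun x => Real.cos (phase (k - l) x + (c - c')) := by
    funext x
    have e1 : phase (k + l) x + (c + c') = (phase k x + c) + (phase l x + c') := by
      simp [phase, add_mul, Finset.sum_add_distrib]; ring
    have e2 : phase (k - l) x + (c - c') = (phase k x + c) - (phase l x + c') := by
      simp [phase, sub_mul, Finset.sum_sub_distrib]; ring
    simp only [Pi.mul_apply, Pi.add_apply, Pi.smul_apply, smul_eq_mul]
    rw [e1, e2, Real.cos_add (phase k x + c), Real.cos_sub (phase k x + c)]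
    ring
  change (fun x => Real.cos (phase k x + c)) * (fun x => Real.cos (phase l x + c')) ∈ trigSpan d
  rw [this]
  exact add_mem (Submodule.smul_mem _ _ (cos_mem_trigSpan _ _))
    (Submodule.smul_mem _ _ (cos_mem_trigSpan _ _))

/-- A trigonometric polynomial with values in `[0, 1]`, equal to `1` at the lattice points only. -/
noncomputable def bump (x : E d) : ℝ := ∏ a, (1 + Real.cos (2 * Real.pi * x a)) / 2

lemma bump_mem_trigSpan : (bump : E d → ℝ) ∈ trigSpan d := by
  have h : (bump : E d → ℝ) = ∏ a, fun x : E d => (1 + Real.cos (2 * Real.pi * x a)) / 2 := by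
    funext x; simp [bump]
  rw [h]
  refine Finset.prod_induction _ (· ∈ trigSpan d) (fun _ _ => mul_mem_trigSpan) one_mem_trigSpan ?_
  intro a _
  have h1 : (fun x : E d => (1 + Real.cos (2 * Real.pi * x a)) / 2)
      = (1 / 2 : ℝ) • (1 : E d → ℝ) + (1 / 2 : ℝ) •
        fun x => Real.cos (phase (Pi.single a 1) x + 0) := by
    funext x
    have : phase (Pi.single a 1) x = 2 * Real.pi * x a := by
      simp [phase, Pi.single_apply]
    simp [this]; ring
  rw [h1]
  exact add_mem (Submodule.smul_mem _ _ one_mem_trigSpan)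
    (Submodule.smul_mem _ _ (cos_mem_trigSpan _ _))

lemma bump_pow_mem_trigSpan (n : ℕ) : (bump ^ n : E d → ℝ) ∈ trigSpan d := by
  induction n with
  | zero => simpa using one_mem_trigSpan
  | succ n ih => rw [pow_succ]; exact mul_mem_trigSpan ih bump_mem_trigSpan

lemma contDiff_bump : ContDiff ℝ (⊤ : ℕ∞) (bump : E d → ℝ) := by
  unfold bump
  have h : ∀ a : Fin d, ContDiff ℝ (⊤ : ℕ∞) fun x : E d => x a := fun a =>
    (EuclideanSpace.proj (𝕜 := ℝ) a).contDiff
  refine contDiff_prod fun a _ => ?_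
  exact (contDiff_const.add (contDiff_const.mul (h a)).cos).div_const _

lemma continuous_bump : Continuous (bump : E d → ℝ) := contDiff_bump.continuous

lemma periodic_bump : Periodic (bump : E d → ℝ) := by
  intro b x
  unfold bump
  refine Finset.prod_congr rfl fun a _ => ?_
  congr 2
  by_cases h : a = b
  · subst h
    simp [e, mul_add, Real.cos_add_two_pi]
  · simp [e, h]

lemma bump_factor_mem (s : ℝ) : 0 ≤ (1 + Real.cos s) / 2 ∧ (1 + Real.cos s) / 2 ≤ 1 := by
  have := Real.neg_one_le_cos s
  have := Real.cos_le_one s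
  constructor <;> linarith

lemma bump_nonneg (x : E d) : 0 ≤ bump x := Finset.prod_nonneg fun _ _ => (bump_factor_mem _).1

lemma bump_zero : bump (0 : E d) = 1 := by simp [bump]

lemma bump_lt_one {x : E d} {a : Fin d} (h : x a ≠ 0) (h1 : |x a| ≤ 1 / 2) : bump x < 1 := by
  unfold bump
  rw [← Finset.mul_prod_erase _ _ (Finset.mem_univ a)]
  have h2 : ∏ b ∈ Finset.univ.erase a, (1 + Real.cos (2 * Real.pi * x b)) / 2 ≤ 1 :=
    Finset.prod_le_one (fun _ _ => (bump_factor_mem _).1) fun _ _ => (bump_factor_mem _).2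
  have h3 : Real.cos (2 * Real.pi * x a) < 1 := by
    refine lt_of_le_of_ne (Real.cos_le_one _) fun h4 => h ?_
    have hpi := Real.pi_pos
    have h5 := abs_le.1 h1
    have h6 := (Real.cos_eq_one_iff_of_lt_of_lt (by nlinarith) (by nlinarith)).1 h4
    have : (2 * Real.pi) ≠ 0 := by positivity
    exact (mul_eq_zero.1 h6).resolve_left this
  calc _ ≤ (1 + Real.cos (2 * Real.pi * x a)) / 2 * 1 :=
        mul_le_mul_of_nonneg_left h2 (bump_factor_mem _).1
    _ < 1 := by linarith

/-- The mass of the kernel `bump ^ n`. -/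
noncomputable def bumpMass (d n : ℕ) : ℝ := ∫ x in cell d, (bump x : ℝ) ^ n

/-- The trigonometric polynomial of degree `n` that approximates `f`: its convolution with the
normalized kernel `bump ^ n`. -/
noncomputable def trigApprox (n : ℕ) (f : E d → ℝ) (x : E d) : ℝ :=
  (bumpMass d n)⁻¹ * ∫ z in cell d, bump (z - x) ^ n * f z

variable {f : E d → ℝ}

lemma trigApprox_eq (n : ℕ) (hp : Periodic f) (x : E d) :
    trigApprox n f x = (bumpMass d n)⁻¹ * ∫ z in cell d, bump z ^ n * f (x + z) := by
  unfold trigApprox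
  congr 1
  have h : Periodic fun z => bump (z - x) ^ n * f z := by
    intro a z
    have : z + e a - x = z - x + e a := by abel
    simp only [this, periodic_bump a, hp a]
  rw [← setIntegral_cell_add h x]
  refine integral_congr_ae (Eventually.of_forall fun z => ?_)
  simp only [add_comm z x, add_sub_cancel_left]

lemma abs_trigApprox_le (n : ℕ) (hp : Periodic f) (hf : Continuous f) {C : ℝ}
    (hC0 : 0 ≤ C) (hC : ∀ x, |f x| ≤ C) (x : E d) : |trigApprox n f x| ≤ C := by
  have hm : 0 ≤ bumpMass d n := integral_nonneg fun x => pow_nonneg (bump_nonneg x) n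
  have hcb : Continuous fun z : E d => bump z ^ n := continuous_bump.pow n
  rw [trigApprox_eq n hp, abs_mul, abs_of_nonneg (inv_nonneg.2 hm)]
  have h1 : |∫ z in cell d, bump z ^ n * f (x + z)| ≤ ∫ z in cell d, C * bump z ^ n := by
    refine (abs_integral_le_integral_abs).trans (integral_mono ?_ ?_ fun z => ?_)
    · exact (integrable_cell (hcb.mul (hf.comp (by fun_prop)))).abs
    · exact integrable_cell (hcb.const_mul _)
    · simp only [abs_mul, abs_of_nonneg (pow_nonneg (bump_nonneg z) n)]
      rw [mul_comm]
      exact mul_le_mul_of_nonneg_right (hC _) (pow_nonneg (bump_nonneg z) n)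
  rw [integral_const_mul] at h1
  calc _ ≤ (bumpMass d n)⁻¹ * (C * bumpMass d n) := mul_le_mul_of_nonneg_left h1 (inv_nonneg.2 hm)
    _ = C * ((bumpMass d n)⁻¹ * bumpMass d n) := by ring
    _ ≤ C * 1 := mul_le_mul_of_nonneg_left (inv_mul_le_one) hC0
    _ = C := mul_one C

/-- The kernels `bump ^ n` concentrate at the maximum of `bump`. -/
lemma tendsto_trigApprox (hp : Periodic f) (hf : Continuous f) (x : E d) :
    Tendsto (fun n => trigApprox n f x) atTop (𝓝 (f x)) := by
  -- the kernel is shifted to the centre `c` of the cell, where it has a unique maximum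
  set c : E d := WithLp.toLp 2 fun _ => (1 / 2 : ℝ) with hc
  have hca : ∀ a, c a = 1 / 2 := fun a => rfl
  have hbc : Continuous fun z : E d => bump (z - c) := continuous_bump.comp (by fun_prop)
  have hpb : ∀ n, Periodic fun z : E d => bump z ^ n := fun n a z => by
    simp only [periodic_bump a z]
  have h := tendsto_setIntegral_pow_smul_of_unique_maximum_of_isCompact_of_measure_nhdsWithin_pos
    (μ := volume.restrict (cell d)) (s := closedCell d) (x₀ := c)
    (c := fun z => bump (z - c)) (g := fun z => f (x + (z - c))) isCompact_closedCell ?_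
    hbc.continuousOn ?_ (fun z _ => bump_nonneg _) ?_ ?_ ?_ ?_
  · simp only [restrict_cell_restrict cell_subset_closedCell, sub_self, add_zero, smul_eq_mul] at h
    refine h.congr fun n => ?_
    rw [trigApprox_eq n hp, bumpMass]
    have hp2 : Periodic fun z => bump z ^ n * f (x + z) := fun a z => by
      simp only [periodic_bump a z, ← add_assoc, hp a]
    rw [← setIntegral_cell_add (hpb n) (-c), ← setIntegral_cell_add hp2 (-c)]
    simp only [sub_eq_add_neg]
  · intro u hu hcu
    have hopen : IsOpen {y : E d | ∀ a, y a ∈ Set.Ioo (0 : ℝ) 1} := by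
      simp only [Set.ofPred_forall]
      exact isOpen_iInter_of_finite fun a => isOpen_Ioo.preimage (by fun_prop)
    have h1 : 0 < volume (u ∩ {y : E d | ∀ a, y a ∈ Set.Ioo (0 : ℝ) 1}) := by
      refine (hu.inter hopen).measure_pos _ ⟨c, hcu, fun a => ?_⟩
      rw [hca]; norm_num
    rw [Measure.restrict_apply' measurableSet_cell]
    refine h1.trans_le (measure_mono ?_)
    rintro y ⟨hy1, hy2⟩
    exact ⟨⟨hy1, fun a => ⟨(hy2 a).1.le, (hy2 a).2.le⟩⟩, fun a => ⟨(hy2 a).1.le, (hy2 a).2⟩⟩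
  · intro y hy hyc
    obtain ⟨a, ha⟩ : ∃ a, y a ≠ c a := by
      by_contra! hcon
      exact hyc (PiLp.ext hcon)
    simp only [sub_self, bump_zero]
    refine bump_lt_one (a := a) ?_ ?_
    · simpa [sub_eq_zero] using ha
    · have := hy a
      simp only [PiLp.sub_apply, hca, abs_le]
      constructor <;> linarith [this.1, this.2]
  · simp [bump_zero]
  · intro a; rw [hca]; norm_num
  · exact (integrable_cell (hf.comp (by fun_prop))).integrableOn
  · exact (hf.comp (by fun_prop : Continuous fun z => x + (z - c))).continuousWithinAt

/-- Approximation commutes with partial derivatives. -/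
lemma hasDerivAt_trigApprox (n : ℕ) (hp : Periodic f) (hf : ContDiff ℝ 1 f) (b : Fin d) (x : E d) :
    HasDerivAt (fun s : ℝ => trigApprox n f (x + s • e b))
      (trigApprox n (fun y => fderiv ℝ f y (e b)) x) 0 := by
  have hpd : Periodic fun y => fderiv ℝ f y (e b) := fun a y => by
    simp only [hp.fderiv a y]
  have hcd : Continuous fun y => fderiv ℝ f y (e b) :=
    (hf.continuous_fderiv (by norm_num)).clm_apply continuous_const
  have hcb : Continuous fun z : E d => bump z ^ n := continuous_bump.pow n
  simp only [trigApprox_eq n hp, trigApprox_eq n hpd]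
  refine HasDerivAt.const_mul _ ?_
  have := hasDerivAt_cell_integral (t₀ := 0)
    (f := fun s z => bump z ^ n * f (x + s • e b + z))
    (f' := fun s z => bump z ^ n * fderiv ℝ f (x + s • e b + z) (e b)) univ_mem
    (fun s => hcb.mul (hf.continuous.comp (by fun_prop)))
    ((hcb.comp continuous_snd).mul (hcd.comp
      (by fun_prop : Continuous fun w : ℝ × E d => x + w.1 • e b + w.2)))
    (fun s _ z => ?_)
  · simpa using this
  · refine HasDerivAt.const_mul _ ?_
    have h1 := hasDerivAt_line (hf.differentiable (by norm_num)) (e b) (x + s • e b + z)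
    have h2 : HasDerivAt (fun r : ℝ => r - s) 1 s := (hasDerivAt_id s).sub_const s
    have h3 := HasDerivAt.comp s (h₂ := fun r : ℝ => f (x + s • e b + z + r • e b))
      (by simpa using h1) h2
    rw [mul_one] at h3
    refine h3.congr_of_eventuallyEq (Eventually.of_forall fun r => ?_)
    simp only [Function.comp, sub_smul]
    congr 1
    abel

/-- The approximations of degree `n` are trigonometric polynomials with a common finite set of
frequencies. -/
lemma exists_trigApprox_eq_trigHeat (d n : ℕ) :
    ∃ (N : ℕ) (k : Fin N → Fin d → ℤ), ∀ f : E d → ℝ, Continuous f →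
      ∃ α β : Fin N → ℝ, trigApprox n f = trigHeat k α β 0 := by
  obtain ⟨N, a, g, hg⟩ := Submodule.mem_span_set'.1 (bump_pow_mem_trigSpan (d := d) n)
  choose kc hkc using fun j => (g j).2
  refine ⟨N, fun j => (kc j).1, fun f hf => ?_⟩
  have hb : ∀ w : E d, bump w ^ n = ∑ j, a j * Real.cos (phase (kc j).1 w + (kc j).2) := by
    intro w
    have := congrFun hg w
    rw [Finset.sum_apply] at this
    rw [← Pi.pow_apply, ← this]
    refine Finset.sum_congr rfl fun j _ => ?_
    rw [Pi.smul_apply, smul_eq_mul, ← hkc j]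
  have hc1 : ∀ j, Continuous fun z : E d => Real.cos (phase (kc j).1 z + (kc j).2) * f z :=
    fun j => (Real.continuous_cos.comp ((continuous_phase _).add continuous_const)).mul hf
  have hc2 : ∀ j, Continuous fun z : E d => Real.sin (phase (kc j).1 z + (kc j).2) * f z :=
    fun j => (Real.continuous_sin.comp ((continuous_phase _).add continuous_const)).mul hf
  refine ⟨fun j => (bumpMass d n)⁻¹ * (a j * ∫ z in cell d,
      Real.cos (phase (kc j).1 z + (kc j).2) * f z),
    fun j => (bumpMass d n)⁻¹ * (a j * ∫ z in cell d,
      Real.sin (phase (kc j).1 z + (kc j).2) * f z), ?_⟩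
  funext x
  have h1 : ∀ z, bump (z - x) ^ n * f z = ∑ j, (a j * Real.cos (phase (kc j).1 x) *
      (Real.cos (phase (kc j).1 z + (kc j).2) * f z) + a j * Real.sin (phase (kc j).1 x) *
      (Real.sin (phase (kc j).1 z + (kc j).2) * f z)) := by
    intro z
    rw [hb, Finset.sum_mul]
    refine Finset.sum_congr rfl fun j _ => ?_
    rw [phase_sub, show phase (kc j).1 z - phase (kc j).1 x + (kc j).2
      = phase (kc j).1 z + (kc j).2 - phase (kc j).1 x by ring, Real.cos_sub]
    ring
  unfold trigApprox trigHeat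
  simp only [h1, mul_zero, Real.exp_zero, one_mul]
  have i1 : ∀ (j : Fin N) (r : ℝ), Integrable (fun z =>
      r * (Real.cos (phase (kc j).1 z + (kc j).2) * f z)) (volume.restrict (cell d)) :=
    fun j r => integrable_cell ((hc1 j).const_mul r)
  have i2 : ∀ (j : Fin N) (r : ℝ), Integrable (fun z =>
      r * (Real.sin (phase (kc j).1 z + (kc j).2) * f z)) (volume.restrict (cell d)) :=
    fun j r => integrable_cell ((hc2 j).const_mul r)
  rw [integral_finsetSum _ fun j _ => (i1 j _).fun_add (i2 j _), Finset.mul_sum]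
  refine Finset.sum_congr rfl fun j _ => ?_
  rw [integral_add (i1 j _) (i2 j _), integral_const_mul, integral_const_mul]
  ring

end Approximation

/-! ### Matrix norms and gradients -/

section Matrix

variable {d : ℕ}

lemma ddot_eq_sum (A B : Matrix (Fin d) (Fin d) ℝ) :
    ddot A B = ∑ i : Fin d × Fin d, A i.1 i.2 * B i.2 i.1 := by
  simp [ddot, Matrix.trace, Matrix.mul_apply, Fintype.sum_prod_type]

lemma mnorm_eq (A : Matrix (Fin d) (Fin d) ℝ) :
    mnorm A = √(∑ i : Fin d × Fin d, A i.1 i.2 ^ 2) := by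
  simp [mnorm, ddot_eq_sum, pow_two]

lemma mnorm_nonneg (A : Matrix (Fin d) (Fin d) ℝ) : 0 ≤ mnorm A := Real.sqrt_nonneg _

lemma mnorm_rpow (A : Matrix (Fin d) (Fin d) ℝ) (p : ℝ) :
    mnorm A ^ p = (∑ i : Fin d × Fin d, A i.1 i.2 ^ 2) ^ (p / 2) := by
  rw [mnorm_eq, Real.sqrt_eq_rpow, ← Real.rpow_mul (Finset.sum_nonneg fun _ _ => sq_nonneg _)]
  congr 1; ring

lemma abs_apply_le_mnorm (A : Matrix (Fin d) (Fin d) ℝ) (a b : Fin d) : |A a b| ≤ mnorm A := by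
  rw [mnorm_eq]
  refine Real.abs_le_sqrt ?_
  exact Finset.single_le_sum (f := fun i : Fin d × Fin d => A i.1 i.2 ^ 2)
    (fun _ _ => sq_nonneg _) (Finset.mem_univ (a, b))

lemma symGrad_apply (v : E d → E d) (x : E d) (a b : Fin d) :
    (symGrad v x).1 a b = (grad v x a b + grad v x b a) / 2 := by
  simp [symGrad]; ring

lemma contDiff_component {v : E d → E d} (hv : ContDiff ℝ 1 v) (a : Fin d) :
    ContDiff ℝ 1 fun x => v x a :=
  (EuclideanSpace.proj (𝕜 := ℝ) a).contDiff.comp hv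

lemma Periodic.component {v : E d → E d} (hv : Periodic v) (a : Fin d) :
    Periodic fun x => v x a := fun b x => by simp only [hv b x]

lemma grad_apply {v : E d → E d} (hv : Differentiable ℝ v) (x : E d) (a b : Fin d) :
    grad v x a b = fderiv ℝ (fun y => v y a) x (e b) := by
  have h : HasFDerivAt (fun y => v y a)
      ((EuclideanSpace.proj (𝕜 := ℝ) a).comp (fderiv ℝ v x)) x :=
    (EuclideanSpace.proj (𝕜 := ℝ) a).hasFDerivAt.comp x (hv x).hasFDerivAt
  rw [h.fderiv]
  rfl

lemma continuous_grad_apply {v : E d → E d} (hv : ContDiff ℝ 1 v) (a b : Fin d) :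
    Continuous fun x => grad v x a b :=
  (EuclideanSpace.proj (𝕜 := ℝ) a).continuous.comp
    ((hv.continuous_fderiv (by norm_num)).clm_apply continuous_const)

lemma continuous_mnorm_grad {v : E d → E d} (hv : ContDiff ℝ 1 v) :
    Continuous fun x => mnorm (grad v x) := by
  simp only [mnorm_eq]
  exact (continuous_finsetSum _ fun i _ => (continuous_grad_apply hv i.1 i.2).pow 2).sqrt

lemma continuous_symGrad_apply {v : E d → E d} (hv : ContDiff ℝ 1 v) (a b : Fin d) :
    Continuous fun x => (symGrad v x).1 a b := by
  simp only [symGrad_apply]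
  exact ((continuous_grad_apply hv a b).add (continuous_grad_apply hv b a)).div_const _

lemma continuous_mnorm_symGrad {v : E d → E d} (hv : ContDiff ℝ 1 v) :
    Continuous fun x => mnorm (symGrad v x).1 := by
  simp only [mnorm_eq]
  exact (continuous_finsetSum _ fun i _ => (continuous_symGrad_apply hv i.1 i.2).pow 2).sqrt

lemma Periodic.grad {v : E d → E d} (hv : Periodic v) : Periodic (grad v) := by
  intro a x
  unfold TwoPhase.grad
  have h : _root_.fderiv ℝ v (x + e a) = _root_.fderiv ℝ v x := hv.fderiv a x
  rw [h]

lemma sum_smul_e (h : E d) : ∑ b, h b • (e b : E d) = h := by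
  ext a
  simp [e, Finset.sum_apply, Pi.single_apply]

lemma norm_fderiv_apply_le (v : E d → E d) (x h : E d) :
    ‖fderiv ℝ v x h‖ ≤ mnorm (grad v x) * ‖h‖ := by
  have h1 : ∀ a, (fderiv ℝ v x h) a = ∑ b, grad v x a b * h b := by
    intro a
    conv_lhs => rw [← sum_smul_e h]
    simp [map_sum, grad, mul_comm]
  rw [EuclideanSpace.norm_eq, EuclideanSpace.norm_eq, mnorm_eq,
    ← Real.sqrt_mul (Finset.sum_nonneg fun _ _ => sq_nonneg _)]
  refine Real.sqrt_le_sqrt ?_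
  simp only [Real.norm_eq_abs, sq_abs, h1]
  rw [Fintype.sum_prod_type, Finset.sum_mul]
  exact Finset.sum_le_sum fun a _ => Finset.sum_mul_sq_le_sq_mul_sq _ _ _

end Matrix

/-! ### Korn's inequality -/

section Korn

variable {d : ℕ}

/-- Korn's inequality for the gradient alone, by approximation with trigonometric polynomials. -/
theorem exists_korn_grad (d : ℕ) {p : ℝ} (hp : 2 < p) :
    ∃ C : ℝ, 0 ≤ C ∧ ∀ v : E d → E d, ContDiff ℝ 1 v → Periodic v →
      ∫ x in cell d, mnorm (grad v x) ^ p ≤ C * ∫ x in cell d, mnorm (symGrad v x).1 ^ p := by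
  obtain ⟨C, hC, hK⟩ := exists_korn_trig d (q := p / 2) (by linarith)
  refine ⟨C, hC, fun v hv hvp => ?_⟩
  have hq0 : 0 ≤ p / 2 := by linarith
  have hc := contDiff_component hv
  have hpc := hvp.component
  set D : Fin d → Fin d → E d → ℝ := fun a b x => fderiv ℝ (fun y => v y a) x (e b) with hD
  have hDc : ∀ a b, Continuous (D a b) := fun a b =>
    ((hc a).continuous_fderiv (by norm_num)).clm_apply continuous_const
  have hDp : ∀ a b, Periodic (D a b) := fun a b c x => by
    simp only [hD, (hpc a).fderiv c x]
  have hgrad : ∀ x a b, grad v x a b = D a b x := fun x a b =>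
    grad_apply (hv.differentiable (by norm_num)) x a b
  set G : ℕ → Fin d → Fin d → E d → ℝ := fun n a b => trigApprox n (D a b) with hG
  have hGform : ∀ n, ∃ (N : ℕ) (k : Fin N → Fin d → ℤ) (α β : Fin d → Fin N → ℝ),
      ∀ a b, G n a b = trigHeat k (fun j => 2 * Real.pi * k j b * β a j)
        (fun j => -(2 * Real.pi * k j b * α a j)) 0 := by
    intro n
    obtain ⟨N, k, hk⟩ := exists_trigApprox_eq_trigHeat d n
    choose α β hαβ using fun a => hk (fun x => v x a) (hc a).continuous
    refine ⟨N, k, α, β, fun a b => ?_⟩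
    funext x
    have h1 := hasDerivAt_trigApprox n (hpc a) (hc a) b x
    rw [hαβ a] at h1
    exact h1.unique (hasDerivAt_trigHeat b 0 x)
  have hineq : ∀ n, ∫ x in cell d, (∑ i : Fin d × Fin d, G n i.1 i.2 x ^ 2) ^ (p / 2) ≤
      C * ∫ x in cell d,
        (∑ i : Fin d × Fin d, ((G n i.1 i.2 x + G n i.2 i.1 x) / 2) ^ 2) ^ (p / 2) := by
    intro n
    obtain ⟨N, k, α, β, h⟩ := hGform n
    exact hK N k α β (G n) h
  have hGc : ∀ n a b, Continuous (G n a b) := by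
    intro n a b
    obtain ⟨N, k, α, β, h⟩ := hGform n
    rw [h]
    exact continuous_trigHeat.comp (by fun_prop : Continuous fun x : E d => ((0 : ℝ), x))
  choose K hK0 hKb using fun i : Fin d × Fin d => (hDp i.1 i.2).exists_bound (hDc i.1 i.2)
  have hGb : ∀ n (i : Fin d × Fin d) x, |G n i.1 i.2 x| ≤ K i := fun n i x =>
    abs_trigApprox_le n (hDp _ _) (hDc _ _) (hK0 i) (hKb i) x
  have hGl : ∀ a b x, Tendsto (fun n => G n a b x) atTop (𝓝 (D a b x)) := fun a b x =>
    tendsto_trigApprox (hDp a b) (hDc a b) x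
  -- both sides converge, by dominated convergence
  have lim : ∀ (X : ℕ → Fin d × Fin d → E d → ℝ) (Y : Fin d × Fin d → E d → ℝ)
      (M : Fin d × Fin d → ℝ), (∀ n i, Continuous (X n i)) → (∀ n i x, |X n i x| ≤ M i) →
      (∀ i x, Tendsto (fun n => X n i x) atTop (𝓝 (Y i x))) →
      Tendsto (fun n => ∫ x in cell d, (∑ i, X n i x ^ 2) ^ (p / 2)) atTop
        (𝓝 (∫ x in cell d, (∑ i, Y i x ^ 2) ^ (p / 2))) := by
    intro X Y M hX hXM hXY
    refine tendsto_integral_of_dominated_convergence (fun _ => (∑ i, M i ^ 2) ^ (p / 2))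
      (fun n => ?_) (integrable_const _) (fun n => Eventually.of_forall fun x => ?_)
      (Eventually.of_forall fun x => ?_)
    · exact ((continuous_finsetSum _ fun i _ => (hX n i).pow 2).rpow_const
        fun _ => Or.inr hq0).aestronglyMeasurable
    · have h0 : 0 ≤ ∑ i, X n i x ^ 2 := Finset.sum_nonneg fun _ _ => sq_nonneg _
      rw [Real.norm_eq_abs, abs_of_nonneg (Real.rpow_nonneg h0 _)]
      refine Real.rpow_le_rpow h0 (Finset.sum_le_sum fun i _ => ?_) hq0
      exact sq_le_sq' (abs_le.1 (hXM n i x)).1 (abs_le.1 (hXM n i x)).2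
    · exact (tendsto_finsetSum _ fun i _ => (hXY i x).pow 2).rpow_const (Or.inr hq0)
  have l1 := lim (fun n i => G n i.1 i.2) (fun i => D i.1 i.2) K (fun n i => hGc n _ _) hGb
    (fun i x => hGl _ _ x)
  have l2 := lim (fun n i x => (G n i.1 i.2 x + G n i.2 i.1 x) / 2)
    (fun i x => (D i.1 i.2 x + D i.2 i.1 x) / 2) (fun i => (K i + K i.swap) / 2)
    (fun n i => ((hGc n _ _).add (hGc n _ _)).div_const _)
    (fun n i x => by
      have h1 := abs_le.1 (hGb n i x)
      have h2 := abs_le.1 (hGb n i.swap x)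
      simp only [Prod.fst_swap, Prod.snd_swap] at h2
      rw [abs_le]; constructor <;> linarith [h1.1, h1.2, h2.1, h2.2])
    (fun i x => ((hGl _ _ x).add (hGl _ _ x)).div_const 2)
  have h := le_of_tendsto_of_tendsto' l1 (l2.const_mul C) hineq
  simpa only [mnorm_rpow, symGrad_apply, hgrad] using h

/-- Jensen's inequality for powers. -/
lemma rpow_integral_le {α : Type*} [MeasurableSpace α] {μ : Measure α} [IsProbabilityMeasure μ]
    {p : ℝ} (hp : 1 ≤ p) {g : α → ℝ} (h0 : ∀ x, 0 ≤ g x) (h1 : Integrable g μ)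
    (h2 : Integrable (fun x => g x ^ p) μ) : (∫ x, g x ∂μ) ^ p ≤ ∫ x, g x ^ p ∂μ :=
  (convexOn_rpow hp).map_integral_le
    (continuousOn_id.rpow_const fun _ _ => Or.inr (by linarith)) isClosed_Ici
    (Eventually.of_forall h0) h1 h2

lemma integrable_prod_cell {F : E d × E d → ℝ} (hF : Continuous F) :
    Integrable F ((volume.restrict (cell d)).prod (volume.restrict (cell d))) := by
  rw [Measure.prod_restrict]
  exact (hF.continuousOn.integrableOn_compact
    (isCompact_closedCell.prod isCompact_closedCell)).mono_set
    (Set.prod_mono cell_subset_closedCell cell_subset_closedCell)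

lemma integrable_prod_Icc_cell {F : ℝ × E d → ℝ} (hF : Continuous F) (a b : ℝ) :
    Integrable F ((volume.restrict (Set.Icc a b)).prod (volume.restrict (cell d))) := by
  rw [Measure.prod_restrict]
  exact (hF.continuousOn.integrableOn_compact
    (isCompact_Icc.prod isCompact_closedCell)).mono_set
    (Set.prod_mono subset_rfl cell_subset_closedCell)

instance : IsProbabilityMeasure ((volume : Measure ℝ).restrict (Set.Icc 0 1)) :=
  ⟨by simp⟩

/-- A `C¹` field is Lipschitz in the `L^p` mean, by integration along segments. -/
lemma integral_cell_translate_sub_le {p : ℝ} (hp : 1 ≤ p) {v : E d → E d} (hv : ContDiff ℝ 1 v)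
    (hvp : Periodic v) (h : E d) :
    ∫ x in cell d, ‖v (x + h) - v x‖ ^ p ≤ ‖h‖ ^ p * ∫ x in cell d, mnorm (grad v x) ^ p := by
  have hp0 : 0 ≤ p := by linarith
  have hcM := continuous_mnorm_grad hv
  have hcMp : Continuous fun x => mnorm (grad v x) ^ p := hcM.rpow_const fun _ => Or.inr hp0
  have hc2 : ∀ x, Continuous fun s : ℝ => mnorm (grad v (x + s • h)) := fun x =>
    hcM.comp (by fun_prop)
  have hc3 : Continuous fun z : ℝ × E d => mnorm (grad v (z.2 + z.1 • h)) ^ p :=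
    hcMp.comp (by fun_prop : Continuous fun z : ℝ × E d => z.2 + z.1 • h)
  have hii : ∀ g : ℝ → ℝ, Continuous g → Integrable g (volume.restrict (Set.Icc 0 1)) :=
    fun g hg => hg.continuousOn.integrableOn_compact isCompact_Icc
  have key : ∀ x, ‖v (x + h) - v x‖ ^ p ≤
      ‖h‖ ^ p * ∫ s in Set.Icc (0 : ℝ) 1, mnorm (grad v (x + s • h)) ^ p := by
    intro x
    have hd : ∀ s : ℝ, HasDerivAt (fun s : ℝ => v (x + s • h)) (fderiv ℝ v (x + s • h) h) s := by
      intro s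
      have h1 : HasDerivAt (fun s : ℝ => x + s • h) h s := by
        simpa using ((hasDerivAt_id s).smul_const h).const_add x
      exact (hv.differentiable (by norm_num) _).hasFDerivAt.comp_hasDerivAt s h1
    have hcd : Continuous fun s : ℝ => fderiv ℝ v (x + s • h) h :=
      ((hv.continuous_fderiv (by norm_num)).comp (by fun_prop)).clm_apply continuous_const
    have h1 : ∫ s in (0 : ℝ)..1, fderiv ℝ v (x + s • h) h = v (x + h) - v x := by
      rw [intervalIntegral.integral_eq_sub_of_hasDerivAt (fun s _ => hd s)
        (hcd.intervalIntegrable _ _)]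
      simp
    have h2 : ‖v (x + h) - v x‖ ≤ ‖h‖ * ∫ s in Set.Icc (0 : ℝ) 1, mnorm (grad v (x + s • h)) := by
      rw [← h1, intervalIntegral.integral_of_le zero_le_one, ← integral_Icc_eq_integral_Ioc,
        ← integral_const_mul]
      refine norm_integral_le_of_norm_le (hii _ ((hc2 x).const_mul _))
        (Eventually.of_forall fun s => ?_)
      rw [mul_comm]
      exact norm_fderiv_apply_le _ _ _
    have h3 : 0 ≤ ∫ s in Set.Icc (0 : ℝ) 1, mnorm (grad v (x + s • h)) :=
      integral_nonneg fun s => mnorm_nonneg _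
    calc ‖v (x + h) - v x‖ ^ p
        ≤ (‖h‖ * ∫ s in Set.Icc (0 : ℝ) 1, mnorm (grad v (x + s • h))) ^ p :=
          Real.rpow_le_rpow (norm_nonneg _) h2 hp0
      _ = ‖h‖ ^ p * (∫ s in Set.Icc (0 : ℝ) 1, mnorm (grad v (x + s • h))) ^ p :=
          Real.mul_rpow (norm_nonneg _) h3
      _ ≤ _ := by
          refine mul_le_mul_of_nonneg_left ?_ (Real.rpow_nonneg (norm_nonneg _) _)
          exact rpow_integral_le hp (fun s => mnorm_nonneg _) (hii _ (hc2 x))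
            (hii _ ((hc2 x).rpow_const fun _ => Or.inr hp0))
  have hint : Integrable (fun x => ∫ s in Set.Icc (0 : ℝ) 1, mnorm (grad v (x + s • h)) ^ p)
      (volume.restrict (cell d)) := (integrable_prod_Icc_cell hc3 0 1).integral_prod_right
  have hcv : Continuous fun x => ‖v (x + h) - v x‖ ^ p :=
    ((hv.continuous.comp (by fun_prop)).sub hv.continuous).norm.rpow_const fun _ => Or.inr hp0
  calc ∫ x in cell d, ‖v (x + h) - v x‖ ^ p
      ≤ ∫ x in cell d, ‖h‖ ^ p * ∫ s in Set.Icc (0 : ℝ) 1, mnorm (grad v (x + s • h)) ^ p :=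
        integral_mono (integrable_cell hcv) (hint.const_mul _) key
    _ = ‖h‖ ^ p * ∫ x in cell d, ∫ s in Set.Icc (0 : ℝ) 1, mnorm (grad v (x + s • h)) ^ p :=
        integral_const_mul _ _
    _ = ‖h‖ ^ p * ∫ s in Set.Icc (0 : ℝ) 1, ∫ x in cell d, mnorm (grad v (x + s • h)) ^ p := by
        rw [integral_integral_swap]
        exact (integrable_prod_Icc_cell hc3 0 1).swap
    _ = ‖h‖ ^ p * ∫ s in Set.Icc (0 : ℝ) 1, ∫ x in cell d, mnorm (grad v x) ^ p := by
        congr 2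
        funext s
        exact setIntegral_cell_add (f := fun x => mnorm (grad v x) ^ p)
          (fun a x => by simp only [hvp.grad a x]) (s • h)
    _ = _ := by simp

/-- Poincaré's inequality in `L^p`: the deviation of `v` from its mean is an average of the
translation differences `v (x + h) - v x`. -/
theorem exists_poincare (d : ℕ) {p : ℝ} (hp : 1 ≤ p) :
    ∃ C : ℝ, 0 ≤ C ∧ ∀ v : E d → E d, ContDiff ℝ 1 v → Periodic v →
      ∫ x in cell d, ‖v x‖ ^ p ≤
        C * ((∫ x in cell d, mnorm (grad v x) ^ p) + (∫ x in cell d, ‖v x‖) ^ p) := by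
  have hp0 : 0 ≤ p := by linarith
  obtain ⟨K, hK⟩ := (isCompact_closedCell (d := d)).exists_bound_of_continuousOn continuousOn_id
  have hK' : ∀ h ∈ cell d, ‖h‖ ≤ max K 0 := fun h hh =>
    (hK h (cell_subset_closedCell hh)).trans (le_max_left _ _)
  set R := max K 0 with hR
  have hR0 : 0 ≤ R := le_max_right _ _
  refine ⟨2 ^ (p - 1) * (R ^ p + 1), by positivity, fun v hv hvp => ?_⟩
  set I := ∫ x in cell d, mnorm (grad v x) ^ p with hI
  have hI0 : 0 ≤ I := integral_nonneg fun x => Real.rpow_nonneg (mnorm_nonneg _) _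
  have hL0 : 0 ≤ ∫ x in cell d, ‖v x‖ := integral_nonneg fun x => norm_nonneg _
  set V : E d := ∫ h in cell d, v h with hV
  have hVn : ‖V‖ ≤ ∫ x in cell d, ‖v x‖ := norm_integral_le_integral_norm _
  have hcF : Continuous fun z : E d × E d => ‖v (z.1 + z.2) - v z.1‖ :=
    ((hv.continuous.comp (by fun_prop)).sub (hv.continuous.comp continuous_fst)).norm
  have hcFp : Continuous fun z : E d × E d => ‖v (z.1 + z.2) - v z.1‖ ^ p :=
    hcF.rpow_const fun _ => Or.inr hp0
  have h1 : ∀ x, ‖v x - V‖ ^ p ≤ ∫ h in cell d, ‖v (x + h) - v x‖ ^ p := by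
    intro x
    have e1 : V - v x = ∫ h in cell d, (v (x + h) - v x) := by
      have e2 : ∫ h in cell d, v (x + h) = V := by
        simp only [add_comm x]; exact setIntegral_cell_add hvp x
      have e3 : Integrable (fun h => v (x + h)) (volume.restrict (cell d)) :=
        integrable_cell (hv.continuous.comp (by fun_prop))
      rw [integral_sub e3 (integrable_const _), e2]
      simp
    have hcx : Continuous fun h => ‖v (x + h) - v x‖ :=
      ((hv.continuous.comp (by fun_prop)).sub continuous_const).norm
    rw [norm_sub_rev, e1]
    refine (Real.rpow_le_rpow (norm_nonneg _) (norm_integral_le_integral_norm _) hp0).trans ?_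
    exact rpow_integral_le hp (fun _ => norm_nonneg _) (integrable_cell hcx)
      (integrable_cell (hcx.rpow_const fun _ => Or.inr hp0))
  have hcvV : Continuous fun x => ‖v x - V‖ ^ p :=
    (hv.continuous.sub continuous_const).norm.rpow_const fun _ => Or.inr hp0
  have hcv : Continuous fun x => ‖v x‖ ^ p := hv.continuous.norm.rpow_const fun _ => Or.inr hp0
  have h2 : ∫ x in cell d, ‖v x - V‖ ^ p ≤ R ^ p * I := by
    calc ∫ x in cell d, ‖v x - V‖ ^ p
        ≤ ∫ x in cell d, ∫ h in cell d, ‖v (x + h) - v x‖ ^ p :=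
          integral_mono (integrable_cell hcvV) (integrable_prod_cell hcFp).integral_prod_left h1
      _ = ∫ h in cell d, ∫ x in cell d, ‖v (x + h) - v x‖ ^ p :=
          integral_integral_swap (integrable_prod_cell hcFp)
      _ ≤ ∫ h in cell d, R ^ p * I := by
          refine integral_mono_ae (integrable_prod_cell hcFp).integral_prod_right
            (integrable_const _) ?_
          filter_upwards [ae_restrict_mem measurableSet_cell] with h hh
          refine (integral_cell_translate_sub_le hp hv hvp h).trans ?_
          exact mul_le_mul_of_nonneg_right
            (Real.rpow_le_rpow (norm_nonneg _) (hK' h hh) hp0) hI0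
      _ = R ^ p * I := by simp
  have h3 : ∀ x, ‖v x‖ ^ p ≤ 2 ^ (p - 1) * ‖v x - V‖ ^ p + 2 ^ (p - 1) * ‖V‖ ^ p := by
    intro x
    have e1 : ‖v x‖ ≤ ‖v x - V‖ + ‖V‖ := by
      calc ‖v x‖ = ‖(v x - V) + V‖ := by rw [sub_add_cancel]
        _ ≤ _ := norm_add_le _ _
    refine (Real.rpow_le_rpow (norm_nonneg _) e1 hp0).trans ?_
    rw [← mul_add]
    exact_mod_cast NNReal.rpow_add_le_mul_rpow_add_rpow ‖v x - V‖₊ ‖V‖₊ hp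
  calc ∫ x in cell d, ‖v x‖ ^ p
      ≤ ∫ x in cell d, (2 ^ (p - 1) * ‖v x - V‖ ^ p + 2 ^ (p - 1) * ‖V‖ ^ p) :=
        integral_mono (integrable_cell hcv)
          (integrable_cell ((hcvV.const_mul _).add continuous_const)) h3
    _ = 2 ^ (p - 1) * (∫ x in cell d, ‖v x - V‖ ^ p) + 2 ^ (p - 1) * ‖V‖ ^ p := by
        rw [integral_add (integrable_cell (hcvV.const_mul _)) (integrable_const _),
          integral_const_mul]
        simp
    _ ≤ 2 ^ (p - 1) * (R ^ p * I) + 2 ^ (p - 1) * (∫ x in cell d, ‖v x‖) ^ p := by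
        gcongr
    _ ≤ _ := by
        have a1 : 0 ≤ (∫ x in cell d, ‖v x‖) ^ p := Real.rpow_nonneg hL0 _
        have a2 : (0 : ℝ) ≤ R ^ p := by positivity
        rw [mul_assoc, ← mul_add]
        refine mul_le_mul_of_nonneg_left ?_ (by positivity)
        nlinarith [mul_nonneg a2 a1]

/-- Korn's inequality on the torus, for exponents `p > 2`. -/
theorem exists_isKornConstant (d : ℕ) {p : ℝ} (hp : 2 < p) :
    ∃ c : ℝ, 0 ≤ c ∧ IsKornConstant d p c := by
  obtain ⟨C₁, hC₁, h₁⟩ := exists_korn_grad d hp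
  obtain ⟨C₂, hC₂, h₂⟩ := exists_poincare d (p := p) (by linarith)
  refine ⟨(C₂ + 1) * C₁ + C₂, by positivity, fun v hv hvp => ?_⟩
  have hp0 : 0 ≤ p := by linarith
  have a1 := h₁ v hv hvp
  have a2 := h₂ v hv hvp
  have a3 : 0 ≤ ∫ x in cell d, mnorm (symGrad v x).1 ^ p :=
    integral_nonneg fun x => Real.rpow_nonneg (mnorm_nonneg _) _
  have a4 : 0 ≤ (∫ x in cell d, ‖v x‖) ^ p :=
    Real.rpow_nonneg (integral_nonneg fun x => norm_nonneg _) _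
  have e1 : w1pNormPow p v
      = (∫ x in cell d, ‖v x‖ ^ p) + ∫ x in cell d, mnorm (grad v x) ^ p :=
    integral_add (integrable_cell (hv.continuous.norm.rpow_const fun _ => Or.inr hp0))
      (integrable_cell ((continuous_mnorm_grad hv).rpow_const fun _ => Or.inr hp0))
  rw [e1]
  nlinarith [mul_le_mul_of_nonneg_left a1 (by positivity : 0 ≤ C₂ + 1), mul_nonneg hC₂ a3,
    mul_nonneg (mul_nonneg (by positivity : 0 ≤ C₂ + 1) hC₁) a4]

end Korn

/-! ### Solenoidal fields -/

section Solenoidal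

variable {d : ℕ}

/-- A periodic `C¹` divergence-free vector field. -/
structure IsSolenoidal (v : E d → E d) : Prop where
  contDiff : ContDiff ℝ 1 v
  periodic : Periodic v
  trace_grad : ∀ x, (grad v x).trace = 0

/-- The partial derivative `∂_a f`. -/
noncomputable def pderiv (a : Fin d) (f : E d → ℝ) (x : E d) : ℝ := fderiv ℝ f x (e a)

lemma Periodic.pderiv {f : E d → ℝ} (hf : Periodic f) (a : Fin d) : Periodic (pderiv a f) := by
  intro b x
  have h : _root_.fderiv ℝ f (x + e b) = _root_.fderiv ℝ f x := hf.fderiv b x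
  simp only [TwoPhase.pderiv, h]

lemma continuous_pderiv {f : E d → ℝ} (hf : ContDiff ℝ 1 f) (a : Fin d) : Continuous (pderiv a f) :=
  (hf.continuous_fderiv (by norm_num)).clm_apply continuous_const

lemma trace_grad_eq {v : E d → E d} (hv : ContDiff ℝ 1 v) (x : E d) :
    (grad v x).trace = ∑ a, pderiv a (fun y => v y a) x := by
  simp [Matrix.trace, pderiv, grad_apply (hv.differentiable (by norm_num))]

lemma integral_mul_pderiv {f g : E d → ℝ} (hpf : Periodic f) (hpg : Periodic g)
    (hf : ContDiff ℝ 1 f) (hg : ContDiff ℝ 1 g) (a : Fin d) :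
    ∫ x in cell d, f x * pderiv a g x = -∫ x in cell d, pderiv a f x * g x :=
  integral_cell_mul_fderiv hpf hpg hf hg (e a)

/-- `∫ v · ∇f = -∫ (div v) f`. -/
lemma integral_sum_mul_pderiv {v : E d → E d} (hv : ContDiff ℝ 1 v) (hvp : Periodic v)
    {f : E d → ℝ} (hf : ContDiff ℝ 1 f) (hfp : Periodic f) :
    ∫ x in cell d, ∑ b, v x b * pderiv b f x = -∫ x in cell d, (grad v x).trace * f x := by
  have hc := contDiff_component hv
  simp only [trace_grad_eq hv, Finset.sum_mul]
  rw [integral_finsetSum _ fun b _ => integrable_cell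
      ((hc b).continuous.fun_mul (continuous_pderiv hf b)),
    integral_finsetSum _ fun b _ => integrable_cell
      ((continuous_pderiv (hc b) b).fun_mul hf.continuous), ← Finset.sum_neg_distrib]
  exact Finset.sum_congr rfl fun b _ => integral_mul_pderiv (hvp.component b) hfp (hc b) hf b

lemma IsSolenoidal.integral_sum_mul_pderiv_eq_zero {v : E d → E d} (hv : IsSolenoidal v)
    {f : E d → ℝ} (hf : ContDiff ℝ 1 f) (hfp : Periodic f) :
    ∫ x in cell d, ∑ b, v x b * pderiv b f x = 0 := by
  rw [integral_sum_mul_pderiv hv.contDiff hv.periodic hf hfp]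
  simp [hv.trace_grad]

lemma periodic_of_components {v : E d → E d} (h : ∀ b, Periodic fun x => v x b) : Periodic v :=
  fun a x => PiLp.ext fun b => h b a x

/-- `L²` convergence on the cell implies convergence of the integrals against bounded functions. -/
lemma tendsto_integral_mul_of_eLpNorm {h : ℕ → E d → ℝ} {g χ : E d → ℝ}
    (hh : ∀ n, InLp 2 (h n)) (hg : InLp 2 g) (hχ : Continuous χ) (hχp : Periodic χ)
    (hl : Tendsto (fun n => eLpNorm (h n - g) 2 (volume.restrict (cell d))) atTop (𝓝 0)) :
    Tendsto (fun n => ∫ x in cell d, h n x * χ x) atTop (𝓝 (∫ x in cell d, g x * χ x)) := by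
  obtain ⟨C, hC0, hC⟩ := hχp.exists_bound hχ
  have hi : ∀ k : E d → ℝ, InLp 2 k →
      Integrable (fun x => k x * χ x) (volume.restrict (cell d)) := fun k hk =>
    (hk.2.integrable (by norm_num)).mul_bdd hχ.aestronglyMeasurable (Eventually.of_forall hC)
  refine tendsto_integral_of_L1' _ (hi g hg).aestronglyMeasurable
    (Eventually.of_forall fun n => hi _ (hh n)) ?_
  have h1 : ∀ n, eLpNorm ((fun x => h n x * χ x) - fun x => g x * χ x) 1
      (volume.restrict (cell d)) ≤ ENNReal.ofReal C *
        eLpNorm (h n - g) 2 (volume.restrict (cell d)) := by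
    intro n
    refine (eLpNorm_le_mul_eLpNorm_of_ae_le_mul (g := h n - g) (c := C)
      (Eventually.of_forall fun x => ?_) 1).trans ?_
    · simp only [Pi.sub_apply, ← sub_mul, norm_mul]
      rw [mul_comm]
      exact mul_le_mul_of_nonneg_right (hC x) (norm_nonneg _)
    · gcongr
      exact eLpNorm_le_eLpNorm_of_exponent_le (by norm_num)
        ((hh n).2.aestronglyMeasurable.sub hg.2.aestronglyMeasurable)
  have h2 : Tendsto (fun n => ENNReal.ofReal C *
      eLpNorm (h n - g) 2 (volume.restrict (cell d))) atTop (𝓝 0) := by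
    have := ENNReal.Tendsto.const_mul (a := ENNReal.ofReal C) hl (Or.inr ENNReal.ofReal_ne_top)
    simpa using this
  exact tendsto_of_tendsto_of_tendsto_of_le_of_le tendsto_const_nhds h2 (fun _ => zero_le) h1

/-- A continuous periodic function that is orthogonal to all smooth functions vanishes. -/
lemma eq_zero_of_forall_integral_mul {f : E d → ℝ} (hf : Continuous f) (hp : Periodic f)
    (h : ∀ ψ : E d → ℝ, ContDiff ℝ (⊤ : ℕ∞) ψ → Periodic ψ → ∫ x in cell d, f x * ψ x = 0)
    (x : E d) : f x = 0 := by
  have h1 : ∀ n, trigApprox n f x = 0 := by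
    intro n
    have h2 := h (fun z => bump (z - x) ^ n)
      ((contDiff_bump.comp (contDiff_id.sub contDiff_const)).pow n) fun a z => by
        have : z + e a - x = z - x + e a := by abel
        simp only [this, periodic_bump a]
    simp only [trigApprox, mul_comm _ (f _), h2, mul_zero]
  have h2 := tendsto_trigApprox hp hf x
  simp only [h1] at h2
  exact (tendsto_nhds_unique h2 tendsto_const_nhds)

/-- The classical `C¹` representatives of `V^{s,2}` are divergence-free. -/
lemma InV.isSolenoidal {s : ℕ} {v : E d → E d} (h : InV s 2 v) (hv : ContDiff ℝ 1 v) :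
    IsSolenoidal v := by
  obtain ⟨w, hw, -, hvW, hconv⟩ := h
  have hvp : Periodic v := periodic_of_components fun b => (hvW b).1.1
  have hgc : Continuous fun x => (grad v x).trace := by
    simp only [Matrix.trace, Matrix.diag]
    exact continuous_finsetSum _ fun a _ => continuous_grad_apply hv a a
  refine ⟨hv, hvp, eq_zero_of_forall_integral_mul hgc
    (fun a x => by simp only [hvp.grad a x]) fun ψ hψ hψp => ?_⟩
  have hψ1 : ContDiff ℝ 1 ψ := hψ.of_le (by exact_mod_cast le_top)
  have hps : ∀ b, ContDiff ℝ (⊤ : ℕ∞) (pderiv b ψ) := fun b =>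
    (hψ.fderiv_right (m := (⊤ : ℕ∞)) (by exact_mod_cast le_top)).clm_apply contDiff_const
  have hl : ∀ b, Tendsto (fun n => ∫ x in cell d, w n x b * pderiv b ψ x) atTop
      (𝓝 (∫ x in cell d, v x b * pderiv b ψ x)) := by
    intro b
    obtain ⟨h, g, h1, h2, h3, h4⟩ := hconv b [] (by simp)
    have e1 : ∀ n, ∫ x in cell d, w n x b * pderiv b ψ x
        = ∫ x in cell d, h n x * pderiv b ψ x := by
      intro n
      have := (h1 n).2 (pderiv b ψ) (hps b) (hψp.pderiv b)
      simpa [partialD] using this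
    have e2 : ∫ x in cell d, v x b * pderiv b ψ x = ∫ x in cell d, g x * pderiv b ψ x := by
      have := h3 (pderiv b ψ) (hps b) (hψp.pderiv b)
      simpa [partialD] using this
    simp only [e1, e2]
    exact tendsto_integral_mul_of_eLpNorm (fun n => (h1 n).1) h2 (hps b).continuous
      (hψp.pderiv b) h4
  have hsum := tendsto_finsetSum Finset.univ fun b (_ : b ∈ Finset.univ) => hl b
  have hzero : ∀ n, ∑ b, ∫ x in cell d, w n x b * pderiv b ψ x = 0 := by
    intro n
    have hw1 : ContDiff ℝ 1 (w n) := (hw n).1.of_le (by exact_mod_cast le_top)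
    have hws : IsSolenoidal (w n) := ⟨hw1, (hw n).2.1, (hw n).2.2⟩
    rw [← integral_finsetSum _ fun b _ => integrable_cell
      ((contDiff_component hw1 b).continuous.fun_mul (continuous_pderiv hψ1 b))]
    exact hws.integral_sum_mul_pderiv_eq_zero hψ1 hψp
  simp only [hzero] at hsum
  have h0 := tendsto_nhds_unique hsum tendsto_const_nhds
  rw [← integral_finsetSum _ fun b _ => integrable_cell
      ((contDiff_component hv b).continuous.fun_mul (continuous_pderiv hψ1 b)),
    integral_sum_mul_pderiv hv hvp hψ1 hψp] at h0
  linarith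

/-! ### The Galerkin spaces -/

lemma IsSolenoidal.sum_smul {ω : ℕ → E d → E d} (hω : ∀ j, IsSolenoidal (ω j)) (s : Finset ℕ)
    (c : ℕ → ℝ) : IsSolenoidal (∑ j ∈ s, c j • ω j) := by
  have hcd : ContDiff ℝ 1 (∑ j ∈ s, c j • ω j) := by
    have : (∑ j ∈ s, c j • ω j) = fun x => ∑ j ∈ s, c j • ω j x := by
      funext x; simp [Finset.sum_apply]
    rw [this]
    exact ContDiff.sum fun j _ => (hω j).contDiff.const_smul (c j)
  refine ⟨hcd, fun a x => ?_, fun x => ?_⟩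
  · simp only [Finset.sum_apply, Pi.smul_apply, (hω _).periodic a x]
  · have h1 : fderiv ℝ (∑ j ∈ s, c j • ω j) x = ∑ j ∈ s, c j • fderiv ℝ (ω j) x := by
      rw [fderiv_sum fun j _ => ((hω j).contDiff.differentiable (by norm_num) x).const_smul (c j)]
      exact Finset.sum_congr rfl fun j _ =>
        fderiv_const_smul ((hω j).contDiff.differentiable (by norm_num) x) (c j)
    have h2 : grad (∑ j ∈ s, c j • ω j) x = ∑ j ∈ s, c j • grad (ω j) x := by
      ext a b
      simp [grad, h1, Finset.sum_apply, Matrix.sum_apply]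
    rw [h2, Matrix.trace_sum]
    simp [Matrix.trace_smul, (hω _).trace_grad]

lemma l2_sum_smul_left {ω : ℕ → E d → E d} (hω : ∀ j, IsSolenoidal (ω j)) (s : Finset ℕ)
    (c : ℕ → ℝ) {w : E d → E d} (hw : Continuous w) :
    l2 (∑ j ∈ s, c j • ω j) w = ∑ j ∈ s, c j * l2 (ω j) w := by
  unfold l2
  have h1 : ∀ x, inner ℝ ((∑ j ∈ s, c j • ω j) x) (w x) = ∑ j ∈ s, c j * inner ℝ (ω j x) (w x) := by
    intro x
    simp [Finset.sum_apply, sum_inner, real_inner_smul_left]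
  have h2 : ∀ j ∈ s, Integrable (fun x => c j * inner ℝ (ω j x) (w x))
      (volume.restrict (cell d)) := fun j _ =>
    integrable_cell (((hω j).contDiff.continuous.inner hw).const_mul _)
  simp only [h1]
  rw [integral_finsetSum _ h2]
  simp only [integral_const_mul]

lemma l2_comm (v w : E d → E d) : l2 v w = l2 w v := by
  unfold l2
  simp only [real_inner_comm]

variable {s : ℕ} {ω : ℕ → E d → E d}

lemma IsGalerkinBasis.isSolenoidal (h : IsGalerkinBasis s ω) (j : ℕ) : IsSolenoidal (ω j) :=
  (h.mem j).isSolenoidal (h.contDiff j)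

/-- The projection onto `V_i` is the identity on `V_i`. -/
lemma IsGalerkinBasis.eq_galerkinProj (h : IsGalerkinBasis s ω) {i : ℕ} {v : E d → E d}
    (hv : v ∈ galerkinSpace ω i) : v = galerkinProj ω i v := by
  have hset : ω '' {j | j < i} = ω '' ↑(Finset.range i) := by
    congr 1; ext; simp
  rw [galerkinSpace, hset] at hv
  obtain ⟨c, hc⟩ := (Submodule.mem_span_image_finset_iff_exists_fun' ℝ).1 hv
  have hck : ∀ k ∈ Finset.range i, c k • ω k = l2 v (ω k) • ω k := by
    intro k hk
    congr 1
    rw [← hc, l2_sum_smul_left h.isSolenoidal _ _ (h.contDiff k).continuous]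
    simp only [h.orthonormal, mul_ite, mul_one, mul_zero]
    rw [Finset.sum_ite_eq' (Finset.range i) k, if_pos hk]
  calc v = ∑ k ∈ Finset.range i, c k • ω k := hc.symm
    _ = _ := Finset.sum_congr rfl hck

lemma galerkinProj_mem (ω : ℕ → E d → E d) (i : ℕ) (v : E d → E d) :
    galerkinProj ω i v ∈ galerkinSpace ω i := by
  unfold galerkinProj
  exact Submodule.sum_mem (galerkinSpace ω i) fun j hj =>
    Submodule.smul_mem (galerkinSpace ω i) _
      (Submodule.subset_span ⟨j, Finset.mem_range.1 hj, rfl⟩)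

lemma mem_galerkinSpace (ω : ℕ → E d → E d) {i j : ℕ} (hj : j < i) : ω j ∈ galerkinSpace ω i :=
  Submodule.subset_span ⟨j, hj, rfl⟩

lemma IsGalerkinBasis.isSolenoidal_of_mem (h : IsGalerkinBasis s ω) {i : ℕ} {v : E d → E d}
    (hv : v ∈ galerkinSpace ω i) : IsSolenoidal v := by
  rw [h.eq_galerkinProj hv]
  exact IsSolenoidal.sum_smul h.isSolenoidal _ _

/-- Parseval's identity in `V_i`. -/
lemma IsGalerkinBasis.l2_eq_sum (h : IsGalerkinBasis s ω) {i : ℕ} {v w : E d → E d}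
    (hv : v ∈ galerkinSpace ω i) (hw : w ∈ galerkinSpace ω i) :
    l2 v w = ∑ j ∈ Finset.range i, l2 v (ω j) * l2 w (ω j) := by
  conv_lhs => rw [h.eq_galerkinProj hv]
  unfold galerkinProj
  rw [l2_sum_smul_left h.isSolenoidal _ _ (h.isSolenoidal_of_mem hw).contDiff.continuous]
  exact Finset.sum_congr rfl fun j _ => by rw [l2_comm (ω j) w]

end Solenoidal

/-! ### Mollification -/

section Mollify

variable {d : ℕ} {F : Type*} [NormedAddCommGroup F] [NormedSpace ℝ F]

/-- The properties of the mollifying kernel that are used: it is continuous, even, and has compact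
support. -/
structure IsEvenKernel (ζ : E d → ℝ) : Prop where
  continuous : Continuous ζ
  hasCompactSupport : HasCompactSupport ζ
  even : ∀ x, ζ (-x) = ζ x

lemma IsKernel.isEvenKernel_scaledKernel {ζ : E d → ℝ} (hζ : IsKernel ζ) (γ : ℝ) {ε : ℝ}
    (hε : 0 < ε) : IsEvenKernel (scaledKernel ζ γ ε) := by
  have hr : (ε ^ (γ / d))⁻¹ ≠ 0 := inv_ne_zero (Real.rpow_pos_of_pos hε _).ne'
  have hcs : HasCompactSupport ζ :=
    HasCompactSupport.of_support_subset_isCompact (isCompact_closedBall (0 : E d) 1)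
      ((subset_tsupport ζ).trans (hζ.supp.trans Metric.ball_subset_closedBall))
  refine ⟨?_, ?_, fun x => ?_⟩
  · exact continuous_const.mul (hζ.smooth.continuous.comp (by fun_prop))
  · exact (hcs.comp_smul hr).mul_left
  · unfold scaledKernel
    congr 1
    exact hζ.radial _ _ (by rw [smul_neg, norm_neg])

lemma mollify_apply (ζ : E d → ℝ) (f : E d → F) (x : E d) :
    mollify ζ f x = ∫ t, ζ t • f (x - t) := by
  simp [mollify, convolution_def]

variable {ζ : E d → ℝ}

lemma IsEvenKernel.integrable (hζ : IsEvenKernel ζ) {f : E d → F} (hf : Continuous f) (x : E d) :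
    Integrable fun t => ζ t • f (x - t) :=
  (hζ.continuous.smul (hf.comp (by fun_prop))).integrable_of_hasCompactSupport
    hζ.hasCompactSupport.smul_right

lemma IsEvenKernel.continuous_mollify (hζ : IsEvenKernel ζ) {f : E d → F}
    (hf : Continuous f) : Continuous (mollify ζ f) :=
  hζ.hasCompactSupport.continuous_convolution_left _ hζ.continuous hf.locallyIntegrable

lemma periodic_mollify {f : E d → F} (hf : Periodic f) : Periodic (mollify ζ f) := by
  intro a x
  simp only [mollify_apply]
  refine integral_congr_ae (Eventually.of_forall fun t => ?_)
  have : x + e a - t = x - t + e a := by abel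
  simp only [this, hf a]

lemma IsEvenKernel.hasFDerivAt_mollify (hζ : IsEvenKernel ζ) {f : E d → F} (hf : ContDiff ℝ 1 f)
    (hp : Periodic f) (x : E d) :
    HasFDerivAt (mollify ζ f) (mollify ζ (fderiv ℝ f) x) x := by
  have hcd := hf.continuous_fderiv (by norm_num)
  have hpd : Periodic (fderiv ℝ f) := hp.fderiv
  obtain ⟨C, hC0, hC⟩ := hpd.exists_bound hcd
  have e1 : mollify ζ f = fun x => ∫ t, ζ t • f (x - t) := funext fun x => mollify_apply ζ f x
  rw [e1, mollify_apply]
  refine hasFDerivAt_integral_of_dominated_of_fderiv_le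
    (F := fun y t => ζ t • f (y - t)) (F' := fun y t => ζ t • fderiv ℝ f (y - t))
    (bound := fun t => |ζ t| * C)
    univ_mem (Eventually.of_forall fun y => (hζ.integrable hf.continuous y).aestronglyMeasurable)
    (hζ.integrable hf.continuous x) (hζ.integrable hcd x).aestronglyMeasurable
    (Eventually.of_forall fun t y _ => ?_)
    ((hζ.continuous.abs.integrable_of_hasCompactSupport hζ.hasCompactSupport.abs).mul_const C)
    (Eventually.of_forall fun t y _ => ?_)
  · rw [norm_smul, Real.norm_eq_abs]
    exact mul_le_mul_of_nonneg_left (hC _) (abs_nonneg _)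
  · have h1 : HasFDerivAt (fun y => f (y - t)) (fderiv ℝ f (y - t)) y := by
      have := (hf.differentiable (by norm_num) (y - t)).hasFDerivAt.comp y
        ((hasFDerivAt_id y).sub_const t)
      rw [ContinuousLinearMap.comp_id] at this
      exact this
    exact h1.const_smul (ζ t)

lemma IsEvenKernel.contDiff_mollify (hζ : IsEvenKernel ζ) {f : E d → F} (hf : ContDiff ℝ 1 f)
    (hp : Periodic f) : ContDiff ℝ 1 (mollify ζ f) := by
  rw [contDiff_one_iff_fderiv]
  refine ⟨fun x => (hζ.hasFDerivAt_mollify hf hp x).differentiableAt, ?_⟩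
  have : fderiv ℝ (mollify ζ f) = mollify ζ (fderiv ℝ f) :=
    funext fun x => (hζ.hasFDerivAt_mollify hf hp x).fderiv
  rw [this]
  exact hζ.continuous_mollify (hf.continuous_fderiv (by norm_num))

lemma IsEvenKernel.grad_mollify (hζ : IsEvenKernel ζ) {v : E d → E d} (hv : ContDiff ℝ 1 v)
    (hp : Periodic v) (x : E d) (a b : Fin d) :
    grad (mollify ζ v) x a b = mollify ζ (fun y => grad v y a b) x := by
  have hcd := hv.continuous_fderiv (by norm_num)
  let L : (E d →L[ℝ] E d) →L[ℝ] ℝ :=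
    (EuclideanSpace.proj (𝕜 := ℝ) a).comp (ContinuousLinearMap.apply ℝ (E d) (e b))
  have hL : ∀ A : E d →L[ℝ] E d, L A = (A (e b)) a := fun A => rfl
  have h1 : grad (mollify ζ v) x a b = L (fderiv ℝ (mollify ζ v) x) := rfl
  rw [h1, (hζ.hasFDerivAt_mollify hv hp x).fderiv, mollify_apply, mollify_apply,
    ← L.integral_comp_comm (hζ.integrable hcd x)]
  simp only [map_smul]
  rfl

lemma IsEvenKernel.isSolenoidal_mollify (hζ : IsEvenKernel ζ) {v : E d → E d}
    (hv : IsSolenoidal v) : IsSolenoidal (mollify ζ v) := by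
  refine ⟨hζ.contDiff_mollify hv.contDiff hv.periodic, periodic_mollify hv.periodic, fun x => ?_⟩
  simp only [Matrix.trace, Matrix.diag, hζ.grad_mollify hv.contDiff hv.periodic, mollify_apply]
  rw [← integral_finsetSum _ fun a _ => hζ.integrable (continuous_grad_apply hv.contDiff a a) x]
  simp only [← Finset.smul_sum]
  have h : ∀ y, ∑ a, grad v y a a = 0 := hv.trace_grad
  simp [h]

/-- Mollification with an even kernel is symmetric. -/
lemma IsEvenKernel.integral_mollify_mul (hζ : IsEvenKernel ζ) {f g : E d → ℝ}
    (hf : Continuous f) (hfp : Periodic f) (hg : Continuous g) (hgp : Periodic g) :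
    ∫ x in cell d, mollify ζ f x * g x = ∫ x in cell d, f x * mollify ζ g x := by
  obtain ⟨Cf, hCf0, hCf⟩ := hfp.exists_bound hf
  obtain ⟨Cg, hCg0, hCg⟩ := hgp.exists_bound hg
  have hζi : Integrable fun t => |ζ t| :=
    hζ.continuous.abs.integrable_of_hasCompactSupport hζ.hasCompactSupport.abs
  have hint : ∀ (f g : E d → ℝ) (Cf Cg : ℝ), Continuous f → Continuous g → (∀ x, ‖f x‖ ≤ Cf) →
      (∀ x, ‖g x‖ ≤ Cg) → Integrable (fun z : E d × E d => ζ z.2 * f (z.1 - z.2) * g z.1)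
      ((volume.restrict (cell d)).prod volume) := by
    intro f g Cf Cg hf hg hCf hCg
    refine ((integrable_const (Cf * Cg)).mul_prod hζi).mono' ?_ (Eventually.of_forall fun z => ?_)
    · exact (((hζ.continuous.comp continuous_snd).mul (hf.comp (by fun_prop))).mul
        (hg.comp continuous_fst)).aestronglyMeasurable
    · have h0 : 0 ≤ Cf := (norm_nonneg _).trans (hCf 0)
      rw [norm_mul, norm_mul, Real.norm_eq_abs (ζ z.2)]
      calc |ζ z.2| * ‖f (z.1 - z.2)‖ * ‖g z.1‖ ≤ |ζ z.2| * Cf * Cg := by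
            gcongr
            exacts [hCf _, hCg _]
        _ = _ := by ring
  have step : ∀ (f g : E d → ℝ) (Cf Cg : ℝ), Continuous f → Continuous g → (∀ x, ‖f x‖ ≤ Cf) →
      (∀ x, ‖g x‖ ≤ Cg) → ∫ x in cell d, mollify ζ f x * g x
        = ∫ t, ζ t * ∫ x in cell d, f (x - t) * g x := by
    intro f g Cf Cg hf hg hCf hCg
    calc ∫ x in cell d, mollify ζ f x * g x = ∫ x in cell d, ∫ t, ζ t * f (x - t) * g x := by
          congr 1; funext x
          rw [mollify_apply, ← integral_mul_const]; rfl
      _ = ∫ t, ∫ x in cell d, ζ t * f (x - t) * g x :=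
          integral_integral_swap (hint f g Cf Cg hf hg hCf hCg)
      _ = _ := by
          congr 1; funext t
          rw [← integral_const_mul]
          simp only [mul_assoc]
  rw [step f g Cf Cg hf hg hCf hCg]
  simp only [mul_comm (f _) (mollify ζ g _)]
  rw [step g f Cg Cf hg hf hCg hCf, ← integral_neg_eq_self]
  congr 1; funext t
  rw [hζ.even]
  congr 1
  have hp : Periodic fun x => f (x + t) * g x := fun a x => by
    simp only [hgp a x, add_right_comm x (e a) t, hfp a]
  have h1 := setIntegral_cell_add hp (-t)
  simp only [← sub_eq_add_neg, sub_add_cancel] at h1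
  calc ∫ x in cell d, f (x - -t) * g x = ∫ x in cell d, f (x + t) * g x := by
        simp only [sub_neg_eq_add]
    _ = ∫ x in cell d, f x * g (x - t) := h1.symm
    _ = _ := by simp only [mul_comm]

lemma IsEvenKernel.mollify_sum_smul (hζ : IsEvenKernel ζ) {ω : ℕ → E d → E d}
    (hω : ∀ j, Continuous (ω j)) (s : Finset ℕ) (c : ℕ → ℝ) (x : E d) :
    mollify ζ (∑ j ∈ s, c j • ω j) x = ∑ j ∈ s, c j • mollify ζ (ω j) x := by
  simp only [mollify_apply]
  have h1 : ∀ t, ζ t • (∑ j ∈ s, c j • ω j) (x - t) = ∑ j ∈ s, c j • (ζ t • ω j (x - t)) := by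
    intro t
    simp only [Finset.sum_apply, Pi.smul_apply, Finset.smul_sum]
    exact Finset.sum_congr rfl fun j _ => smul_comm _ _ _
  simp only [h1]
  have h2 : ∀ j ∈ s, Integrable (fun t => c j • (ζ t • ω j (x - t))) := fun j _ =>
    (hζ.integrable (hω j) x).smul (c j)
  rw [integral_finsetSum _ h2]
  simp only [integral_smul]

end Mollify

/-! ### The spatial energy identities -/

section Identities

variable {d : ℕ}

lemma gradient_apply (f : E d → ℝ) (x : E d) (a : Fin d) : (∇ f x) a = pderiv a f x := by
  have h : inner ℝ (∇ f x) (e a) = fderiv ℝ f x (e a) := by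
    simp [gradient, InnerProductSpace.toDual_symm_apply]
  rw [pderiv, ← h, e, EuclideanSpace.inner_single_right]
  simp only [one_mul, conj_trivial]

lemma norm_gradient_sq (f : E d → ℝ) (x : E d) : ‖∇ f x‖ ^ 2 = ∑ a, pderiv a f x ^ 2 := by
  rw [EuclideanSpace.norm_sq_eq]
  simp [gradient_apply]

lemma inner_gradient_right (v : E d) (f : E d → ℝ) (x : E d) :
    inner ℝ v (∇ f x) = ∑ b, v b * pderiv b f x := by
  rw [PiLp.inner_apply]
  refine Finset.sum_congr rfl fun b _ => ?_
  rw [gradient_apply]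
  simp [mul_comm]

lemma contDiff_one_pderiv {f : E d → ℝ} (hf : ContDiff ℝ 2 f) (a : Fin d) :
    ContDiff ℝ 1 (pderiv a f) :=
  (hf.fderiv_right (m := 1) (by norm_num)).clm_apply contDiff_const

lemma pderiv_pderiv_eq {f : E d → ℝ} (hf : ContDiff ℝ 2 f) (a b : Fin d) (x : E d) :
    pderiv a (pderiv b f) x = fderiv ℝ (fderiv ℝ f) x (e a) (e b) := by
  have h1 : DifferentiableAt ℝ (fderiv ℝ f) x :=
    (hf.fderiv_right (m := 1) (by norm_num)).differentiable (by norm_num) x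
  have h2 := (h1.hasFDerivAt.clm_apply (hasFDerivAt_const (e b) x)).fderiv
  unfold pderiv
  rw [h2]
  simp

lemma pderiv_comm {f : E d → ℝ} (hf : ContDiff ℝ 2 f) (a b : Fin d) (x : E d) :
    pderiv a (pderiv b f) x = pderiv b (pderiv a f) x := by
  rw [pderiv_pderiv_eq hf, pderiv_pderiv_eq hf]
  exact (hf.contDiffAt.isSymmSndFDerivAt (by simp)).eq _ _

lemma laplacian_eq_sum {f : E d → ℝ} (hf : ContDiff ℝ 2 f) (x : E d) :
    Laplacian.laplacian f x = ∑ a, pderiv a (pderiv a f) x := by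
  rw [InnerProductSpace.laplacian_eq_iteratedFDeriv_orthonormalBasis f
    (EuclideanSpace.basisFun (Fin d) ℝ)]
  simp only [pderiv_pderiv_eq hf, iteratedFDeriv_two_apply]
  simp [e]

lemma continuous_laplacian {f : E d → ℝ} (hf : ContDiff ℝ 2 f) :
    Continuous fun x => Laplacian.laplacian f x := by
  simp only [laplacian_eq_sum hf]
  exact continuous_finsetSum _ fun a _ => continuous_pderiv (contDiff_one_pderiv hf a) a

lemma hasDerivAt_W (s : ℝ) : HasDerivAt W (-2 * s * (1 - s ^ 2)) s := by
  unfold W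
  have h1 : HasDerivAt (fun s : ℝ => 1 - s ^ 2) (-(2 * s)) s := by
    simpa using ((hasDerivAt_id s).pow 2).const_sub 1
  refine ((h1.fun_pow 2).div_const 2).congr_deriv ?_
  simp; ring

lemma deriv_W : deriv W = fun s => -2 * s * (1 - s ^ 2) := funext fun s => (hasDerivAt_W s).deriv

lemma continuous_deriv_W : Continuous (deriv W) := by rw [deriv_W]; fun_prop

lemma contDiff_W : ContDiff ℝ 1 W := by unfold W; fun_prop

lemma W_nonneg (s : ℝ) : 0 ≤ W s := by unfold W; positivity

variable {φ : E d → ℝ} {U u : E d → E d}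

lemma continuous_sum_mul_pderiv (hU : Continuous U) (hφ : ContDiff ℝ 1 φ) :
    Continuous fun x => ∑ b, U x b * pderiv b φ x :=
  continuous_finsetSum _ fun b _ => ((EuclideanSpace.proj (𝕜 := ℝ) b).continuous.comp hU).mul
    (continuous_pderiv hφ b)

/-- Transport by a solenoidal field does not change the potential energy. -/
lemma IsSolenoidal.integral_deriv_W_mul (hU : IsSolenoidal U) (hφ : ContDiff ℝ 1 φ)
    (hφp : Periodic φ) : ∫ x in cell d, deriv W (φ x) * ∑ b, U x b * pderiv b φ x = 0 := by
  have h := hU.integral_sum_mul_pderiv_eq_zero (f := fun x => W (φ x)) (contDiff_W.comp hφ)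
    fun a x => by simp only [hφp a x]
  rw [← h]
  congr 1; funext x
  have h1 : ∀ b, pderiv b (fun x => W (φ x)) x = deriv W (φ x) * pderiv b φ x := by
    intro b
    have := ((hasDerivAt_W (φ x)).comp_hasFDerivAt x
      (hφ.differentiable (by norm_num) x).hasFDerivAt).fderiv
    unfold pderiv
    rw [show (fun x => W (φ x)) = W ∘ φ from rfl, this, (hasDerivAt_W (φ x)).deriv]
    simp
  simp only [h1, Finset.mul_sum]
  exact Finset.sum_congr rfl fun b _ => by ring

/-- Transport by a solenoidal field changes the Dirichlet energy only through the strain. -/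
lemma IsSolenoidal.integral_laplacian_mul (hU : IsSolenoidal U) (hφ : ContDiff ℝ 2 φ)
    (hφp : Periodic φ) :
    ∫ x in cell d, Laplacian.laplacian φ x * ∑ b, U x b * pderiv b φ x
      = -∫ x in cell d, ∑ i : Fin d × Fin d,
          pderiv i.1 φ x * pderiv i.2 φ x * grad U x i.2 i.1 := by
  have hφ1 : ContDiff ℝ 1 φ := hφ.of_le (by norm_num)
  have hUc := contDiff_component hU.contDiff
  have hUd := hU.contDiff.differentiable (by norm_num : (1 : WithTop ℕ∞) ≠ 0)
  have hp1 := contDiff_one_pderiv hφ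
  set h : E d → ℝ := fun x => ∑ b, U x b * pderiv b φ x with hh
  have hhc : ContDiff ℝ 1 h := ContDiff.sum fun b _ => (hUc b).mul (hp1 b)
  have hhp : Periodic h := fun a x => by
    simp only [hh, hU.periodic a x, hφp.pderiv _ a x]
  have hdh : ∀ a x, pderiv a h x
      = ∑ b, (grad U x b a * pderiv b φ x + U x b * pderiv b (pderiv a φ) x) := by
    intro a x
    have h1 : ∀ b, HasFDerivAt (fun x => U x b * pderiv b φ x)
        (U x b • fderiv ℝ (pderiv b φ) x + pderiv b φ x • fderiv ℝ (fun y => U y b) x) x :=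
      fun b => ((hUc b).differentiable (by norm_num) x).hasFDerivAt.fun_mul
        ((hp1 b).differentiable (by norm_num) x).hasFDerivAt
    have h2 := (HasFDerivAt.fun_sum fun b (_ : b ∈ Finset.univ) => h1 b).fderiv
    unfold pderiv at h2 ⊢
    rw [hh]
    unfold pderiv
    rw [h2, _root_.sum_apply]
    refine Finset.sum_congr rfl fun b _ => ?_
    have h3 := pderiv_comm hφ a b x
    unfold pderiv at h3
    rw [grad_apply hUd, ← h3]
    simp only [_root_.add_apply, _root_.smul_apply, smul_eq_mul]
    ring
  -- the Dirichlet density is transported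
  have htr := hU.integral_sum_mul_pderiv_eq_zero (f := fun x => ∑ a, pderiv a φ x ^ 2 / 2)
    (ContDiff.sum fun a _ => ((hp1 a).pow 2).div_const 2)
    fun a x => by simp only [hφp.pderiv _ a x]
  have hdd : ∀ b x, pderiv b (fun x => ∑ a, pderiv a φ x ^ 2 / 2) x
      = ∑ a, pderiv a φ x * pderiv b (pderiv a φ) x := by
    intro b x
    have h1 : ∀ a, HasFDerivAt (fun x => pderiv a φ x ^ 2 / 2)
        (pderiv a φ x • fderiv ℝ (pderiv a φ) x) x := by
      intro a
      have hA : HasDerivAt (fun r : ℝ => r ^ 2 / 2) (pderiv a φ x) (pderiv a φ x) := by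
        refine (((hasDerivAt_id (pderiv a φ x)).fun_pow 2).div_const 2).congr_deriv ?_
        simp
      exact hA.comp_hasFDerivAt x ((hp1 a).differentiable (by norm_num) x).hasFDerivAt
    have h2 := (HasFDerivAt.fun_sum fun a (_ : a ∈ Finset.univ) => h1 a).fderiv
    conv_lhs => unfold pderiv
    unfold pderiv at h2
    rw [h2, _root_.sum_apply]
    rfl
  have hcp := fun a => continuous_pderiv hφ1 a
  have hcpp := fun a b => continuous_pderiv (hp1 b) a
  have hcg := fun a b => continuous_grad_apply hU.contDiff a b
  have hcS : Continuous fun x => ∑ i : Fin d × Fin d,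
      pderiv i.1 φ x * pderiv i.2 φ x * grad U x i.2 i.1 :=
    continuous_finsetSum _ fun i _ => ((hcp _).mul (hcp _)).mul (hcg _ _)
  have hcT : Continuous fun x =>
      ∑ b, U x b * pderiv b (fun x => ∑ a, pderiv a φ x ^ 2 / 2) x := by
    simp only [hdd]
    exact continuous_finsetSum _ fun b _ => (hUc b).continuous.mul
      (continuous_finsetSum _ fun a _ => (hcp a).mul (hcpp b a))
  calc ∫ x in cell d, Laplacian.laplacian φ x * h x
      = ∫ x in cell d, ∑ a, h x * pderiv a (pderiv a φ) x := by
        simp only [laplacian_eq_sum hφ, mul_comm _ (h _), Finset.mul_sum]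
    _ = ∑ a, ∫ x in cell d, h x * pderiv a (pderiv a φ) x :=
        integral_finsetSum _ fun a _ => integrable_cell (hhc.continuous.fun_mul (hcpp a a))
    _ = ∑ a, -∫ x in cell d, pderiv a h x * pderiv a φ x :=
        Finset.sum_congr rfl fun a _ => integral_mul_pderiv hhp (hφp.pderiv a) hhc (hp1 a) a
    _ = -∫ x in cell d, ∑ a, pderiv a h x * pderiv a φ x := by
        rw [Finset.sum_neg_distrib, integral_finsetSum _ fun a _ => integrable_cell
          ((continuous_pderiv hhc a).fun_mul (hcp a))]
    _ = -∫ x in cell d, ((∑ i : Fin d × Fin d, pderiv i.1 φ x * pderiv i.2 φ x * grad U x i.2 i.1)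
          + ∑ b, U x b * pderiv b (fun x => ∑ a, pderiv a φ x ^ 2 / 2) x) := by
        congr 2; funext x
        simp only [hdh, hdd, Finset.sum_mul, Finset.mul_sum, Fintype.sum_prod_type]
        rw [Finset.sum_comm (f := fun b a => U x b * (pderiv a φ x * pderiv b (pderiv a φ) x)),
          ← Finset.sum_add_distrib]
        refine Finset.sum_congr rfl fun a _ => ?_
        rw [← Finset.sum_add_distrib]
        refine Finset.sum_congr rfl fun b _ => ?_
        ring
    _ = _ := by
        rw [integral_add (integrable_cell hcS) (integrable_cell hcT), htr, add_zero]

/-- The convective term does not change the kinetic energy. -/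
lemma IsSolenoidal.integral_convection_eq_zero (hu : IsSolenoidal u) :
    ∫ x in cell d, inner ℝ (fderiv ℝ u x (u x)) (u x) = 0 := by
  have hc := contDiff_component hu.contDiff
  have h := hu.integral_sum_mul_pderiv_eq_zero (f := fun x => ‖u x‖ ^ 2)
    (hu.contDiff.norm_sq ℝ) fun a x => by simp only [hu.periodic a x]
  have h1 : ∀ x, ∑ b, u x b * pderiv b (fun x => ‖u x‖ ^ 2) x
      = 2 * inner ℝ (fderiv ℝ u x (u x)) (u x) := by
    intro x
    have hd := (hu.contDiff.differentiable (by norm_num) x).hasFDerivAt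
    have h2 : ∀ b, pderiv b (fun x => ‖u x‖ ^ 2) x = 2 * inner ℝ (u x) (fderiv ℝ u x (e b)) := by
      intro b
      unfold pderiv
      rw [hd.norm_sq.fderiv]
      simp
    conv_rhs => rw [← sum_smul_e (u x)]
    simp only [h2, map_sum, map_smul]
    rw [sum_smul_e, sum_inner, Finset.mul_sum]
    refine Finset.sum_congr rfl fun b _ => ?_
    rw [real_inner_smul_left, real_inner_comm]
    ring
  simp only [h1, integral_const_mul] at h
  linarith

/-- The capillary force acts on the mollified velocity. -/
lemma IsEvenKernel.integral_capillary {ζ : E d → ℝ} (hζ : IsEvenKernel ζ) (hu : IsSolenoidal u)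
    (hφ : ContDiff ℝ 1 φ) (hφp : Periodic φ) :
    ∫ x in cell d, ddot (capillary ζ φ x) (grad u x)
      = ∫ x in cell d, ∑ i : Fin d × Fin d,
          pderiv i.1 φ x * pderiv i.2 φ x * grad (mollify ζ u) x i.2 i.1 := by
  have hcp := fun a => continuous_pderiv hφ a
  have hcg := fun a b => continuous_grad_apply hu.contDiff a b
  have hpp : ∀ a b, Periodic fun x => pderiv a φ x * pderiv b φ x := fun a b c x => by
    simp only [hφp.pderiv _ c x]
  have hpg : ∀ a b, Periodic fun x => grad u x a b := fun a b c x => by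
    simp only [hu.periodic.grad c x]
  simp only [ddot_eq_sum, hζ.grad_mollify hu.contDiff hu.periodic, capillary, Matrix.of_apply,
    gradient_apply]
  rw [integral_finsetSum _ fun i _ => integrable_cell
      ((hζ.continuous_mollify ((hcp i.1).fun_mul (hcp i.2))).fun_mul (hcg i.2 i.1)),
    integral_finsetSum _ fun i _ => integrable_cell
      (((hcp i.1).fun_mul (hcp i.2)).fun_mul (hζ.continuous_mollify (hcg i.2 i.1)))]
  exact Finset.sum_congr rfl fun i _ => hζ.integral_mollify_mul ((hcp _).mul (hcp _)) (hpp _ _)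
    (hcg _ _) (hpg _ _)

end Identities

/-! ### The stress tensor -/

section Stress

variable {d : ℕ} {ν₀ p : ℝ} {τ τp τm : Sym d → Sym d}

lemma IsStress.continuous_apply (hτ : IsStress ν₀ p τ) {X : Type*} [TopologicalSpace X]
    {s : X → Sym d} (hs : ∀ a b, Continuous fun x => (s x).1 a b) (a b : Fin d) :
    Continuous fun x => (τ (s x)).1 a b := by
  rw [continuous_iff_continuousAt]
  intro x₀
  obtain ⟨r, hr, K, hK⟩ := hτ.locLip (s x₀)
  have hm : Tendsto (fun x => mnorm ((s x).1 - (s x₀).1)) (𝓝 x₀) (𝓝 0) := by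
    have h1 : Continuous fun x => mnorm ((s x).1 - (s x₀).1) := by
      simp only [mnorm_eq, Matrix.sub_apply]
      exact (continuous_finsetSum _ fun i _ => ((hs i.1 i.2).sub continuous_const).pow 2).sqrt
    have h2 := h1.tendsto x₀
    simpa [mnorm_eq] using h2
  have hm0 : mnorm ((s x₀).1 - (s x₀).1) < r := by simpa [mnorm_eq] using hr
  rw [ContinuousAt, tendsto_iff_dist_tendsto_zero]
  refine squeeze_zero' (Eventually.of_forall fun _ => dist_nonneg) ?_
    (by simpa using hm.const_mul K)
  filter_upwards [hm.eventually (gt_mem_nhds hr)] with x hx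
  rw [Real.dist_eq]
  exact (abs_apply_le_mnorm ((τ (s x)).1 - (τ (s x₀)).1) a b).trans (hK _ _ hx hm0)

lemma continuous_mixStress (hp : IsStress ν₀ p τp) (hm : IsStress ν₀ p τm) {X : Type*}
    [TopologicalSpace X] {s : X → Sym d} (hs : ∀ a b, Continuous fun x => (s x).1 a b)
    {f : X → ℝ} (hf : Continuous f) (a b : Fin d) :
    Continuous fun x => mixStress τp τm (f x) (s x) a b := by
  simp only [mixStress, Matrix.add_apply, Matrix.smul_apply, smul_eq_mul]
  exact (((continuous_const.add hf).div_const _).mul (hp.continuous_apply hs a b)).add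
    (((continuous_const.sub hf).div_const _).mul (hm.continuous_apply hs a b))

lemma le_ddot_mixStress (hp : IsStress ν₀ p τp) (hm : IsStress ν₀ p τm) {f : ℝ} (hf : |f| ≤ 1)
    (s : Sym d) : ν₀ * mnorm s.1 ^ p ≤ ddot (mixStress τp τm f s) s.1 := by
  have h1 : ddot (mixStress τp τm f s) s.1
      = (1 + f) / 2 * ddot (τp s).1 s.1 + (1 - f) / 2 * ddot (τm s).1 s.1 := by
    simp [mixStress, ddot, Matrix.add_mul, Matrix.trace_add, Matrix.trace_smul]
  have h2 := abs_le.1 hf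
  rw [h1]
  have h3 := mul_le_mul_of_nonneg_left (hp.lower s) (by linarith : 0 ≤ (1 + f) / 2)
  have h4 := mul_le_mul_of_nonneg_left (hm.lower s) (by linarith : 0 ≤ (1 - f) / 2)
  linarith

end Stress

/-! ### The dissipation of energy -/

section Dissipation

variable {d : ℕ} {ν₀ p ε : ℝ} {τp τm : Sym d → Sym d} {ζ φ : E d → ℝ} {u : E d → E d}

/-- The right-hand side of the phase equation. -/
noncomputable def phaseRHS (ζ : E d → ℝ) (ε : ℝ) (φ : E d → ℝ) (u : E d → E d) (x : E d) : ℝ :=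
  Laplacian.laplacian φ x - deriv W (φ x) / ε ^ 2 - inner ℝ (mollify ζ u x) (∇ φ x)

/-- The rate of change of the total energy is at most minus the dissipation: the capillary force
cancels the transport of the interface. -/
theorem energy_rate_le (hp : IsStress ν₀ p τp) (hm : IsStress ν₀ p τm) (hp0 : 0 ≤ p)
    (hε : 0 < ε) (hζ : IsEvenKernel ζ) (hu : IsSolenoidal u) (hφ : ContDiff ℝ 2 φ)
    (hφp : Periodic φ) (hφ1 : ∀ x, |φ x| ≤ 1) :
    1 / σ * (∫ x in cell d,
        (-(ε * Laplacian.laplacian φ x) + deriv W (φ x) / ε) * phaseRHS ζ ε φ u x)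
      + momentumRHS τp τm ζ ε φ u u ≤ -∫ x in cell d, dissipation ν₀ p ε φ u x := by
  have hφ' : ContDiff ℝ 1 φ := hφ.of_le (by norm_num)
  have hU := hζ.isSolenoidal_mollify hu
  have hcL := continuous_laplacian hφ
  have hcW : Continuous fun x => deriv W (φ x) := continuous_deriv_W.comp hφ.continuous
  have hce := continuous_symGrad_apply hu.contDiff
  have hcen : Continuous fun x => mnorm (symGrad u x).1 ^ p :=
    (continuous_mnorm_symGrad hu.contDiff).rpow_const fun _ => Or.inr hp0
  set h : E d → ℝ := fun x => ∑ b, mollify ζ u x b * pderiv b φ x with hh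
  have hch : Continuous h := continuous_sum_mul_pderiv hU.contDiff.continuous hφ'
  -- `Q` is the dissipation of the interface and `S` the work of the transport, which occurs in the
  -- phase equation and in the capillary term with opposite signs
  set Q : ℝ := ∫ x in cell d, (Laplacian.laplacian φ x - deriv W (φ x) / ε ^ 2) ^ 2 with hQ
  set S : ℝ := ∫ x in cell d, ∑ i : Fin d × Fin d,
    pderiv i.1 φ x * pderiv i.2 φ x * grad (mollify ζ u) x i.2 i.1 with hS
  have e1 : ∫ x in cell d,
      (-(ε * Laplacian.laplacian φ x) + deriv W (φ x) / ε) * phaseRHS ζ ε φ u x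
      = -ε * Q - ε * S := by
    have h1 : ∀ x, (-(ε * Laplacian.laplacian φ x) + deriv W (φ x) / ε) * phaseRHS ζ ε φ u x
        = -ε * (Laplacian.laplacian φ x - deriv W (φ x) / ε ^ 2) ^ 2
          + (ε * (Laplacian.laplacian φ x * h x) - 1 / ε * (deriv W (φ x) * h x)) := by
      intro x
      rw [phaseRHS, inner_gradient_right, hh]
      field_simp
      ring
    have i1 : Integrable (fun x => -ε * (Laplacian.laplacian φ x - deriv W (φ x) / ε ^ 2) ^ 2)
        (volume.restrict (cell d)) :=
      integrable_cell (((hcL.sub (hcW.div_const _)).pow 2).const_mul _)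
    have i2 : Integrable (fun x => ε * (Laplacian.laplacian φ x * h x))
        (volume.restrict (cell d)) := integrable_cell ((hcL.mul hch).const_mul _)
    have i3 : Integrable (fun x => 1 / ε * (deriv W (φ x) * h x))
        (volume.restrict (cell d)) := integrable_cell ((hcW.mul hch).const_mul _)
    have h2 : ∫ x in cell d, Laplacian.laplacian φ x * h x = -S :=
      hU.integral_laplacian_mul hφ hφp
    have h3 : ∫ x in cell d, deriv W (φ x) * h x = 0 := hU.integral_deriv_W_mul hφ' hφp
    simp only [h1]
    have i4 : Integrable (fun x => ε * (Laplacian.laplacian φ x * h x)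
        - 1 / ε * (deriv W (φ x) * h x)) (volume.restrict (cell d)) := i2.sub i3
    rw [integral_add i1 i4, integral_sub i2 i3, integral_const_mul, integral_const_mul,
      integral_const_mul, h2, h3]
    ring
  have e2 : ∫ x in cell d, dissipation ν₀ p ε φ u x
      = ε / σ * Q + ν₀ * ∫ x in cell d, mnorm (symGrad u x).1 ^ p := by
    have i1 : Integrable (fun x => ε / σ * (Laplacian.laplacian φ x - deriv W (φ x) / ε ^ 2) ^ 2)
        (volume.restrict (cell d)) :=
      integrable_cell (((hcL.sub (hcW.div_const _)).pow 2).const_mul _)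
    have i2 : Integrable (fun x => ν₀ * mnorm (symGrad u x).1 ^ p) (volume.restrict (cell d)) :=
      integrable_cell (hcen.const_mul _)
    rw [hQ, ← integral_const_mul, ← integral_const_mul]
    exact integral_add i1 i2
  have e3 : ν₀ * ∫ x in cell d, mnorm (symGrad u x).1 ^ p
      ≤ ∫ x in cell d, ddot (mixStress τp τm (φ x) (symGrad u x)) (symGrad u x).1 := by
    rw [← integral_const_mul]
    refine integral_mono (integrable_cell (hcen.const_mul _)) (integrable_cell ?_)
      fun x => le_ddot_mixStress hp hm (hφ1 x) _
    simp only [ddot_eq_sum]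
    exact continuous_finsetSum _ fun i _ =>
      (continuous_mixStress hp hm hce hφ.continuous _ _).mul (hce _ _)
  rw [momentumRHS, hu.integral_convection_eq_zero, hζ.integral_capillary hu hφ' hφp, e1, e2, ← hS]
  have e4 : 1 / σ * (-ε * Q - ε * S) = -(ε / σ * Q) - ε / σ * S := by ring
  rw [e4]
  linarith

end Dissipation

/-! ### Time-dependent functions with uniform spatial bounds -/

section RegularFamily

variable {d : ℕ}

/-- A family of `C^k` functions with uniformly bounded derivatives of order at most `k`, depending
continuously on the time for each fixed point of space. -/
structure IsRegularFamily (k : ℕ) (f : ℝ → E d → ℝ) : Prop where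
  contDiff : ∀ t, ContDiff ℝ k (f t)
  bound : ∃ M : ℝ, ∀ t x, ∀ j ≤ k, ‖iteratedFDeriv ℝ j (f t) x‖ ≤ M
  cont : ∀ x, Continuous fun t => f t x

variable {k : ℕ} {f : ℝ → E d → ℝ}

lemma IsRegularFamily.continuous (hf : IsRegularFamily k f) (hk : 1 ≤ k) :
    Continuous (Function.uncurry f) := by
  obtain ⟨M, hM⟩ := hf.bound
  refine continuous_prod_of_continuous_lipschitzWith' _ M.toNNReal (fun t => ?_) hf.cont
  refine lipschitzWith_of_nnnorm_fderiv_le (𝕜 := ℝ)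
    ((hf.contDiff t).differentiable (by exact_mod_cast (by omega : k ≠ 0))) fun x => ?_
  have := hM t x 1 hk
  rw [norm_iteratedFDeriv_one] at this
  rw [← NNReal.coe_le_coe, coe_nnnorm]
  exact this.trans (Real.le_coe_toNNReal M)

/-- The partial derivatives are uniform limits of difference quotients, hence continuous in time. -/
lemma IsRegularFamily.pderiv (hf : IsRegularFamily (k + 1) f) (hk : 1 ≤ k) (a : Fin d) :
    IsRegularFamily k fun t => pderiv a (f t) := by
  obtain ⟨M, hM⟩ := hf.bound
  have hea : ‖(e a : E d)‖ = 1 := by simp [e]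
  have hcd : ∀ t, ContDiff ℝ k (fderiv ℝ (f t)) := fun t =>
    (hf.contDiff t).fderiv_right (m := k) (by norm_cast)
  have hk0 : (k : WithTop ℕ∞) ≠ 0 := by exact_mod_cast (by omega : k ≠ 0)
  refine ⟨fun t => (hcd t).clm_apply contDiff_const, ⟨M, fun t x j hj => ?_⟩, fun x => ?_⟩
  · have h1 := norm_iteratedFDeriv_clm_apply_const (n := j) (N := k) (c := (e a : E d))
      (hcd t).contDiffAt (x := x) (by exact_mod_cast hj)
    rw [hea, one_mul, norm_iteratedFDeriv_fderiv] at h1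
    exact h1.trans (hM t x (j + 1) (by omega))
  · have hM0 : 0 ≤ M := (norm_nonneg _).trans (hM 0 0 0 (by omega))
    have hlip : ∀ t y, ‖fderiv ℝ (f t) y - fderiv ℝ (f t) x‖ ≤ M * ‖y - x‖ := by
      intro t y
      refine convex_univ.norm_image_sub_le_of_norm_fderiv_le (𝕜 := ℝ)
        (fun z _ => (hcd t).differentiable hk0 z) (fun z _ => ?_) (Set.mem_univ x) (Set.mem_univ y)
      rw [← norm_iteratedFDeriv_one, norm_iteratedFDeriv_fderiv]
      exact hM t z 2 (by omega)
    set s : ℕ → ℝ := fun n => 1 / ((n : ℝ) + 1) with hs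
    have hs0 : ∀ n, 0 < s n := fun n => Nat.one_div_pos_of_nat
    have hquot : ∀ n t, |TwoPhase.pderiv a (f t) x - (s n)⁻¹ * (f t (x + s n • e a) - f t x)|
        ≤ M * s n := by
      intro n t
      have hball : x + s n • e a ∈ Metric.closedBall x (s n) := by
        simp [norm_smul, hea, abs_of_pos (hs0 n)]
      have h1 := (convex_closedBall x (s n)).norm_image_sub_le_of_norm_fderiv_le' (𝕜 := ℝ)
        (f := f t) (φ := fderiv ℝ (f t) x) (C := M * s n)
        (fun z _ => (hf.contDiff t).differentiable (by norm_cast) z)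
        (fun z hz => (hlip t z).trans (by
          rw [mem_closedBall_iff_norm] at hz
          gcongr)) (Metric.mem_closedBall_self (hs0 n).le) hball
      rw [add_sub_cancel_left, norm_smul, hea, mul_one, map_smul, smul_eq_mul, Real.norm_eq_abs,
        Real.norm_eq_abs, abs_of_pos (hs0 n)] at h1
      have h2 : TwoPhase.pderiv a (f t) x - (s n)⁻¹ * (f t (x + s n • e a) - f t x)
          = -((s n)⁻¹ * (f t (x + s n • e a) - f t x - s n * fderiv ℝ (f t) x (e a))) := by
        have := (hs0 n).ne'
        unfold TwoPhase.pderiv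
        field_simp
        ring
      rw [h2, abs_neg, abs_mul, abs_of_pos (inv_pos.2 (hs0 n)), inv_mul_le_iff₀ (hs0 n)]
      linarith
    have hu : TendstoUniformly (fun n t => (s n)⁻¹ * (f t (x + s n • e a) - f t x))
        (fun t => TwoPhase.pderiv a (f t) x) atTop := by
      rw [Metric.tendstoUniformly_iff]
      intro r hr
      have h1 : Tendsto (fun n => M * s n) atTop (𝓝 0) := by
        have h2 := (tendsto_one_div_add_atTop_nhds_zero_nat (𝕜 := ℝ)).const_mul M
        rwa [mul_zero] at h2
      filter_upwards [h1.eventually (gt_mem_nhds hr)] with n hn t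
      rw [Real.dist_eq]
      exact (hquot n t).trans_lt hn
    exact hu.continuous (Frequently.of_forall fun n =>
      continuous_const.mul ((hf.cont _).sub (hf.cont _)))

lemma IsRegularFamily.continuous_laplacian (hf : IsRegularFamily 3 f) :
    Continuous fun z : ℝ × E d => Laplacian.laplacian (f z.1) z.2 := by
  have h1 : ∀ t x, Laplacian.laplacian (f t) x = ∑ a, TwoPhase.pderiv a (TwoPhase.pderiv a (f t)) x :=
    fun t x => laplacian_eq_sum ((hf.contDiff t).of_le (by norm_num)) x
  simp only [h1]
  exact continuous_finsetSum _ fun a _ =>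
    ((hf.pderiv (k := 2) (by norm_num) a).pderiv (k := 1) le_rfl a).continuous le_rfl

/-- Green's formula on the torus. -/
lemma integral_sum_pderiv_mul_pderiv {φ ψ : E d → ℝ} (hφ : ContDiff ℝ 2 φ) (hφp : Periodic φ)
    (hψ : ContDiff ℝ 1 ψ) (hψp : Periodic ψ) :
    ∫ x in cell d, ∑ a, TwoPhase.pderiv a ψ x * TwoPhase.pderiv a φ x
      = -∫ x in cell d, ψ x * Laplacian.laplacian φ x := by
  have hp1 := contDiff_one_pderiv hφ
  have h1 : ∀ x, ψ x * Laplacian.laplacian φ x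
      = ∑ a, ψ x * TwoPhase.pderiv a (TwoPhase.pderiv a φ) x := fun x => by
    rw [laplacian_eq_sum hφ, Finset.mul_sum]
  simp only [h1]
  rw [integral_finsetSum _ fun a _ => integrable_cell
      ((continuous_pderiv hψ a).fun_mul (hp1 a).continuous),
    integral_finsetSum _ fun a _ => integrable_cell
      (hψ.continuous.fun_mul (continuous_pderiv (hp1 a) a)), ← Finset.sum_neg_distrib]
  refine Finset.sum_congr rfl fun a _ => ?_
  rw [integral_mul_pderiv hψp (hφp.pderiv a) hψ (hp1 a), neg_neg]

/-- Difference quotients in time converge weakly to the time derivative. -/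
lemma tendsto_integral_slope_mul {f F G : ℝ → E d → ℝ} (hf : ∀ t, Continuous (f t))
    (hF : Continuous (Function.uncurry F)) (hG : Continuous (Function.uncurry G)) {t₀ : ℝ}
    {U : Set ℝ} (hU : U ∈ 𝓝 t₀) (hd : ∀ t ∈ U, ∀ x, HasDerivAt (fun t => f t x) (F t x) t) :
    Tendsto (fun t => ∫ x in cell d, (t - t₀)⁻¹ * (f t x - f t₀ x) * G t x) (𝓝[≠] t₀)
      (𝓝 (∫ x in cell d, F t₀ x * G t₀ x)) := by
  obtain ⟨r, hr, hrU⟩ := Metric.mem_nhds_iff.1 hU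
  have hr2 : 0 < r / 2 := by linarith
  have hsub : Metric.closedBall t₀ (r / 2) ⊆ U :=
    (Metric.closedBall_subset_ball (by linarith)).trans hrU
  have hK : IsCompact (Metric.closedBall t₀ (r / 2) ×ˢ closedCell d) :=
    (isCompact_closedBall _ _).prod isCompact_closedCell
  obtain ⟨C, hC⟩ := hK.exists_bound_of_continuousOn hF.continuousOn
  obtain ⟨L, hL⟩ := hK.exists_bound_of_continuousOn hG.continuousOn
  have hC' : ∀ t ∈ Metric.closedBall t₀ (r / 2), ∀ x ∈ closedCell d, ‖F t x‖ ≤ C :=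
    fun t ht x hx => hC (t, x) ⟨ht, hx⟩
  have hL' : ∀ t ∈ Metric.closedBall t₀ (r / 2), ∀ x ∈ closedCell d, ‖G t x‖ ≤ L :=
    fun t ht x hx => hL (t, x) ⟨ht, hx⟩
  have hGt : ∀ t, Continuous (G t) := fun t => hG.comp (by fun_prop : Continuous fun x => (t, x))
  refine tendsto_integral_filter_of_dominated_convergence (fun _ => C * L)
    (Eventually.of_forall fun t => ?_) ?_ (integrable_const _)
    (Eventually.of_forall fun x => ?_)
  · exact ((continuous_const.mul ((hf t).sub (hf t₀))).mul (hGt t)).aestronglyMeasurable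
  · have hmem : Metric.closedBall t₀ (r / 2) ∈ 𝓝[≠] t₀ :=
      mem_nhdsWithin_of_mem_nhds (Metric.closedBall_mem_nhds t₀ hr2)
    filter_upwards [hmem, self_mem_nhdsWithin] with t ht htne
    filter_upwards [ae_restrict_mem measurableSet_cell] with x hx
    have hxc := cell_subset_closedCell hx
    have ht₀ : t₀ ∈ Metric.closedBall t₀ (r / 2) := Metric.mem_closedBall_self hr2.le
    have h1 : ‖f t x - f t₀ x‖ ≤ C * ‖t - t₀‖ :=
      (convex_closedBall t₀ (r / 2)).norm_image_sub_le_of_norm_hasDerivWithin_le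
        (f := fun s => f s x) (f' := fun s => F s x)
        (fun s hs => (hd s (hsub hs) x).hasDerivWithinAt) (fun s hs => hC' s hs x hxc) ht₀ ht
    have h2 : 0 < ‖t - t₀‖ := norm_pos_iff.2 (sub_ne_zero.2 htne)
    have h3 : ‖(t - t₀)⁻¹ * (f t x - f t₀ x)‖ ≤ C := by
      rw [norm_mul, norm_inv, inv_mul_le_iff₀ h2]
      linarith
    rw [norm_mul]
    exact mul_le_mul h3 (hL' t ht x hxc) (norm_nonneg _) ((norm_nonneg _).trans h3)
  · have h1 := hasDerivAt_iff_tendsto_slope.1 (hd t₀ (mem_of_mem_nhds hU) x)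
    have h2 : Tendsto (fun t => G t x) (𝓝[≠] t₀) (𝓝 (G t₀ x)) := by
      have h3 : Continuous fun t => G t x := hG.comp (by fun_prop : Continuous fun t : ℝ => (t, x))
      exact (h3.tendsto t₀).mono_left nhdsWithin_le_nhds
    refine (h1.mul h2).congr fun t => ?_
    rw [slope_def_module, smul_eq_mul]

/-- The Dirichlet energy of a family of `C³` functions is differentiable in time, although the
gradient itself need not be. -/
lemma IsRegularFamily.hasDerivAt_dirichlet (hf : IsRegularFamily 3 f) (hp : ∀ t, Periodic (f t))
    {F : ℝ → E d → ℝ} (hF : Continuous (Function.uncurry F)) {t₀ : ℝ} {U : Set ℝ} (hU : U ∈ 𝓝 t₀)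
    (hd : ∀ t ∈ U, ∀ x, HasDerivAt (fun t => f t x) (F t x) t) :
    HasDerivAt (fun t => ∫ x in cell d, ∑ a, TwoPhase.pderiv a (f t) x ^ 2)
      (-2 * ∫ x in cell d, Laplacian.laplacian (f t₀) x * F t₀ x) t₀ := by
  have hC2 : ∀ t, ContDiff ℝ 2 (f t) := fun t => (hf.contDiff t).of_le (by norm_num)
  have hC1 : ∀ t, ContDiff ℝ 1 (f t) := fun t => (hf.contDiff t).of_le (by norm_num)
  have hcL := hf.continuous_laplacian
  have hcLt : ∀ t, Continuous fun x => Laplacian.laplacian (f t) x := fun t =>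
    TwoPhase.continuous_laplacian (hC2 t)
  have hcp : ∀ t a, Continuous (TwoPhase.pderiv a (f t)) := fun t a =>
    continuous_pderiv (hC1 t) a
  have hci : ∀ t, Integrable (fun x => ∑ a, TwoPhase.pderiv a (f t) x ^ 2)
      (volume.restrict (cell d)) := fun t =>
    integrable_cell (continuous_finsetSum _ fun a _ => (hcp t a).pow 2)
  -- difference quotients, integrated by parts
  have hslope : ∀ t, slope (fun t => ∫ x in cell d, ∑ a, TwoPhase.pderiv a (f t) x ^ 2) t₀ t
      = -∫ x in cell d, (t - t₀)⁻¹ * (f t x - f t₀ x) *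
          (Laplacian.laplacian (f t) x + Laplacian.laplacian (f t₀) x) := by
    intro t
    have hψ : ContDiff ℝ 1 fun x => f t x - f t₀ x := (hC1 t).sub (hC1 t₀)
    have hψp : Periodic fun x => f t x - f t₀ x := fun a x => by simp only [hp t a x, hp t₀ a x]
    have e1 : ∀ a x, TwoPhase.pderiv a (fun x => f t x - f t₀ x) x
        = TwoPhase.pderiv a (f t) x - TwoPhase.pderiv a (f t₀) x := by
      intro a x
      unfold TwoPhase.pderiv
      rw [fderiv_fun_sub ((hC1 t).differentiable (by norm_num) x)
        ((hC1 t₀).differentiable (by norm_num) x)]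
      rfl
    have e2 : (∫ x in cell d, ∑ a, TwoPhase.pderiv a (f t) x ^ 2)
        - ∫ x in cell d, ∑ a, TwoPhase.pderiv a (f t₀) x ^ 2
        = -∫ x in cell d, (f t x - f t₀ x) *
          (Laplacian.laplacian (f t) x + Laplacian.laplacian (f t₀) x) := by
      have h1 := integral_sum_pderiv_mul_pderiv (hC2 t) (hp t) hψ hψp
      have h2 := integral_sum_pderiv_mul_pderiv (hC2 t₀) (hp t₀) hψ hψp
      have i1 : ∀ r, Integrable (fun x => ∑ a, TwoPhase.pderiv a (fun x => f t x - f t₀ x) x *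
          TwoPhase.pderiv a (f r) x) (volume.restrict (cell d)) := fun r =>
        integrable_cell (continuous_finsetSum _ fun a _ => (continuous_pderiv hψ a).mul (hcp r a))
      have i2 : ∀ r, Integrable (fun x => (f t x - f t₀ x) * Laplacian.laplacian (f r) x)
          (volume.restrict (cell d)) := fun r =>
        integrable_cell (hψ.continuous.mul (hcLt r))
      simp only [mul_add]
      rw [integral_add (i2 t) (i2 t₀), neg_add, ← h1, ← h2, ← integral_sub (hci t) (hci t₀),
        ← integral_add (i1 t) (i1 t₀)]
      congr 1; funext x
      rw [← Finset.sum_sub_distrib, ← Finset.sum_add_distrib]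
      refine Finset.sum_congr rfl fun a _ => ?_
      rw [e1]; ring
    rw [slope_def_module, smul_eq_mul, e2, mul_neg, ← integral_const_mul]
    simp only [mul_assoc]
  rw [hasDerivAt_iff_tendsto_slope]
  simp only [funext hslope]
  have hlim : -2 * ∫ x in cell d, Laplacian.laplacian (f t₀) x * F t₀ x
      = -∫ x in cell d, F t₀ x *
        (Laplacian.laplacian (f t₀) x + Laplacian.laplacian (f t₀) x) := by
    rw [neg_mul, ← integral_const_mul]
    congr 2; funext x; ring
  rw [hlim]
  have hG : Continuous (Function.uncurry fun t x =>
      Laplacian.laplacian (f t) x + Laplacian.laplacian (f t₀) x) :=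
    hcL.add ((hcLt t₀).comp continuous_snd)
  exact (tendsto_integral_slope_mul (fun t => (hC1 t).continuous) hF hG hU hd).neg

end RegularFamily

/-! ### The energy inequality -/

section Flow

variable {d : ℕ}

/-- A weak solution extended to all times: the equations hold on `[0,T]`, the regularity
everywhere. Compared with `IsWeakSolution`, the initial data are the values at time `0`. -/
structure IsFlow (τp τm : Sym d → Sym d) (ζ : E d → ℝ) (ε : ℝ) (ω : ℕ → E d → E d) (i : ℕ)
    (T : ℝ) (u : ℝ → E d → E d) (φ : ℝ → E d → ℝ) : Prop where
  mem : ∀ t, u t ∈ galerkinSpace ω i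
  cont_u : ∀ v ∈ galerkinSpace ω i, Continuous fun t => l2 (u t) v
  regular : IsRegularFamily 3 φ
  periodic : ∀ t, Periodic (φ t)
  abs_le : ∀ t x, |φ t x| ≤ 1
  momentum : ∀ t ∈ Set.Icc 0 T, ∀ v ∈ galerkinSpace ω i,
    l2 (u t) v = l2 (u 0) v + ∫ r in (0 : ℝ)..t, momentumRHS τp τm ζ ε (φ r) (u r) v
  phase : ∀ t ∈ Set.Icc 0 T, ∀ x,
    φ t x = φ 0 x + ∫ r in (0 : ℝ)..t, phaseRHS ζ ε (φ r) (u r) x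

variable {τp τm : Sym d → Sym d} {ζ : E d → ℝ} {ε ν₀ p T : ℝ} {ω : ℕ → E d → E d} {i s : ℕ}
  {u : ℝ → E d → E d} {φ : ℝ → E d → ℝ}

lemma IsFlow.isSolenoidal (h : IsFlow τp τm ζ ε ω i T u φ) (hω : IsGalerkinBasis s ω) (t : ℝ) :
    IsSolenoidal (u t) :=
  hω.isSolenoidal_of_mem (h.mem t)

/-- The expansion that reduces joint continuity of `u` to that of finitely many coefficients. -/
lemma IsFlow.eq_sum (h : IsFlow τp τm ζ ε ω i T u φ) (hω : IsGalerkinBasis s ω) (t : ℝ) :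
    u t = ∑ j ∈ Finset.range i, l2 (u t) (ω j) • ω j :=
  hω.eq_galerkinProj (h.mem t)

lemma IsFlow.continuous_coeff (h : IsFlow τp τm ζ ε ω i T u φ) {j : ℕ}
    (hj : j ∈ Finset.range i) : Continuous fun t => l2 (u t) (ω j) :=
  h.cont_u _ (mem_galerkinSpace ω (Finset.mem_range.1 hj))

lemma IsFlow.continuous_u (h : IsFlow τp τm ζ ε ω i T u φ) (hω : IsGalerkinBasis s ω) :
    Continuous (Function.uncurry u) := by
  have h1 : Function.uncurry u
      = fun z : ℝ × E d => ∑ j ∈ Finset.range i, l2 (u z.1) (ω j) • ω j z.2 := by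
    funext z
    conv_lhs => rw [Function.uncurry, h.eq_sum hω z.1]
    rw [Finset.sum_apply]
    rfl
  rw [h1]
  exact continuous_finsetSum _ fun j hj => ((h.continuous_coeff hj).comp continuous_fst).smul
    ((hω.contDiff j).continuous.comp continuous_snd)

lemma IsFlow.continuous_fderiv (h : IsFlow τp τm ζ ε ω i T u φ) (hω : IsGalerkinBasis s ω) :
    Continuous fun z : ℝ × E d => fderiv ℝ (u z.1) z.2 := by
  have h1 : (fun z : ℝ × E d => fderiv ℝ (u z.1) z.2)
      = fun z => ∑ j ∈ Finset.range i, l2 (u z.1) (ω j) • fderiv ℝ (ω j) z.2 := by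
    funext z
    have hd : ∀ j, DifferentiableAt ℝ (ω j) z.2 := fun j =>
      (hω.contDiff j).differentiable (by norm_num) z.2
    conv_lhs => rw [h.eq_sum hω z.1]
    rw [fderiv_sum fun j _ => (hd j).const_smul _]
    exact Finset.sum_congr rfl fun j _ => fderiv_const_smul (hd j) _
  rw [h1]
  exact continuous_finsetSum _ fun j hj => ((h.continuous_coeff hj).comp continuous_fst).smul
    (((hω.contDiff j).continuous_fderiv (by norm_num)).comp continuous_snd)

lemma IsFlow.continuous_grad (h : IsFlow τp τm ζ ε ω i T u φ) (hω : IsGalerkinBasis s ω)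
    (a b : Fin d) : Continuous fun z : ℝ × E d => grad (u z.1) z.2 a b :=
  (EuclideanSpace.proj (𝕜 := ℝ) a).continuous.comp
    ((h.continuous_fderiv hω).clm_apply continuous_const)

lemma IsFlow.continuous_symGrad (h : IsFlow τp τm ζ ε ω i T u φ) (hω : IsGalerkinBasis s ω)
    (a b : Fin d) : Continuous fun z : ℝ × E d => (symGrad (u z.1) z.2).1 a b := by
  simp only [symGrad_apply]
  have h1 := h.continuous_grad hω a b
  have h2 := h.continuous_grad hω b a
  fun_prop

lemma IsFlow.continuous_mollify (h : IsFlow τp τm ζ ε ω i T u φ) (hω : IsGalerkinBasis s ω)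
    (hζ : IsEvenKernel ζ) : Continuous fun z : ℝ × E d => mollify ζ (u z.1) z.2 := by
  have h1 : (fun z : ℝ × E d => mollify ζ (u z.1) z.2)
      = fun z => ∑ j ∈ Finset.range i, l2 (u z.1) (ω j) • mollify ζ (ω j) z.2 := by
    funext z
    conv_lhs => rw [h.eq_sum hω z.1]
    exact hζ.mollify_sum_smul (fun j => (hω.contDiff j).continuous) _ _ _
  rw [h1]
  exact continuous_finsetSum _ fun j hj => ((h.continuous_coeff hj).comp continuous_fst).smul
    ((hζ.continuous_mollify (hω.contDiff j).continuous).comp continuous_snd)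

lemma IsFlow.continuous_pderiv (h : IsFlow τp τm ζ ε ω i T u φ) (a : Fin d) :
    Continuous fun z : ℝ × E d => pderiv a (φ z.1) z.2 :=
  (h.regular.pderiv (k := 2) (by norm_num) a).continuous (by norm_num)

lemma IsFlow.continuous_phi (h : IsFlow τp τm ζ ε ω i T u φ) :
    Continuous fun z : ℝ × E d => φ z.1 z.2 :=
  h.regular.continuous (by norm_num)

lemma IsFlow.continuous_phaseRHS (h : IsFlow τp τm ζ ε ω i T u φ) (hω : IsGalerkinBasis s ω)
    (hζ : IsEvenKernel ζ) : Continuous fun z : ℝ × E d => phaseRHS ζ ε (φ z.1) (u z.1) z.2 := by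
  unfold phaseRHS
  simp only [inner_gradient_right]
  refine (h.regular.continuous_laplacian.sub
    ((continuous_deriv_W.comp h.continuous_phi).div_const _)).sub
    (continuous_finsetSum _ fun b _ => ?_)
  exact ((EuclideanSpace.proj (𝕜 := ℝ) b).continuous.comp (h.continuous_mollify hω hζ)).mul
    (h.continuous_pderiv b)

lemma IsFlow.continuous_mnorm_symGrad (h : IsFlow τp τm ζ ε ω i T u φ)
    (hω : IsGalerkinBasis s ω) (hp0 : 0 ≤ p) :
    Continuous fun z : ℝ × E d => mnorm (symGrad (u z.1) z.2).1 ^ p := by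
  simp only [mnorm_eq]
  exact (continuous_finsetSum _ fun a _ => (h.continuous_symGrad hω a.1 a.2).pow 2).sqrt.rpow_const
    fun _ => Or.inr hp0

lemma IsFlow.continuous_dissipation (h : IsFlow τp τm ζ ε ω i T u φ) (hω : IsGalerkinBasis s ω)
    (hp0 : 0 ≤ p) : Continuous fun z : ℝ × E d => dissipation ν₀ p ε (φ z.1) (u z.1) z.2 := by
  unfold dissipation
  exact (continuous_const.mul ((h.regular.continuous_laplacian.sub
    ((continuous_deriv_W.comp h.continuous_phi).div_const _)).pow 2)).add
    (continuous_const.mul (h.continuous_mnorm_symGrad hω hp0))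

lemma IsFlow.continuous_momentumRHS (h : IsFlow τp τm ζ ε ω i T u φ) (hω : IsGalerkinBasis s ω)
    (hp : IsStress ν₀ p τp) (hm : IsStress ν₀ p τm) (hζ : IsEvenKernel ζ) {v : E d → E d}
    (hv : IsSolenoidal v) : Continuous fun t => momentumRHS τp τm ζ ε (φ t) (u t) v := by
  have hV := hζ.isSolenoidal_mollify hv
  have hφ1 : ∀ t, ContDiff ℝ 1 (φ t) := fun t => (h.regular.contDiff t).of_le (by norm_num)
  unfold momentumRHS
  simp only [hζ.integral_capillary hv (hφ1 _) (h.periodic _)]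
  refine ((continuous_cell_integral ?_).neg.sub (continuous_cell_integral ?_)).add
    (continuous_const.mul (continuous_cell_integral ?_))
  · simp only [Function.uncurry_def, ddot_eq_sum]
    exact continuous_finsetSum _ fun a _ =>
      (continuous_mixStress hp hm (h.continuous_symGrad hω) h.continuous_phi a.1 a.2).mul
        ((continuous_symGrad_apply hv.contDiff a.2 a.1).comp continuous_snd)
  · exact ((h.continuous_fderiv hω).clm_apply (h.continuous_u hω)).inner
      (hv.contDiff.continuous.comp continuous_snd)
  · exact continuous_finsetSum _ fun a _ =>
      ((h.continuous_pderiv a.1).mul (h.continuous_pderiv a.2)).mul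
        ((continuous_grad_apply hV.contDiff a.2 a.1).comp continuous_snd)

/-- An equation integrated in time holds pointwise at interior times. -/
lemma hasDerivAt_of_eq_add_integral {f g : ℝ → ℝ} (hg : Continuous g)
    (hf : ∀ t ∈ Set.Icc 0 T, f t = f 0 + ∫ r in (0 : ℝ)..t, g r) {t : ℝ} (ht : t ∈ Set.Ioo 0 T) :
    HasDerivAt f (g t) t := by
  have h1 : HasDerivAt (fun t => f 0 + ∫ r in (0 : ℝ)..t, g r) (g t) t :=
    (intervalIntegral.integral_hasDerivAt_right (hg.intervalIntegrable _ _)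
      (hg.stronglyMeasurableAtFilter _ _) hg.continuousAt).const_add _
  refine h1.congr_of_eventuallyEq ?_
  filter_upwards [Ioo_mem_nhds ht.1 ht.2] with r hr using hf r ⟨hr.1.le, hr.2.le⟩

/-- The momentum equation may be tested with the solution itself. -/
lemma IsFlow.hasDerivAt_l2_self (h : IsFlow τp τm ζ ε ω i T u φ) (hω : IsGalerkinBasis s ω)
    (hp : IsStress ν₀ p τp) (hm : IsStress ν₀ p τm) (hζ : IsEvenKernel ζ) {t : ℝ}
    (ht : t ∈ Set.Ioo 0 T) :
    HasDerivAt (fun r => l2 (u r) (u r)) (2 * momentumRHS τp τm ζ ε (φ t) (u t) (u t)) t := by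
  have hd : ∀ v ∈ galerkinSpace ω i, HasDerivAt (fun r => l2 (u r) v)
      (momentumRHS τp τm ζ ε (φ t) (u t) v) t := fun v hv =>
    hasDerivAt_of_eq_add_integral
      (h.continuous_momentumRHS hω hp hm hζ (hω.isSolenoidal_of_mem hv))
      (fun r hr => h.momentum r hr v hv) ht
  have hj : ∀ j ∈ Finset.range i, HasDerivAt (fun r => l2 (u r) (ω j))
      (momentumRHS τp τm ζ ε (φ t) (u t) (ω j)) t := fun j hj =>
    hd _ (mem_galerkinSpace ω (Finset.mem_range.1 hj))
  -- with the test field frozen at time `t`, the two expressions for the derivative agree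
  have h1 : HasDerivAt (fun r => l2 (u r) (u t))
      (∑ j ∈ Finset.range i, momentumRHS τp τm ζ ε (φ t) (u t) (ω j) * l2 (u t) (ω j)) t := by
    simp only [fun r => hω.l2_eq_sum (h.mem r) (h.mem t)]
    exact HasDerivAt.fun_sum fun j hj' => (hj j hj').mul_const _
  have h2 := h1.unique (hd _ (h.mem t))
  have h3 : HasDerivAt (fun r => ∑ j ∈ Finset.range i, l2 (u r) (ω j) * l2 (u r) (ω j))
      (∑ j ∈ Finset.range i, (momentumRHS τp τm ζ ε (φ t) (u t) (ω j) * l2 (u t) (ω j)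
        + l2 (u t) (ω j) * momentumRHS τp τm ζ ε (φ t) (u t) (ω j))) t :=
    HasDerivAt.fun_sum fun j hj' => (hj j hj').fun_mul (hj j hj')
  simp only [fun r => hω.l2_eq_sum (h.mem r) (h.mem r)]
  refine h3.congr_deriv ?_
  rw [← h2, Finset.mul_sum]
  exact Finset.sum_congr rfl fun j _ => by ring

lemma IsFlow.mono (h : IsFlow τp τm ζ ε ω i T u φ) {S : ℝ} (hS : S ≤ T) :
    IsFlow τp τm ζ ε ω i S u φ :=
  { h with
    momentum := fun t ht => h.momentum t ⟨ht.1, ht.2.trans hS⟩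
    phase := fun t ht => h.phase t ⟨ht.1, ht.2.trans hS⟩ }

lemma energy_eq {f : E d → ℝ} {v : E d → E d} (hf : ContDiff ℝ 1 f) (hv : Continuous v) :
    energy ε f v = 1 / σ * (ε / 2 * (∫ x in cell d, ∑ a, pderiv a f x ^ 2)
      + 1 / ε * ∫ x in cell d, W (f x)) + 1 / 2 * l2 v v := by
  have i1 : Integrable (fun x => ∑ a, pderiv a f x ^ 2) (volume.restrict (cell d)) :=
    integrable_cell (continuous_finsetSum _ fun a _ => (TwoPhase.continuous_pderiv hf a).pow 2)
  have i2 : Integrable (fun x => W (f x)) (volume.restrict (cell d)) :=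
    integrable_cell (contDiff_W.continuous.comp hf.continuous)
  have i3 : Integrable (fun x => inner ℝ (v x) (v x)) (volume.restrict (cell d)) :=
    integrable_cell (hv.inner hv)
  have i4 : Integrable (fun x => 1 / σ * (ε / 2 * ∑ a, pderiv a f x ^ 2 + 1 / ε * W (f x)))
      (volume.restrict (cell d)) := ((i1.const_mul _).add (i2.const_mul _)).const_mul _
  unfold energy l2
  rw [← integral_const_mul, ← integral_const_mul, ← integral_const_mul,
    ← integral_add (i1.const_mul _) (i2.const_mul _), ← integral_const_mul,
    ← integral_add i4 (i3.const_mul _)]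
  congr 1; funext x
  simp only [norm_gradient_sq, real_inner_self_eq_norm_sq]
  ring

lemma IsFlow.hasDerivAt_phi (h : IsFlow τp τm ζ ε ω i T u φ) (hω : IsGalerkinBasis s ω)
    (hζ : IsEvenKernel ζ) {t : ℝ} (ht : t ∈ Set.Ioo 0 T) (x : E d) :
    HasDerivAt (fun r => φ r x) (phaseRHS ζ ε (φ t) (u t) x) t := by
  have h1 : Continuous fun r : ℝ => (r, x) := by fun_prop
  have h2 := (h.continuous_phaseRHS hω hζ).comp h1
  simp only [Function.comp_def] at h2
  exact hasDerivAt_of_eq_add_integral h2 (fun r hr => h.phase r hr x) ht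

lemma IsFlow.hasDerivAt_potential (h : IsFlow τp τm ζ ε ω i T u φ) (hω : IsGalerkinBasis s ω)
    (hζ : IsEvenKernel ζ) {t : ℝ} (ht : t ∈ Set.Ioo 0 T) :
    HasDerivAt (fun r => ∫ x in cell d, W (φ r x))
      (∫ x in cell d, deriv W (φ t x) * phaseRHS ζ ε (φ t) (u t) x) t := by
  refine hasDerivAt_cell_integral (f := fun r x => W (φ r x))
    (f' := fun r x => deriv W (φ r x) * phaseRHS ζ ε (φ r) (u r) x) (Ioo_mem_nhds ht.1 ht.2)
    (fun r => contDiff_W.continuous.comp (h.regular.contDiff r).continuous)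
    ((continuous_deriv_W.comp h.continuous_phi).mul (h.continuous_phaseRHS hω hζ))
    fun r hr x => ?_
  rw [(hasDerivAt_W (φ r x)).deriv]
  exact (hasDerivAt_W (φ r x)).comp r (h.hasDerivAt_phi hω hζ hr x)

/-- The first factor in the integral is the variational derivative of the surface energy. -/
lemma IsFlow.hasDerivAt_energy (h : IsFlow τp τm ζ ε ω i T u φ) (hω : IsGalerkinBasis s ω)
    (hp : IsStress ν₀ p τp) (hm : IsStress ν₀ p τm) (hζ : IsEvenKernel ζ) {t : ℝ}
    (ht : t ∈ Set.Ioo 0 T) :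
    HasDerivAt (fun r => energy ε (φ r) (u r))
      (1 / σ * (∫ x in cell d, (-(ε * Laplacian.laplacian (φ t) x) + deriv W (φ t x) / ε)
          * phaseRHS ζ ε (φ t) (u t) x)
        + momentumRHS τp τm ζ ε (φ t) (u t) (u t)) t := by
  have hF := h.continuous_phaseRHS hω hζ
  have hC2 : ContDiff ℝ 2 (φ t) := (h.regular.contDiff t).of_le (by norm_num)
  have hφt : ∀ r, Continuous (φ r) := fun r => (h.regular.contDiff r).continuous
  have hct : Continuous fun x : E d => (t, x) := by fun_prop
  have hFt := hF.comp hct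
  simp only [Function.comp_def] at hFt
  have h1 := h.regular.hasDerivAt_dirichlet h.periodic (F := fun r => phaseRHS ζ ε (φ r) (u r))
    hF (Ioo_mem_nhds ht.1 ht.2) fun r hr x => h.hasDerivAt_phi hω hζ hr x
  have h2 := h.hasDerivAt_potential hω hζ ht
  have h3 := h.hasDerivAt_l2_self hω hp hm hζ ht
  have e1 : (fun r => energy ε (φ r) (u r)) = fun r => 1 / σ * (ε / 2 *
      (∫ x in cell d, ∑ a, pderiv a (φ r) x ^ 2) + 1 / ε * ∫ x in cell d, W (φ r x))
      + 1 / 2 * l2 (u r) (u r) := funext fun r =>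
    energy_eq ((h.regular.contDiff r).of_le (by norm_num)) (h.isSolenoidal hω r).contDiff.continuous
  rw [e1]
  refine ((((h1.const_mul (ε / 2)).fun_add (h2.const_mul (1 / ε))).const_mul (1 / σ)).fun_add
    (h3.const_mul (1 / 2))).congr_deriv ?_
  have i1 : Integrable (fun x => Laplacian.laplacian (φ t) x * phaseRHS ζ ε (φ t) (u t) x)
      (volume.restrict (cell d)) := integrable_cell ((continuous_laplacian hC2).mul hFt)
  have i2 : Integrable (fun x => deriv W (φ t x) * phaseRHS ζ ε (φ t) (u t) x)
      (volume.restrict (cell d)) :=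
    integrable_cell ((continuous_deriv_W.comp (hφt t)).mul hFt)
  have e2 : ∫ x in cell d, (-(ε * Laplacian.laplacian (φ t) x) + deriv W (φ t x) / ε)
        * phaseRHS ζ ε (φ t) (u t) x
      = -ε * (∫ x in cell d, Laplacian.laplacian (φ t) x * phaseRHS ζ ε (φ t) (u t) x)
        + 1 / ε * ∫ x in cell d, deriv W (φ t x) * phaseRHS ζ ε (φ t) (u t) x := by
    rw [← integral_const_mul, ← integral_const_mul,
      ← integral_add (i1.const_mul _) (i2.const_mul _)]
    congr 1; funext x
    ring
  rw [e2]
  ring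

lemma IsFlow.continuous_energy (h : IsFlow τp τm ζ ε ω i T u φ) (hω : IsGalerkinBasis s ω) :
    Continuous fun t => energy ε (φ t) (u t) := by
  unfold energy
  refine continuous_cell_integral ?_
  simp only [Function.uncurry_def, norm_gradient_sq]
  have hu : Continuous fun z : ℝ × E d => u z.1 z.2 := h.continuous_u hω
  exact (continuous_const.mul ((((continuous_const.mul (continuous_finsetSum _ fun a _ =>
    (h.continuous_pderiv a).pow 2)).div_const _)).add
    ((contDiff_W.continuous.comp h.continuous_phi).div_const _))).add
    ((hu.norm.pow 2).div_const _)

theorem IsFlow.energy_le (h : IsFlow τp τm ζ ε ω i T u φ) (hω : IsGalerkinBasis s ω)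
    (hp : IsStress ν₀ p τp) (hm : IsStress ν₀ p τm) (hp0 : 0 ≤ p) (hε : 0 < ε)
    (hζ : IsEvenKernel ζ) (hT : 0 ≤ T) :
    energy ε (φ T) (u T) + ∫ t in (0 : ℝ)..T, ∫ x in cell d, dissipation ν₀ p ε (φ t) (u t) x
      ≤ energy ε (φ 0) (u 0) := by
  have hD : Continuous fun t => ∫ x in cell d, dissipation ν₀ p ε (φ t) (u t) x :=
    continuous_cell_integral (h.continuous_dissipation hω hp0)
  have h1 := intervalIntegral.sub_le_integral_of_hasDeriv_right_of_le hT
    (h.continuous_energy hω).continuousOn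
    (fun t ht => (h.hasDerivAt_energy hω hp hm hζ ht).hasDerivWithinAt)
    hD.neg.continuousOn.integrableOn_Icc
    (fun t _ => energy_rate_le hp hm hp0 hε hζ (h.isSolenoidal hω t)
      ((h.regular.contDiff t).of_le (by norm_num)) (h.periodic t) (h.abs_le t))
  simp only [Pi.neg_apply, intervalIntegral.integral_neg] at h1
  linarith

end Flow

/-! ### Weak solutions -/

section WeakSolution

variable {d : ℕ} {τp τm : Sym d → Sym d} {ζ φ₀ : E d → ℝ} {ε ν₀ p T : ℝ} {ω : ℕ → E d → E d}
  {i s : ℕ} {u₀ : E d → E d} {u : ℝ → E d → E d} {φ : ℝ → E d → ℝ}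

/-- The projection of a time onto `[0,T]`. -/
noncomputable def clamp (T t : ℝ) : ℝ := max 0 (min t T)

lemma clamp_mem (hT : 0 ≤ T) (t : ℝ) : clamp T t ∈ Set.Icc 0 T :=
  ⟨le_max_left _ _, max_le hT (min_le_right _ _)⟩

lemma clamp_of_mem {t : ℝ} (ht : t ∈ Set.Icc 0 T) : clamp T t = t := by
  rw [clamp, min_eq_left ht.2, max_eq_right ht.1]

lemma continuous_clamp (T : ℝ) : Continuous (clamp T) := by
  unfold clamp
  fun_prop

lemma IsWeakSolution.phi_zero (h : IsWeakSolution τp τm ζ ε ω i u₀ φ₀ T u φ) (hT : 0 ≤ T) :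
    φ 0 = φ₀ := by
  funext x
  simpa using h.phase 0 ⟨le_rfl, hT⟩ x

lemma IsWeakSolution.u_zero (h : IsWeakSolution τp τm ζ ε ω i u₀ φ₀ T u φ)
    (hω : IsGalerkinBasis s ω) (hT : 0 ≤ T) : u 0 = galerkinProj ω i u₀ := by
  have h0 : (0 : ℝ) ∈ Set.Icc 0 T := ⟨le_rfl, hT⟩
  rw [hω.eq_galerkinProj (h.mem 0 h0), hω.eq_galerkinProj (galerkinProj_mem ω i u₀)]
  refine Finset.sum_congr rfl fun j hj => ?_
  have h1 := h.momentum 0 h0 _ (mem_galerkinSpace ω (Finset.mem_range.1 hj))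
  rw [intervalIntegral.integral_same, add_zero] at h1
  rw [h1]

/-- A weak solution on `[0,T]` extends to all times, being frozen outside `[0,T]`. -/
lemma IsWeakSolution.isFlow (h : IsWeakSolution τp τm ζ ε ω i u₀ φ₀ T u φ)
    (hω : IsGalerkinBasis s ω) (hT : 0 ≤ T) :
    IsFlow τp τm ζ ε ω i T (fun t => u (clamp T t)) (fun t => φ (clamp T t)) where
  mem t := h.mem _ (clamp_mem hT t)
  cont_u v hv := (h.cont_u v hv).comp_continuous (continuous_clamp T) (clamp_mem hT)
  regular := by
    obtain ⟨M, hM⟩ := h.bound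
    exact ⟨fun t => h.contDiff _ (clamp_mem hT t),
      ⟨M, fun t x j hj => hM _ (clamp_mem hT t) x j hj⟩,
      fun x => (h.cont_phi x).comp_continuous (continuous_clamp T) (clamp_mem hT)⟩
  periodic t := h.periodic _ (clamp_mem hT t)
  abs_le t := h.abs_le _ (clamp_mem hT t)
  momentum t ht v hv := by
    have h1 : clamp T 0 = 0 := clamp_of_mem ⟨le_rfl, hT⟩
    simp only [h1, clamp_of_mem ht, h.u_zero hω hT]
    rw [h.momentum t ht v hv]
    congr 1
    refine intervalIntegral.integral_congr fun r hr => ?_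
    rw [Set.uIcc_of_le ht.1] at hr
    simp only [clamp_of_mem (⟨hr.1, hr.2.trans ht.2⟩ : r ∈ Set.Icc 0 T)]
  phase t ht x := by
    have h1 : clamp T 0 = 0 := clamp_of_mem ⟨le_rfl, hT⟩
    simp only [h1, clamp_of_mem ht, h.phi_zero hT]
    rw [h.phase t ht x]
    congr 1
    refine intervalIntegral.integral_congr fun r hr => ?_
    rw [Set.uIcc_of_le ht.1] at hr
    simp only [clamp_of_mem (⟨hr.1, hr.2.trans ht.2⟩ : r ∈ Set.Icc 0 T), phaseRHS]

theorem IsWeakSolution.energy_le (h : IsWeakSolution τp τm ζ ε ω i u₀ φ₀ T u φ)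
    (hω : IsGalerkinBasis s ω) (hp : IsStress ν₀ p τp) (hm : IsStress ν₀ p τm) (hp0 : 0 ≤ p)
    (hε : 0 < ε) (hζ : IsEvenKernel ζ) (hT : 0 ≤ T) :
    energy ε (φ T) (u T) + ∫ t in (0 : ℝ)..T, ∫ x in cell d, dissipation ν₀ p ε (φ t) (u t) x
      ≤ energy ε φ₀ (galerkinProj ω i u₀) := by
  have h1 := (h.isFlow hω hT).energy_le hω hp hm hp0 hε hζ hT
  have h2 : ∫ t in (0 : ℝ)..T, ∫ x in cell d,
        dissipation ν₀ p ε (φ (clamp T t)) (u (clamp T t)) x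
      = ∫ t in (0 : ℝ)..T, ∫ x in cell d, dissipation ν₀ p ε (φ t) (u t) x := by
    refine intervalIntegral.integral_congr fun r hr => ?_
    rw [Set.uIcc_of_le hT] at hr
    simp only [clamp_of_mem hr]
  rw [h2, clamp_of_mem ⟨hT, le_rfl⟩, clamp_of_mem ⟨le_rfl, hT⟩, h.phi_zero hT, h.u_zero hω hT] at h1
  exact h1

lemma IsWeakSolution.integrableOn_dissipation (h : IsWeakSolution τp τm ζ ε ω i u₀ φ₀ T u φ)
    (hω : IsGalerkinBasis s ω) (hp0 : 0 ≤ p) (hT : 0 ≤ T) :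
    IntegrableOn (fun z : ℝ × E d => dissipation ν₀ p ε (φ z.1) (u z.1) z.2)
      (Set.Icc 0 T ×ˢ cell d) := by
  have h1 := integrable_prod_Icc_cell
    ((h.isFlow hω hT).continuous_dissipation (ν₀ := ν₀) hω hp0) 0 T
  rw [Measure.prod_restrict] at h1
  refine IntegrableOn.congr_fun h1 (fun z hz => ?_) (measurableSet_Icc.prod measurableSet_cell)
  simp only [clamp_of_mem hz.1]

end WeakSolution

/-! ### The velocity bound in `W^{1,p}` -/

section Velocity

variable {d : ℕ}

lemma σ_nonneg : 0 ≤ σ :=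
  intervalIntegral.integral_nonneg (by norm_num) fun _ _ => Real.sqrt_nonneg _

lemma energy_nonneg {ε : ℝ} (hε : 0 < ε) (f : E d → ℝ) (v : E d → E d) : 0 ≤ energy ε f v := by
  refine integral_nonneg fun x => ?_
  have h1 := σ_nonneg
  have h2 := W_nonneg (f x)
  positivity

lemma dissipation_ge {ν₀ p ε : ℝ} (hε : 0 < ε) (f : E d → ℝ) (v : E d → E d) (x : E d) :
    ν₀ * mnorm (symGrad v x).1 ^ p ≤ dissipation ν₀ p ε f v x := by
  have h1 := σ_nonneg
  have h2 : 0 ≤ ε / σ * (Laplacian.laplacian f x - deriv W (f x) / ε ^ 2) ^ 2 := by positivity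
  unfold dissipation
  linarith

lemma half_l2_le_energy {ε : ℝ} (hε : 0 < ε) {f : E d → ℝ} {v : E d → E d} (hf : ContDiff ℝ 1 f)
    (hv : Continuous v) : 1 / 2 * l2 v v ≤ energy ε f v := by
  rw [energy_eq hf hv]
  have h1 := σ_nonneg
  have h2 : 0 ≤ ∫ x in cell d, ∑ a, pderiv a f x ^ 2 := integral_nonneg fun x =>
    Finset.sum_nonneg fun a _ => sq_nonneg _
  have h3 : 0 ≤ ∫ x in cell d, W (f x) := integral_nonneg fun x => W_nonneg _
  have h4 : 0 ≤ 1 / σ * (ε / 2 * (∫ x in cell d, ∑ a, pderiv a f x ^ 2)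
      + 1 / ε * ∫ x in cell d, W (f x)) := by positivity
  linarith

/-- The `L¹` norm on the unit cell is bounded by the `L²` norm. -/
lemma l1_rpow_le {p : ℝ} (hp : 0 ≤ p) {v : E d → E d} (hv : Continuous v) :
    (∫ x in cell d, ‖v x‖) ^ p ≤ l2 v v ^ (p / 2) := by
  have h0 : 0 ≤ ∫ x in cell d, ‖v x‖ := integral_nonneg fun x => norm_nonneg _
  have h1 : (∫ x in cell d, ‖v x‖) ^ (2 : ℝ) ≤ l2 v v := by
    unfold l2
    simp only [real_inner_self_eq_norm_sq, ← Real.rpow_two]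
    exact rpow_integral_le (by norm_num) (fun x => norm_nonneg _) (integrable_cell hv.norm)
      (integrable_cell (hv.norm.rpow_const fun _ => Or.inr (by norm_num)))
  calc (∫ x in cell d, ‖v x‖) ^ p = ((∫ x in cell d, ‖v x‖) ^ (2 : ℝ)) ^ (p / 2) := by
        rw [← Real.rpow_mul h0]; congr 1; ring
    _ ≤ _ := Real.rpow_le_rpow (Real.rpow_nonneg h0 _) h1 (by linarith)

lemma IsKornConstant.mono {p c c' : ℝ} (h : IsKornConstant d p c) (hc : c ≤ c') :
    IsKornConstant d p c' := by
  intro v hv hvp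
  refine (h v hv hvp).trans (mul_le_mul_of_nonneg_right hc (add_nonneg ?_ ?_))
  · exact integral_nonneg fun x => Real.rpow_nonneg (mnorm_nonneg _) _
  · exact Real.rpow_nonneg (integral_nonneg fun x => norm_nonneg _) _

variable {τp τm : Sym d → Sym d} {ζ : E d → ℝ} {ε ν₀ p T : ℝ} {ω : ℕ → E d → E d} {i s : ℕ}
  {u : ℝ → E d → E d} {φ : ℝ → E d → ℝ}

lemma IsFlow.continuous_w1pNormPow (h : IsFlow τp τm ζ ε ω i T u φ) (hω : IsGalerkinBasis s ω)
    (hp0 : 0 ≤ p) : Continuous fun t => w1pNormPow p (u t) := by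
  unfold w1pNormPow
  refine continuous_cell_integral ?_
  simp only [Function.uncurry_def, mnorm_eq]
  exact ((h.continuous_u hω).norm.rpow_const fun _ => Or.inr hp0).add
    ((continuous_finsetSum _ fun a _ => (h.continuous_grad hω a.1 a.2).pow 2).sqrt.rpow_const
      fun _ => Or.inr hp0)

/-- The kinetic energy bounds the `L¹` norm at each time, the dissipation bounds the strain, and
Korn's inequality combines the two. -/
theorem IsFlow.integral_w1pNormPow_le (h : IsFlow τp τm ζ ε ω i T u φ)
    (hω : IsGalerkinBasis s ω) (hp : IsStress ν₀ p τp) (hm : IsStress ν₀ p τm) (hp0 : 0 ≤ p)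
    (hε : 0 < ε) (hζ : IsEvenKernel ζ) (hν : 0 < ν₀) {c A : ℝ} (hc0 : 0 ≤ c)
    (hc : IsKornConstant d p c) (hA : energy ε (φ 0) (u 0) ≤ A) {T₁ T₂ : ℝ} (h1 : 0 ≤ T₁)
    (h12 : T₁ ≤ T₂) (h2 : T₂ ≤ T) :
    ∫ t in T₁..T₂, w1pNormPow p (u t) ≤ c * (ν₀⁻¹ * A + (T₂ - T₁) * (2 * A) ^ (p / 2)) := by
  set D : ℝ → ℝ := fun t => ∫ x in cell d, dissipation ν₀ p ε (φ t) (u t) x with hD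
  set S : ℝ → ℝ := fun t => ∫ x in cell d, mnorm (symGrad (u t) x).1 ^ p with hS
  have hDc : Continuous D := continuous_cell_integral (h.continuous_dissipation hω hp0)
  have hSc : Continuous S := continuous_cell_integral (h.continuous_mnorm_symGrad hω hp0)
  have hSD : ∀ t, ν₀ * S t ≤ D t := by
    intro t
    have hct : Continuous fun x : E d => (t, x) := by fun_prop
    have i1 := (h.continuous_mnorm_symGrad hω hp0).comp hct
    have i2 := (h.continuous_dissipation (ν₀ := ν₀) hω hp0).comp hct
    simp only [Function.comp_def] at i1 i2
    rw [hS, hD]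
    simp only
    rw [← integral_const_mul]
    exact integral_mono ((integrable_cell i1).const_mul _) (integrable_cell i2)
      fun x => dissipation_ge hε _ _ x
  have hS0 : ∀ t, 0 ≤ S t := fun t =>
    integral_nonneg fun x => Real.rpow_nonneg (mnorm_nonneg _) _
  have hD0 : ∀ t, 0 ≤ D t := fun t => (mul_nonneg hν.le (hS0 t)).trans (hSD t)
  have hen : ∀ t ∈ Set.Icc 0 T, energy ε (φ t) (u t) + ∫ r in (0 : ℝ)..t, D r ≤ A := fun t ht =>
    ((h.mono ht.2).energy_le hω hp hm hp0 hε hζ ht.1).trans hA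
  have hl2 : ∀ t ∈ Set.Icc T₁ T₂, l2 (u t) (u t) ≤ 2 * A := by
    intro t ht
    have ht0 : 0 ≤ t := h1.trans ht.1
    have e1 := hen t ⟨ht0, ht.2.trans h2⟩
    have e2 : 0 ≤ ∫ r in (0 : ℝ)..t, D r := intervalIntegral.integral_nonneg ht0 fun r _ => hD0 r
    have e3 := half_l2_le_energy (f := φ t) hε ((h.regular.contDiff t).of_le (by norm_num))
      (h.isSolenoidal hω t).contDiff.continuous
    linarith
  have hSint : ∫ t in T₁..T₂, S t ≤ ν₀⁻¹ * A := by
    have e1 := hen T₂ ⟨h1.trans h12, h2⟩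
    have e2 := energy_nonneg hε (φ T₂) (u T₂)
    have e3 : ∫ t in T₁..T₂, D t ≤ ∫ t in (0 : ℝ)..T₂, D t :=
      intervalIntegral.integral_mono_interval h1 h12 le_rfl
        (Eventually.of_forall hD0) (hDc.intervalIntegrable _ _)
    have e4 : ∫ t in T₁..T₂, ν₀ * S t ≤ ∫ t in T₁..T₂, D t :=
      intervalIntegral.integral_mono_on h12 ((hSc.const_mul _).intervalIntegrable _ _)
        (hDc.intervalIntegrable _ _) fun t _ => hSD t
    rw [intervalIntegral.integral_const_mul] at e4
    rw [le_inv_mul_iff₀ hν]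
    linarith
  have hkorn : ∀ t ∈ Set.Icc T₁ T₂, w1pNormPow p (u t) ≤ c * (S t + (2 * A) ^ (p / 2)) := by
    intro t ht
    have hu := h.isSolenoidal hω t
    have hl20 : 0 ≤ l2 (u t) (u t) := integral_nonneg fun x => real_inner_self_nonneg
    refine (hc (u t) hu.contDiff hu.periodic).trans (mul_le_mul_of_nonneg_left ?_ hc0)
    exact add_le_add le_rfl ((l1_rpow_le hp0 hu.contDiff.continuous).trans
      (Real.rpow_le_rpow hl20 (hl2 t ht) (by linarith)))
  have hfin : ∫ t in T₁..T₂, c * (S t + (2 * A) ^ (p / 2))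
      = c * ((∫ t in T₁..T₂, S t) + (T₂ - T₁) * (2 * A) ^ (p / 2)) := by
    rw [intervalIntegral.integral_const_mul, intervalIntegral.integral_add
      (hSc.intervalIntegrable _ _) intervalIntegrable_const, intervalIntegral.integral_const,
      smul_eq_mul]
  calc ∫ t in T₁..T₂, w1pNormPow p (u t)
      ≤ ∫ t in T₁..T₂, c * (S t + (2 * A) ^ (p / 2)) :=
        intervalIntegral.integral_mono_on h12
          ((h.continuous_w1pNormPow hω hp0).intervalIntegrable _ _)
          ((continuous_const.mul (hSc.add continuous_const)).intervalIntegrable _ _) hkorn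
    _ ≤ _ := by
        rw [hfin]
        exact mul_le_mul_of_nonneg_left (add_le_add hSint le_rfl) hc0

variable {φ₀ : E d → ℝ} {u₀ : E d → E d}

/-- The bound for a constant in which the factor `2` is absorbed, so that the right-hand side depends
on the energy bound `A` continuously and has the form required of the limit. -/
theorem IsWeakSolution.integral_w1pNormPow_le
    (h : IsWeakSolution τp τm ζ ε ω i u₀ φ₀ T u φ)
    (hω : IsGalerkinBasis s ω) (hp : IsStress ν₀ p τp) (hm : IsStress ν₀ p τm) (hp0 : 0 ≤ p)
    (hε : 0 < ε) (hζ : IsEvenKernel ζ) (hν : 0 < ν₀) {c A : ℝ} (hc0 : 0 ≤ c)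
    (hc : IsKornConstant d p c) (hA : energy ε φ₀ (galerkinProj ω i u₀) ≤ A) {T₁ T₂ : ℝ}
    (h1 : 0 ≤ T₁) (h12 : T₁ ≤ T₂) (h2 : T₂ ≤ T) :
    IntervalIntegrable (fun t => w1pNormPow p (u t)) volume T₁ T₂ ∧
      ∫ t in T₁..T₂, w1pNormPow p (u t)
        ≤ 2 ^ (p / 2) * c * (ν₀⁻¹ * A + (T₂ - T₁) * A ^ (p / 2)) := by
  have hT : 0 ≤ T := h1.trans (h12.trans h2)
  have hflow := h.isFlow hω hT
  have hcong : Set.EqOn (fun t => w1pNormPow p (u (clamp T t))) (fun t => w1pNormPow p (u t))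
      (Set.uIcc T₁ T₂) := by
    intro t ht
    rw [Set.uIcc_of_le h12] at ht
    simp only [clamp_of_mem (⟨h1.trans ht.1, ht.2.trans h2⟩ : t ∈ Set.Icc 0 T)]
  have hA0 : 0 ≤ A := (energy_nonneg hε _ _).trans hA
  have h2p : (1 : ℝ) ≤ 2 ^ (p / 2) := Real.one_le_rpow (by norm_num) (by linarith)
  refine ⟨((hflow.continuous_w1pNormPow hω hp0).intervalIntegrable T₁ T₂).congr
    (hcong.mono Set.uIoc_subset_uIcc), ?_⟩
  have h3 := hflow.integral_w1pNormPow_le hω hp hm hp0 hε hζ hν hc0 hc (A := A)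
    (by rwa [clamp_of_mem ⟨le_rfl, hT⟩, h.phi_zero hT, h.u_zero hω hT]) h1 h12 h2
  rw [intervalIntegral.integral_congr hcong] at h3
  refine h3.trans ?_
  rw [Real.mul_rpow (by norm_num) hA0, mul_comm (2 ^ (p / 2)) c, mul_assoc]
  refine mul_le_mul_of_nonneg_left ?_ hc0
  have h4 : ν₀⁻¹ * A ≤ 2 ^ (p / 2) * (ν₀⁻¹ * A) :=
    le_mul_of_one_le_left (by positivity) h2p
  rw [mul_add]
  refine add_le_add h4 (le_of_eq (by ring))

end Velocity

end TwoPhase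

theorem mainTheorem3 (d : ℕ) (hd : d = 2 ∨ d = 3) (p : ℝ) (hp : ((d : ℝ) + 2) / 2 < p) :
    ∃ cK : ℝ, TwoPhase.IsKornConstant d p cK ∧
      ∀ (ν₀ : ℝ) (_ : 0 < ν₀) (τp τm : TwoPhase.Sym d → TwoPhase.Sym d)
        (_ : TwoPhase.IsStress ν₀ p τp) (_ : TwoPhase.IsStress ν₀ p τm)
        (ε : ℕ → ℝ) (_ : ∀ i, 0 < ε i) (_ : Tendsto ε atTop (𝓝 0))
        (ζ : TwoPhase.E d → ℝ) (_ : TwoPhase.IsKernel ζ) (γ : ℝ) (_ : 0 < γ) (_ : γ < 1 / 2)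
        (s : ℕ) (_ : (d : ℝ) / 2 + 1 < s)
        (ω : ℕ → TwoPhase.E d → TwoPhase.E d) (_ : TwoPhase.IsGalerkinBasis s ω)
        (u₀ : TwoPhase.E d → TwoPhase.E d) (_ : TwoPhase.InV 0 2 u₀)
        (Ωp : Set (TwoPhase.E d)) (_ : TwoPhase.IsC1Domain Ωp)
        (φ₀ : ℕ → TwoPhase.E d → ℝ)
        (_ : ∀ i, ContDiff ℝ 3 (φ₀ i) ∧ TwoPhase.Periodic (φ₀ i) ∧ ∀ x, |φ₀ i x| ≤ 1)
        (_ : ∃ o : ℕ → ℝ, Tendsto o atTop (𝓝 0) ∧ ∀ i,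
          TwoPhase.energy (ε i) (φ₀ i) (TwoPhase.galerkinProj ω i u₀) ≤ TwoPhase.E₀ Ωp u₀ + o i),
        (∃ o : ℕ → ℝ, Tendsto o atTop (𝓝 0) ∧
          ∀ (i : ℕ) (T : ℝ) (_ : 0 ≤ T)
            (u : ℝ → TwoPhase.E d → TwoPhase.E d) (φ : ℝ → TwoPhase.E d → ℝ)
            (_ : TwoPhase.IsWeakSolution τp τm (TwoPhase.scaledKernel ζ γ (ε i)) (ε i) ω i u₀ (φ₀ i)
              T u φ),
            IntegrableOn
              (fun z : ℝ × TwoPhase.E d => TwoPhase.dissipation ν₀ p (ε i) (φ z.1) (u z.1) z.2)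
              (Set.Icc 0 T ×ˢ TwoPhase.cell d) ∧
            TwoPhase.energy (ε i) (φ T) (u T) +
              ∫ t in (0 : ℝ)..T, ∫ x in TwoPhase.cell d,
                TwoPhase.dissipation ν₀ p (ε i) (φ t) (u t) x
              ≤ TwoPhase.E₀ Ωp u₀ + o i) ∧
        (∀ T₁ T₂ : ℝ, 0 ≤ T₁ → T₁ < T₂ → ∃ o : ℕ → ℝ, Tendsto o atTop (𝓝 0) ∧
          ∀ (i : ℕ) (T : ℝ) (_ : T₂ ≤ T)
            (u : ℝ → TwoPhase.E d → TwoPhase.E d) (φ : ℝ → TwoPhase.E d → ℝ)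
            (_ : TwoPhase.IsWeakSolution τp τm (TwoPhase.scaledKernel ζ γ (ε i)) (ε i) ω i u₀ (φ₀ i)
              T u φ),
            IntervalIntegrable (fun t => TwoPhase.w1pNormPow p (u t)) volume T₁ T₂ ∧
            ∫ t in T₁..T₂, TwoPhase.w1pNormPow p (u t) ≤
              cK * (ν₀⁻¹ * TwoPhase.E₀ Ωp u₀ + (T₂ - T₁) * TwoPhase.E₀ Ωp u₀ ^ (p / 2)) + o i) := by
  have hp2 : 2 < p := by
    have : (2 : ℝ) ≤ d := by rcases hd with rfl | rfl <;> norm_num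
    linarith
  have hp0 : 0 ≤ p := by linarith
  obtain ⟨c, hc0, hc⟩ := TwoPhase.exists_isKornConstant d hp2
  -- the factor absorbs the `2` in `‖u‖_{L²}² ≤ 2 E`
  refine ⟨2 ^ (p / 2) * c, hc.mono (le_mul_of_one_le_left hc0
    (Real.one_le_rpow (by norm_num) (by linarith))), ?_⟩
  intro ν₀ hν τp τm hτp hτm ε hε _ ζ hζ γ _ _ s _ ω hω u₀ _ Ωp _ φ₀ _ ho
  obtain ⟨o, ho, hoE⟩ := ho
  have hk := fun i => hζ.isEvenKernel_scaledKernel γ (hε i)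
  refine ⟨⟨o, ho, fun i T hT u φ h => ⟨h.integrableOn_dissipation hω hp0 hT,
    (h.energy_le hω hτp hτm hp0 (hε i) (hk i) hT).trans (hoE i)⟩⟩, fun T₁ T₂ h1 h12 => ?_⟩
  set B : ℝ → ℝ := fun A => 2 ^ (p / 2) * c * (ν₀⁻¹ * A + (T₂ - T₁) * A ^ (p / 2)) with hB
  have hBc : Continuous B := continuous_const.mul ((continuous_const.mul continuous_id).add
    (continuous_const.mul (continuous_id.rpow_const fun _ => Or.inr (by linarith))))
  refine ⟨fun i => B (TwoPhase.E₀ Ωp u₀ + o i) - B (TwoPhase.E₀ Ωp u₀), ?_,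
    fun i T hT u φ h => ?_⟩
  · have h3 := (hBc.tendsto (TwoPhase.E₀ Ωp u₀ + 0)).comp (ho.const_add (TwoPhase.E₀ Ωp u₀))
    simpa using h3.sub_const (B (TwoPhase.E₀ Ωp u₀))
  · rw [add_sub_cancel]
    exact h.integral_w1pNormPow_le hω hτp hτm hp0 (hε i) (hk i) hν hc0 hc (hoE i) h1 h12.le hT
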